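/- Conventions. Manifolds are smooth, finite-dimensional, Hausdorff and second countable, without boundary. For a manifold $X$ let $\mathbb{T}X=TX\oplus T^*X$, with inner product $\langle v+\alpha,w+\beta\rangle=\tfrac12(\alpha(w)+\beta(v))$ and Dorfman bracket $[v+\alpha,w+\beta]=[v,w]+\mathcal L_v\beta-\iota_w d\alpha$, both extended complex bilinearly to $\mathbb{T}X\otimes\mathbb{C}$. A split structure is a subbundle $E\subseteq\mathbb{T}X$ of some rank $2k$ on which $\langle\,,\rangle$ has signature $(k,k)$. A framing of $E$ over an open set $U$ is a real vector space $V\subseteq\Gamma_U(E)$ with $\dim V=\operatorname{rank}E$ that generates $\Gamma_U(E)$ over $C^\infty(U)$ (a framing if $U=X$, a local framing otherwise). For a subbundle $S$, $\mathbb{I}_U(S)$ is the set of sections $\mathbf x$ over $U$ with $[\mathbf x,\Gamma_U(S)]\subseteq\Gamma_U(S)$, and $\mathbb{I}(S)=\mathbb{I}_X(S)$. $\mathrm{SGF}(E)$ is the set of bundle endomorphisms $J$ of $E$ that are skew-symmetric and orthogonal for $\langle\,,\rangle$; $L_J=\{\mathbf x-\sqrt{-1}J\mathbf x:\mathbf x\in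 E\}$ is the $\sqrt{-1}$-eigenbundle, $\mathbb{I}(J)=\mathbb{I}(L_J)$, and $J\in\mathrm{CRF}(E)$ if $\Gamma(L_J)$ is closed under the Dorfman bracket. If $E,E'$ are orthogonal split structures, $J\in\mathrm{SGF}(E)$ and $V$ is a framing of $E'$, then $(J,V)$ is a normal pair if $J\in\mathrm{CRF}(E)$ and $V\subseteq\mathbb{I}(J)\cap\mathbb{I}(E')$. If $E_1,E_2$ are orthogonal split structures with framings $V_1,V_2$ and $\Psi\in\mathrm{SGF}(E_1\oplus E_2)$, then the triple $(V_1,V_2,\Psi)$ is admissible if there is an isomorphism $\phi:\Gamma(E_1\otimes\mathbb{C})\to\Gamma(E_2\otimes\mathbb{C})$ of $C^\infty(X,\mathbb{C})$-modules (an admissible isomorphism; it is determined by $\Psi$) with $\phi(V_1\otimes\mathbb{C})=V_2\otimes\mathbb{C}$ and $L_\Psi=\{\mathbf e+\phi(\mathbf e):\mathbf e\in E_1\otimes\mathbb{C}\}$. Theorem. Let $G$ be a Lie group and let $\pi:N\to M$ be a principal $G$-bundle with a flat connection, i.e. an involutive $G$-invariant subbundle $H\subseteq TN$ with $TN=H\oplus\ker(T\pi)$.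 Horizontal lifting $v+\alpha\mapsto\hat v+\alpha\circ T\pi$ identifies $\pi^*\mathbb{T}M$ with $H\oplus\mathrm{Ann}(\ker T\pi)\subseteq\mathbb{T}N$; pull-backs $\pi^*$ of sections, subbundles, framings and endomorphisms are taken in this sense. Let $V'$ be the real span of the fundamental vector fields $\tilde v_i$ of a basis $\{v_i\}$ of the Lie algebra of $G$ and of the dual one-forms $\tilde v_j^*$, which vanish on $H$ and satisfy $\tilde v_j^*(\tilde v_i)=\delta_{ij}$; it is a framing of the vertical split structure $\ker(T\pi)\oplus\mathrm{Ann}(H)$. Let $E,E'$ be orthogonal split structures on $M$, put $E''=E\oplus E'$, let $J\in\mathrm{SGF}(E)$, let $V$ be a framing of $E'$, and let $\Psi\in\mathrm{SGF}(\pi^*E'\oplus\ker(T\pi)\oplus\mathrm{Ann}(H))$. Assume that (i) $V\subseteq\mathbb{I}(E'')$; (ii) every point of $M$ has an open neighbourhood $U$ over which $E$ has a local framing $W$ with $W\subseteq\mathbb{I}_U(E'')$ and $d\langle W,JW\rangle\subseteq\Gamma_U(E'')$; (iii) $(\pi^*V,V',\Psi)$ is an admissible triple, with admissible isomorphism $\phi$.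 Then $\pi^*J\oplus\Psi\in\mathrm{CRF}(\pi^*E''\oplus\ker(T\pi)\oplus\mathrm{Ann}(H))$ if and only if $(J,V)$ is a normal pair and $\phi^{-1}:V'\otimes\mathbb{C}\to\pi^*V\otimes\mathbb{C}$ is an isomorphism of complex Lie algebras for the Dorfman bracket (that is, both spaces are closed under the bracket and $\phi^{-1}$ preserves it). -/

import Mathlib

open scoped Manifold ContDiff

noncomputable section

namespace GenGeom

/-- The indices of inertia of a real quadratic form. -/
def HasSignature {W : Type*} [AddCommGroup W] [Module ℝ W] (Q : QuadraticForm ℝ W) (k l : ℕ) :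
    Prop :=
  sigPos Q = k ∧ sigNeg Q = l

/-! ### The generalized tangent bundle and its Dorfman bracket

`X` is a manifold without boundary modelled on the real vector space `F`. -/

section Basic

variable (F : Type*) [NormedAddCommGroup F] [NormedSpace ℝ F]
variable {X : Type*} [TopologicalSpace X] [ChartedSpace F X]

/-- The fibre `T_p X ⊕ T_p^* X` of the generalized tangent bundle. -/
abbrev GT (p : X) : Type _ :=
  TangentSpace 𝓘(ℝ, F) p × (TangentSpace 𝓘(ℝ, F) p →L[ℝ] ℝ)

variable (X) in
/-- All (not necessarily continuous) sections of the generalized tangent bundle. -/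
abbrev GSec : Type _ := ∀ p : X, GT F p

variable (X) in
/-- A family of linear subspaces of the fibres of the generalized tangent bundle. -/
abbrev GFam : Type _ := ∀ p : X, Submodule ℝ (GT F p)

variable (X) in
/-- A family of linear endomorphisms of the fibres of the generalized tangent bundle. -/
abbrev GEnd : Type _ := ∀ p : X, GT F p →ₗ[ℝ] GT F p

/-- The tautological inner product `⟨v + α, w + β⟩ = (α(w) + β(v)) / 2` on a fibre. -/
def pairing (p : X) : LinearMap.BilinForm ℝ (GT F p) :=
  LinearMap.mk₂ ℝ (fun x y => (1 / 2 : ℝ) * (x.2 y.1 + y.2 x.1))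
    (fun x x' y => by simp only [Prod.fst_add, Prod.snd_add, map_add, add_apply]; ring)
    (fun c x y => by
      simp only [Prod.smul_fst, Prod.smul_snd, map_smul, smul_apply,
        smul_eq_mul]; ring)
    (fun x y y' => by simp only [Prod.fst_add, Prod.snd_add, map_add, add_apply]; ring)
    (fun c x y => by
      simp only [Prod.smul_fst, Prod.smul_snd, map_smul, smul_apply,
        smul_eq_mul]; ring)

/-- The differential of a real function, as a covector. -/
def diff (f : X → ℝ) (p : X) : TangentSpace 𝓘(ℝ, F) p →L[ℝ] ℝ :=
  mfderiv 𝓘(ℝ, F) 𝓘(ℝ, ℝ) f p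

/-- The one-form `α` read in the preferred chart around `p`. -/
def formInChart (α : ∀ q : X, TangentSpace 𝓘(ℝ, F) q →L[ℝ] ℝ) (p : X) : F → (F →L[ℝ] ℝ) :=
  fun u => (α ((extChartAt 𝓘(ℝ, F) p).symm u)).comp
    (mfderiv 𝓘(ℝ, F) 𝓘(ℝ, F) (extChartAt 𝓘(ℝ, F) p).symm u)

/-- `ι_v dα` at `p`, where the exterior derivative is computed in the preferred chart around `p`:
`dα(v, w) = (D_v α)(w) - (D_w α)(v)`. -/
def contractD (α : ∀ q : X, TangentSpace 𝓘(ℝ, F) q →L[ℝ] ℝ) (p : X)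
    (v : TangentSpace 𝓘(ℝ, F) p) : TangentSpace 𝓘(ℝ, F) p →L[ℝ] ℝ :=
  let D : F →L[ℝ] F →L[ℝ] ℝ := fderiv ℝ (formInChart F α p) (extChartAt 𝓘(ℝ, F) p p)
  let A : TangentSpace 𝓘(ℝ, F) p →L[ℝ] F := mfderiv 𝓘(ℝ, F) 𝓘(ℝ, F) (extChartAt 𝓘(ℝ, F) p) p
  (D (A v) - D.flip (A v)).comp A

/-- The Dorfman bracket `[v + α, w + β] = [v, w] + L_v β - ι_w dα`, with the Lie derivative given by
Cartan's formula `L_v β = d(β(v)) + ι_v dβ`. -/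
def dorfman (x y : GSec F X) : GSec F X := fun p =>
  (VectorField.mlieBracket 𝓘(ℝ, F) (fun q => (x q).1) (fun q => (y q).1) p,
    diff F (fun q => (y q).2 (x q).1) p + contractD F (fun q => (y q).2) p (x p).1
      - contractD F (fun q => (x q).2) p (y p).1)

/-- `E` and `E'` are orthogonal to each other. -/
def Orthogonal (E E' : GFam F X) : Prop :=
  ∀ p, ∀ x ∈ E p, ∀ y ∈ E' p, pairing F p x y = 0

variable [IsManifold 𝓘(ℝ, F) ∞ X]

/-- The section `s = v + α` is smooth on `U`: both the vector field `v` and the one-form `α` are. -/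
def SmoothOn (U : Set X) (s : GSec F X) : Prop :=
  ContMDiffOn 𝓘(ℝ, F) (𝓘(ℝ, F).prod 𝓘(ℝ, F)) ∞
    (fun p => (Bundle.TotalSpace.mk' F p (s p).1 :
      Bundle.TotalSpace F (fun p : X => TangentSpace 𝓘(ℝ, F) p))) U ∧
  ContMDiffOn 𝓘(ℝ, F) (𝓘(ℝ, F).prod 𝓘(ℝ, F →L[ℝ] ℝ)) ∞
    (fun p => (Bundle.TotalSpace.mk' (F →L[ℝ] ℝ) p (s p).2 :
      Bundle.TotalSpace (F →L[ℝ] ℝ) (fun p : X => TangentSpace 𝓘(ℝ, F) p →L[ℝ] ℝ))) U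

/-! ### Subbundles, split structures, framings, normalizers -/

/-- `E` is a smooth subbundle of rank `r`. -/
def IsSubbundle (E : GFam F X) (r : ℕ) : Prop :=
  ∀ p : X, ∃ U : Set X, IsOpen U ∧ p ∈ U ∧ ∃ e : Fin r → GSec F X,
    (∀ i, SmoothOn F U (e i)) ∧ ∀ q ∈ U, LinearIndependent ℝ (fun i => e i q) ∧
      Submodule.span ℝ (Set.range fun i => e i q) = E q

/-- The quadratic form of the tautological inner product on the fibre `E_p`. -/
def fibreForm (E : GFam F X) (p : X) : QuadraticForm ℝ (E p) :=
  QuadraticMap.restrict (pairing F p).toQuadraticMap (E p)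

/-- `E` is a split structure: a subbundle of some rank `2k` on which the tautological inner product
has signature `(k, k)` (hence is nondegenerate). -/
def IsSplit (E : GFam F X) : Prop :=
  ∃ k : ℕ, IsSubbundle F E (2 * k) ∧
    ∀ p, HasSignature (W := E p) (fibreForm F E p) k k

/-- `Γ_U(E)`: the sections that are smooth and take values in `E` on `U`. -/
def sections (U : Set X) (E : GFam F X) : Set (GSec F X) :=
  {s | SmoothOn F U s ∧ ∀ q ∈ U, s q ∈ E q}

/-- `V` is a framing of `E` on the open set `U`: a real vector space of smooth sections of `E` over
`U` whose dimension is the rank of `E` and which generates `Γ_U(E)` over the smooth functions. -/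
def IsFraming (U : Set X) (E : GFam F X) (V : Submodule ℝ (GSec F X)) : Prop :=
  Module.Finite ℝ V ∧ (∀ q ∈ U, Module.finrank ℝ V = Module.finrank ℝ (E q)) ∧
  (∀ v ∈ V, v ∈ sections F U E) ∧
  ∀ s ∈ sections F U E, ∃ (n : ℕ) (f : Fin n → X → ℝ) (v : Fin n → GSec F X),
    (∀ i, ContMDiffOn 𝓘(ℝ, F) 𝓘(ℝ, ℝ) ∞ (f i) U ∧ v i ∈ V) ∧
    ∀ q ∈ U, s q = ∑ i, f i q • v i q

/-- The normalizer of `E` over `U`: the smooth sections `x` such that `[x, s]` is a section of `E`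
for all sections `s` of `E` over `U`. (Smoothness of `[x, s]` is automatic.) -/
def normalizer (U : Set X) (E : GFam F X) : Set (GSec F X) :=
  {x | SmoothOn F U x ∧ ∀ s ∈ sections F U E, ∀ q ∈ U, dorfman F x s q ∈ E q}

/-- `J` is a split generalized `F`-structure on the split structure `E`: a smooth bundle
endomorphism of `E`, skew-symmetric and orthogonal. It is represented by its extension by `0` to the
orthogonal complement of `E`. -/
structure IsSGF (E : GFam F X) (J : GEnd F X) : Prop where
  split : IsSplit F E
  mapsTo : ∀ p, ∀ x ∈ E p, J p x ∈ E p
  zero : ∀ p x, (∀ y ∈ E p, pairing F p x y = 0) → J p x = 0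
  skew : ∀ p, ∀ x ∈ E p, ∀ y ∈ E p, pairing F p (J p x) y = - pairing F p x (J p y)
  orthogonal : ∀ p, ∀ x ∈ E p, ∀ y ∈ E p, pairing F p (J p x) (J p y) = pairing F p x y
  smooth : ∀ U : Set X, IsOpen U → ∀ s ∈ sections F U E, SmoothOn F U (fun p => J p (s p))

end Basic

/-! ### Complexification -/

/-- The complexification `W ⊗ ℂ = W ⊕ iW` of a real vector space: `(x, y)` stands for `x + iy`. -/
def Cx (W : Type*) : Type _ := W × W

namespace Cx

variable {W : Type*}

instance [AddCommGroup W] : AddCommGroup (Cx W) := inferInstanceAs (AddCommGroup (W × W))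

/-- The element `x + iy`. -/
def mk (x y : W) : Cx W := (x, y)

/-- The real part. -/
def re (z : Cx W) : W := Prod.fst z

/-- The imaginary part. -/
def im (z : Cx W) : W := Prod.snd z

theorem ext {z w : Cx W} (h : z.re = w.re) (h' : z.im = w.im) : z = w := Prod.ext h h'

@[simp] theorem re_mk (x y : W) : (mk x y).re = x := rfl
@[simp] theorem im_mk (x y : W) : (mk x y).im = y := rfl

variable [AddCommGroup W]

@[simp] theorem re_add (z w : Cx W) : (z + w).re = z.re + w.re := rfl
@[simp] theorem im_add (z w : Cx W) : (z + w).im = z.im + w.im := rfl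
@[simp] theorem re_zero : (0 : Cx W).re = 0 := rfl
@[simp] theorem im_zero : (0 : Cx W).im = 0 := rfl

variable [Module ℝ W]

instance : SMul ℂ (Cx W) where
  smul c z := mk (c.re • z.re - c.im • z.im) (c.re • z.im + c.im • z.re)

@[simp] theorem re_smul (c : ℂ) (z : Cx W) : (c • z).re = c.re • z.re - c.im • z.im := rfl
@[simp] theorem im_smul (c : ℂ) (z : Cx W) : (c • z).im = c.re • z.im + c.im • z.re := rfl

instance : Module ℂ (Cx W) where
  one_smul z := ext (by simp) (by simp)
  mul_smul a b z := ext
    (by simp only [re_smul, im_smul, Complex.mul_re, Complex.mul_im]; module)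
    (by simp only [re_smul, im_smul, Complex.mul_re, Complex.mul_im]; module)
  smul_zero c := ext (by simp) (by simp)
  smul_add c z w := ext (by simp only [re_smul, re_add, im_add]; module)
    (by simp only [im_smul, re_add, im_add]; module)
  add_smul a b z := ext
    (by simp only [re_smul, re_add, Complex.add_re, Complex.add_im]; module)
    (by simp only [im_smul, im_add, Complex.add_re, Complex.add_im]; module)
  zero_smul z := ext (by simp) (by simp)

end Cx

section Complex

variable (F : Type*) [NormedAddCommGroup F] [NormedSpace ℝ F]
variable {X : Type*} [TopologicalSpace X] [ChartedSpace F X]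

variable (X) in
/-- All sections of the complexified generalized tangent bundle. -/
abbrev CSec : Type _ := ∀ p : X, Cx (GT F p)

variable {F} in
/-- The complex section `x + iy`. -/
def csec (x y : GSec F X) : CSec F X := fun p => Cx.mk (x p) (y p)

variable {F} in
/-- Real part of a complex section. -/
def reSec (s : CSec F X) : GSec F X := fun p => (s p).re

variable {F} in
/-- Imaginary part of a complex section. -/
def imSec (s : CSec F X) : GSec F X := fun p => (s p).im

/-- The complex bilinear extension of the Dorfman bracket. -/
def cdorfman (s t : CSec F X) : CSec F X :=
  csec (dorfman F (reSec s) (reSec t) - dorfman F (imSec s) (imSec t))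
    (dorfman F (reSec s) (imSec t) + dorfman F (imSec s) (reSec t))

/-- The `i`-eigenbundle `L_J = {x - iJx | x ∈ E}`, as a family of subsets of the fibres. -/
def eigenbundle (E : GFam F X) (J : GEnd F X) (p : X) : Set (Cx (GT F p)) :=
  {z | ∃ x ∈ E p, z = Cx.mk x (-(J p x))}

/-- `ℂ`, as a real manifold, is a smooth ring. -/
instance : ContMDiffRing 𝓘(ℝ, ℂ) ∞ ℂ :=
  { instNormedSpaceLieAddGroup with
    contMDiff_mul := by
      rw [contMDiff_iff]
      refine ⟨continuous_mul, fun x y => ?_⟩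
      simp only [mfld_simps, chartAt_self_eq]
      rw [contDiffOn_univ]
      exact contDiff_mul }

variable (X) in
/-- The ring `C^∞(X, ℂ)`. -/
abbrev CFun : Type _ := C^∞⟮𝓘(ℝ, F), X; 𝓘(ℝ, ℂ), ℂ⟯

/-- Complex functions act on complex sections pointwise. -/
instance : Module (CFun F X) (CSec F X) :=
  Module.compHom (CSec F X) (ContMDiffMap.coeFnRingHom : CFun F X →+* (X → ℂ))

theorem CFun.smooth_re (f : CFun F X) :
    ContMDiffOn 𝓘(ℝ, F) 𝓘(ℝ, ℝ) ∞ (fun p => (f p).re) Set.univ :=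
  (Complex.reCLM.contMDiff.comp f.contMDiff).contMDiffOn

theorem CFun.smooth_im (f : CFun F X) :
    ContMDiffOn 𝓘(ℝ, F) 𝓘(ℝ, ℝ) ∞ (fun p => (f p).im) Set.univ :=
  (Complex.imCLM.contMDiff.comp f.contMDiff).contMDiffOn

theorem smul_csec_apply (f : CFun F X) (s : CSec F X) (p : X) : (f • s) p = f p • s p := rfl

variable [IsManifold 𝓘(ℝ, F) ∞ X]

/-- Smoothness of a complex section. -/
def CSmooth (s : CSec F X) : Prop :=
  SmoothOn F Set.univ (reSec s) ∧ SmoothOn F Set.univ (imSec s)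

/-- `Γ(L_J)`. -/
def eigensections (E : GFam F X) (J : GEnd F X) : Set (CSec F X) :=
  {s | CSmooth F s ∧ ∀ p, s p ∈ eigenbundle F E J p}

/-- `I(J) = I(L_J)`: the smooth complex sections `x` with `[x, Γ(L_J)] ⊆ Γ(L_J)`. -/
def normalizerSGF (E : GFam F X) (J : GEnd F X) : Set (CSec F X) :=
  {x | CSmooth F x ∧ ∀ s ∈ eigensections F E J, ∀ p, cdorfman F x s p ∈ eigenbundle F E J p}

/-- `J ∈ CRF(E)`: `J` is a split generalized `F`-structure on `E` and `L_J` is closed under the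
Dorfman bracket. -/
def IsCRF (E : GFam F X) (J : GEnd F X) : Prop :=
  IsSGF F E J ∧ ∀ s ∈ eigensections F E J, ∀ t ∈ eigensections F E J, ∀ p,
    cdorfman F s t p ∈ eigenbundle F E J p

/-- `(J, V)` is a normal pair: `J ∈ CRF(E)`, `V` is a framing of the split structure `E' ⊆ E^⊥`, and
`V ⊆ I(J) ∩ I(E')`. -/
structure IsNormalPair (E E' : GFam F X) (J : GEnd F X) (V : Submodule ℝ (GSec F X)) : Prop where
  crf : IsCRF F E J
  split : IsSplit F E'
  orthogonal : Orthogonal F E E'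
  framing : IsFraming F Set.univ E' V
  normalizes_J : ∀ v ∈ V, csec v 0 ∈ normalizerSGF F E J
  normalizes_E' : ∀ v ∈ V, v ∈ normalizer F Set.univ E'

/-- `E` admits, around every point, a local framing `W ⊆ I_U(E'')` with
`d⟨W, JW⟩ ⊆ Γ_U(E'')`. -/
def HasAdaptedLocalFramings (E E'' : GFam F X) (J : GEnd F X) : Prop :=
  ∀ p : X, ∃ U : Set X, IsOpen U ∧ p ∈ U ∧ ∃ W : Submodule ℝ (GSec F X),
    IsFraming F U E W ∧ (∀ w ∈ W, w ∈ normalizer F U E'') ∧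
    ∀ w ∈ W, ∀ w' ∈ W, ∀ q ∈ U,
      ((0, diff F (fun r => pairing F r (w r) (J r (w' r))) q) : GT F q) ∈ E'' q

end Complex

section Modules

variable (F : Type*) [NormedAddCommGroup F] [NormedSpace ℝ F]
variable {X : Type*} [TopologicalSpace X] [ChartedSpace F X] [IsManifold 𝓘(ℝ, F) ∞ X]

theorem SmoothOn.add {U : Set X} {s t : GSec F X} (hs : SmoothOn F U s) (ht : SmoothOn F U t) :
    SmoothOn F U (s + t) :=
  ⟨hs.1.add_section ht.1, hs.2.add_section ht.2⟩

theorem SmoothOn.zero {U : Set X} : SmoothOn F U (0 : GSec F X) :=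
  ⟨(Bundle.contMDiff_zeroSection ℝ _).contMDiffOn, (Bundle.contMDiff_zeroSection ℝ _).contMDiffOn⟩

theorem SmoothOn.sub {U : Set X} {s t : GSec F X} (hs : SmoothOn F U s) (ht : SmoothOn F U t) :
    SmoothOn F U (s - t) :=
  ⟨hs.1.sub_section ht.1, hs.2.sub_section ht.2⟩

theorem SmoothOn.smul {U : Set X} {f : X → ℝ} {s : GSec F X}
    (hf : ContMDiffOn 𝓘(ℝ, F) 𝓘(ℝ, ℝ) ∞ f U) (hs : SmoothOn F U s) :
    SmoothOn F U (fun p => f p • s p) :=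
  ⟨hf.smul_section hs.1, hf.smul_section hs.2⟩

/-- `Γ(E ⊗ ℂ)`, as a module over `C^∞(X, ℂ)`. -/
def csections (E : GFam F X) : Submodule (CFun F X) (CSec F X) where
  carrier := {s | CSmooth F s ∧ ∀ p, (s p).re ∈ E p ∧ (s p).im ∈ E p}
  add_mem' hs ht :=
    ⟨⟨hs.1.1.add F ht.1.1, hs.1.2.add F ht.1.2⟩,
      fun p => ⟨add_mem (hs.2 p).1 (ht.2 p).1, add_mem (hs.2 p).2 (ht.2 p).2⟩⟩
  zero_mem' := ⟨⟨SmoothOn.zero F, SmoothOn.zero F⟩, fun _ => ⟨zero_mem _, zero_mem _⟩⟩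
  smul_mem' f _ hs :=
    ⟨⟨((hs.1.1.smul F (CFun.smooth_re F f)).sub F (hs.1.2.smul F (CFun.smooth_im F f))),
      ((hs.1.2.smul F (CFun.smooth_re F f)).add F (hs.1.1.smul F (CFun.smooth_im F f)))⟩,
      fun p => ⟨sub_mem (Submodule.smul_mem _ _ (hs.2 p).1) (Submodule.smul_mem _ _ (hs.2 p).2),
        add_mem (Submodule.smul_mem _ _ (hs.2 p).2) (Submodule.smul_mem _ _ (hs.2 p).1)⟩⟩

/-- The subset `V ⊗ ℂ = {x + iy | x, y ∈ V}` of `Γ(E ⊗ ℂ)`. -/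
def cframing (E : GFam F X) (V : Submodule ℝ (GSec F X)) : Set (csections F E) :=
  {s | reSec (s : CSec F X) ∈ V ∧ imSec (s : CSec F X) ∈ V}

/-- `φ` is an admissible isomorphism for the triple `(V₁, V₂, Ψ)`: it is an isomorphism
`Γ(E₁ ⊗ ℂ) → Γ(E₂ ⊗ ℂ)` of `C^∞(X, ℂ)`-modules with `φ(V₁ ⊗ ℂ) = V₂ ⊗ ℂ`, whose graph is the
`i`-eigenbundle of the structure `Ψ` on `E₁ ⊕ E₂`. -/
structure IsAdmissible {E₁ E₂ : GFam F X} (V₁ V₂ : Submodule ℝ (GSec F X)) (Ψ : GEnd F X)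
    (φ : csections F E₁ ≃ₗ[CFun F X] csections F E₂) : Prop where
  map_framing : φ '' cframing F E₁ V₁ = cframing F E₂ V₂
  graph : eigensections F (E₁ ⊔ E₂) Ψ =
    {s | ∃ e : csections F E₁, s = (e : CSec F X) + (φ e : CSec F X)}

/-- `φ` restricts to an isomorphism of complex Lie algebras `V₁ ⊗ ℂ → V₂ ⊗ ℂ` for the Dorfman
bracket: both spaces are closed under the bracket, and `φ` is a bijection between them that
intertwines the brackets. (Skew-symmetry of the bracket on these spaces is automatic when the
inner products of elements of `Vᵢ` are constant functions; the Jacobi identity always holds.) -/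
structure IsLieIso {E₁ E₂ : GFam F X} (V₁ V₂ : Submodule ℝ (GSec F X))
    (φ : csections F E₁ ≃ₗ[CFun F X] csections F E₂) : Prop where
  closed_left : ∀ a ∈ cframing F E₁ V₁, ∀ b ∈ cframing F E₁ V₁, ∃ c ∈ cframing F E₁ V₁,
    (c : CSec F X) = cdorfman F a b
  closed_right : ∀ a ∈ cframing F E₂ V₂, ∀ b ∈ cframing F E₂ V₂, ∃ c ∈ cframing F E₂ V₂,
    (c : CSec F X) = cdorfman F a b
  map_framing : φ '' cframing F E₁ V₁ = cframing F E₂ V₂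
  map_bracket : ∀ a ∈ cframing F E₁ V₁, ∀ b ∈ cframing F E₁ V₁, ∀ c ∈ cframing F E₁ V₁,
    (c : CSec F X) = cdorfman F a b → (φ c : CSec F X) = cdorfman F (φ a) (φ b)

end Modules

/-! ### Flat principal bundles -/

section Principal

variable (FM FN FG : Type*) [NormedAddCommGroup FM] [NormedSpace ℝ FM]
  [NormedAddCommGroup FN] [NormedSpace ℝ FN] [NormedAddCommGroup FG] [NormedSpace ℝ FG]
variable {M N : Type*} [TopologicalSpace M] [ChartedSpace FM M]
  [TopologicalSpace N] [ChartedSpace FN N]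

/-- `π : N → M` is a smooth principal `G`-bundle, the right action of `G` on `N` being
`q · g = MulOpposite.op g • q`: around each point there are `G`-equivariant smooth trivializations
`π⁻¹(U) ≃ U × G` over `U`. -/
structure IsPrincipalBundle (G : Type*) [TopologicalSpace G] [ChartedSpace FG G] [Group G]
    [MulAction Gᵐᵒᵖ N] (π : N → M) : Prop where
  smooth_action : ContMDiff (𝓘(ℝ, FN).prod 𝓘(ℝ, FG)) 𝓘(ℝ, FN) ∞
    (fun x : N × G => MulOpposite.op x.2 • x.1)
  smooth_proj : ContMDiff 𝓘(ℝ, FN) 𝓘(ℝ, FM) ∞ π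
  proj_smul : ∀ (q : N) (g : G), π (MulOpposite.op g • q) = π q
  locally_trivial : ∀ p : M, ∃ (U : Set M) (e : OpenPartialHomeomorph N (M × G)),
    IsOpen U ∧ p ∈ U ∧ e.source = π ⁻¹' U ∧ e.target = U ×ˢ Set.univ ∧
    ContMDiffOn 𝓘(ℝ, FN) (𝓘(ℝ, FM).prod 𝓘(ℝ, FG)) ∞ e e.source ∧
    ContMDiffOn (𝓘(ℝ, FM).prod 𝓘(ℝ, FG)) 𝓘(ℝ, FN) ∞ e.symm e.target ∧
    (∀ q ∈ e.source, (e q).1 = π q) ∧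
    ∀ q ∈ e.source, ∀ g : G, (e (MulOpposite.op g • q)).2 = (e q).2 * g

/-- A family of subspaces of the tangent spaces of `N`. -/
abbrev Distribution (N : Type*) [TopologicalSpace N] [ChartedSpace FN N] : Type _ :=
  ∀ q : N, Submodule ℝ (TangentSpace 𝓘(ℝ, FN) q)

/-- The fundamental vector field generated by `v`: its value at `q` is the derivative at `1` of
`g ↦ q · g` in the direction `v`. -/
def fundamentalField {G : Type*} [TopologicalSpace G] [ChartedSpace FG G] [Group G]
    [MulAction Gᵐᵒᵖ N] (v : GroupLieAlgebra 𝓘(ℝ, FG) G) (q : N) : TangentSpace 𝓘(ℝ, FN) q :=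
  mfderiv 𝓘(ℝ, FG) 𝓘(ℝ, FN) (fun g : G => MulOpposite.op g • q) 1 v

/-- The horizontal lift `T_{π(q)} M → H_q ⊆ T_q N`: the inverse of the isomorphism
`T_q π : H_q → T_{π(q)} M`. -/
def horLift (π : N → M) (H : Distribution FN N) (q : N) :
    TangentSpace 𝓘(ℝ, FM) (π q) →L[ℝ] TangentSpace 𝓘(ℝ, FN) q :=
  (H q).subtypeL.comp ((mfderiv 𝓘(ℝ, FN) 𝓘(ℝ, FM) π q).comp (H q).subtypeL).inverse

/-- The identification of the fibre of `π^*𝕋M` at `q` with `H_q ⊕ Ann(ker T_q π)`: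
`v + α ↦ v̂ + α ∘ T_q π`. -/
def liftAt (π : N → M) (H : Distribution FN N) (q : N) : GT FM (π q) →ₗ[ℝ] GT FN q where
  toFun x := (horLift FM FN π H q x.1, x.2.comp (mfderiv 𝓘(ℝ, FN) 𝓘(ℝ, FM) π q))
  map_add' x y := by simp
  map_smul' c x := by simp

/-- The map `𝕋_q N → 𝕋_{π(q)} M`, `w + β ↦ T_q π(w) + β ∘ (horizontal lift)`. It is the inverse of
`liftAt` on `H_q ⊕ Ann(ker T_q π)` and vanishes on the vertical split structure. -/
def dropAt (π : N → M) (H : Distribution FN N) (q : N) : GT FN q →ₗ[ℝ] GT FM (π q) where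
  toFun x := (mfderiv 𝓘(ℝ, FN) 𝓘(ℝ, FM) π q x.1, x.2.comp (horLift FM FN π H q))
  map_add' x y := by simp
  map_smul' c x := by simp

/-- `π^*` on sections: the horizontal lifting. -/
def pullSec (π : N → M) (H : Distribution FN N) : GSec FM M →ₗ[ℝ] GSec FN N where
  toFun s q := liftAt FM FN π H q (s (π q))
  map_add' s t := funext fun q => (liftAt FM FN π H q).map_add (s (π q)) (t (π q))
  map_smul' c s := funext fun q => (liftAt FM FN π H q).map_smul c (s (π q))

/-- `π^*E`, as a subbundle of `𝕋N`. -/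
def pullFam (π : N → M) (H : Distribution FN N) (E : GFam FM M) : GFam FN N :=
  fun q => (E (π q)).map (liftAt FM FN π H q)

/-- `π^*J`, extended by `0` to the vertical split structure. -/
def pullEnd (π : N → M) (H : Distribution FN N) (J : GEnd FM M) : GEnd FN N :=
  fun q => liftAt FM FN π H q ∘ₗ J (π q) ∘ₗ dropAt FM FN π H q

/-- The vertical split structure `ker(Tπ) ⊕ Ann(H)`. -/
def vertical (π : N → M) (H : Distribution FN N) : GFam FN N := fun q =>
  { carrier := {x | mfderiv 𝓘(ℝ, FN) 𝓘(ℝ, FM) π q x.1 = 0 ∧ ∀ h ∈ H q, x.2 h = 0}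
    add_mem' := fun {x y} hx hy =>
      ⟨by simp [hx.1, hy.1], fun h hh => by simp [hx.2 h hh, hy.2 h hh]⟩
    zero_mem' := ⟨by simp, fun h _ => by simp⟩
    smul_mem' := fun c x hx => ⟨by simp [hx.1], fun h hh => by simp [hx.2 h hh]⟩ }

/-- The vertical framing `V' = span_ℝ {ṽᵢ, ṽⱼ^*}`: it consists of the sections `ṽ + λ^*`, where `ṽ`
is the fundamental vector field of an element `v` of the Lie algebra of `G` and `λ^*` is the
one-form that vanishes on `H` and takes the constant value `λ(w)` on `w̃`, for a linear form `λ` on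
the Lie algebra. -/
def verticalFraming (G : Type*) [TopologicalSpace G] [ChartedSpace FG G] [Group G]
    [MulAction Gᵐᵒᵖ N] (H : Distribution FN N) : Submodule ℝ (GSec FN N) where
  carrier := {s | ∃ (v : GroupLieAlgebra 𝓘(ℝ, FG) G) (l : GroupLieAlgebra 𝓘(ℝ, FG) G →L[ℝ] ℝ),
    ∀ q, (s q).1 = fundamentalField FN FG v q ∧ (∀ h ∈ H q, (s q).2 h = 0) ∧
      ∀ w : GroupLieAlgebra 𝓘(ℝ, FG) G, (s q).2 (fundamentalField FN FG w q) = l w}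
  add_mem' := by
    rintro s t ⟨v, l, hs⟩ ⟨v', l', ht⟩
    refine ⟨v + v', l + l', fun q => ⟨?_, fun h hh => ?_, fun w => ?_⟩⟩
    · rw [Pi.add_apply, Prod.fst_add, (hs q).1, (ht q).1]
      exact (map_add _ _ _).symm
    · rw [Pi.add_apply, Prod.snd_add, add_apply, (hs q).2.1 h hh, (ht q).2.1 h hh, add_zero]
    · rw [Pi.add_apply, Prod.snd_add, add_apply, (hs q).2.2 w, (ht q).2.2 w, add_apply]
  zero_mem' :=
    ⟨0, 0, fun q => ⟨(map_zero _).symm, fun h _ => rfl, fun w => rfl⟩⟩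
  smul_mem' := by
    rintro c s ⟨v, l, hs⟩
    refine ⟨c • v, c • l, fun q => ⟨?_, fun h hh => ?_, fun w => ?_⟩⟩
    · rw [Pi.smul_apply, Prod.smul_fst, (hs q).1]
      exact (map_smul _ _ _).symm
    · rw [Pi.smul_apply, Prod.smul_snd, smul_apply, (hs q).2.1 h hh, smul_zero]
    · rw [Pi.smul_apply, Prod.smul_snd, smul_apply, (hs q).2.2 w, smul_apply]

/-- Smoothness of a vector field on `U`. -/
def VSmoothOn [IsManifold 𝓘(ℝ, FN) ∞ N] (U : Set N) (v : ∀ q : N, TangentSpace 𝓘(ℝ, FN) q) :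
    Prop :=
  ContMDiffOn 𝓘(ℝ, FN) (𝓘(ℝ, FN).prod 𝓘(ℝ, FN)) ∞
    (fun q => (Bundle.TotalSpace.mk' FN q (v q) :
      Bundle.TotalSpace FN (fun q : N => TangentSpace 𝓘(ℝ, FN) q))) U

/-- `H` is a flat `G`-invariant Ehresmann connection on `π : N → M`: an involutive, `G`-invariant
subbundle of `TN` complementary to `ker(Tπ)`. -/
structure IsFlatConnection [IsManifold 𝓘(ℝ, FN) ∞ N] (G : Type*) [TopologicalSpace G]
    [ChartedSpace FG G] [Group G] [MulAction Gᵐᵒᵖ N] (π : N → M) (H : Distribution FN N) :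
    Prop where
  subbundle : ∀ p : N, ∃ U : Set N, IsOpen U ∧ p ∈ U ∧
    ∃ (r : ℕ) (e : Fin r → ∀ q : N, TangentSpace 𝓘(ℝ, FN) q), (∀ i, VSmoothOn FN U (e i)) ∧
      ∀ q ∈ U, LinearIndependent ℝ (fun i => e i q) ∧
        Submodule.span ℝ (Set.range fun i => e i q) = H q
  isCompl : ∀ q, IsCompl (H q) (mfderiv 𝓘(ℝ, FN) 𝓘(ℝ, FM) π q).ker
  involutive : ∀ v w : (∀ q : N, TangentSpace 𝓘(ℝ, FN) q),
    VSmoothOn FN Set.univ v → VSmoothOn FN Set.univ w →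
    (∀ q, v q ∈ H q) → (∀ q, w q ∈ H q) → ∀ q, VectorField.mlieBracket 𝓘(ℝ, FN) v w q ∈ H q
  invariant : ∀ (q : N) (g : G),
    (H q).map (mfderiv 𝓘(ℝ, FN) 𝓘(ℝ, FN) (fun q' : N => MulOpposite.op g • q') q).toLinearMap =
      H (MulOpposite.op g • q)

end Principal

end GenGeom

end

open GenGeom

/-! Let `L` be the `i`-eigenbundle of `π^*J ⊕ Ψ`. It is the sum of `π^*L_J` and of the graph of `φ`,
so locally its sections are combinations, over smooth complex functions, of two kinds of generators:
lifts `π^*s` with `s ∈ Γ(L_J)`, and `v + φ(v)` with `v` in the lifted framing. As `L` is isotropic,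
the Dorfman bracket is skew-symmetric on its sections, and with the Leibniz rule in the right slot
closure of `Γ(L)` need only be tested on generators.

Brackets of generators are governed by three facts. Lifting commutes with the bracket, because `H`
is involutive (`dorfman_pullSec`). A lift and an element of `V'` have bracket zero, because `H` is
invariant under the group (`dorfman_pullSec_verticalFraming`). The space `V'` is closed under the
bracket, because fundamental fields form a Lie algebra and the vertical forms are constant on them
(`dorfman_mem_verticalFraming`). Together they give `[π^*s + c, π^*t + c'] = π^*[s, t] + [c, c']`
for vertical `c`, `c'` (`cdorfman_cpull_add`). The brackets to be considered are therefore `π^*[s,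
t]`, `π^*[v, s]` and `π^*[v, w] + [φ(v), φ(w)]`.

If `(J, V)` is a normal pair and `φ⁻¹` preserves brackets, the first two are lifts of sections of
`L_J` and the third lies on the graph of `φ`; hence `L` is closed.

Conversely, a lift that lies in `L` lies in `π^*L_J` (`mem_of_cliftAt_mem`). This requires `φ` to be
injective on every fibre, which holds because an element of `V'` that vanishes at one point is zero.
The first two brackets now show that `L_J` is closed and that `V ⊆ I(J)`. In the third, `[v, w]` is
real and `[φ(v), φ(w)]` is vertical, which forces `[v, w]` into `E'`; by the Leibniz rule `V ⊆
I(E')`. With `c = [φ(v), φ(w)]`, subtracting `φ⁻¹(c) + c ∈ L` leaves a lift in `L` whose real part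
lies in `π^*E'`. It lies in `π^*L_J` as well, so it is zero and `φ⁻¹(c) = [v, w]`.

The calculus underneath avoids flows. Covector parts are compared on smooth fields by Cartan's
formula, and Lie brackets are transported along `π`, the orbit maps and the action map by
relatedness (`mlieBracket_related`). -/

noncomputable section

open scoped Topology
open Filter Set Bundle

set_option linter.unusedSectionVars false

namespace GenGeom

/-! ### Vector fields, one-forms and Lie brackets in a chart -/

section Chart

variable {E : Type*} [NormedAddCommGroup E] [NormedSpace ℝ E]
  {H : Type*} [TopologicalSpace H] {I : ModelWithCorners ℝ E H}
  {X : Type*} [TopologicalSpace X] [ChartedSpace H X]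
  {F' : Type*} [NormedAddCommGroup F'] [NormedSpace ℝ F']

variable (I) in
/-- The derivative of a vector-valued function in the direction of a tangent vector. -/
def dirDeriv (f : X → F') (p : X) (v : TangentSpace I p) : F' := mfderiv I 𝓘(ℝ, F') f p v

variable (I) in
/-- A tangent vector at `p`, read in the preferred chart around `p`. -/
def tangentCoord {p : X} (v : TangentSpace I p) : E := v

variable (I) in
/-- The vector field `V` read in the preferred chart around `p`. -/
def chartField (p : X) (V : ∀ q : X, TangentSpace I q) (u : E) : E :=
  VectorField.mpullbackWithin 𝓘(ℝ, E) I (extChartAt I p).symm V (range I) u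

theorem chartField_self [IsManifold I 1 X] (p : X) (V : ∀ q : X, TangentSpace I q) :
    chartField I p V (extChartAt I p p) = tangentCoord I (V p) := by
  have h : ∀ q (_ : q = p), tangentCoord I (V q) = tangentCoord I (V p) := by
    rintro _ rfl; rfl
  exact (mfderivWithin_extChartAt_symm_inverse_apply (𝕜 := ℝ) (E := E) (I := I) (x := p)
    (tangentCoord (E := E) I (V ((extChartAt I p).symm (extChartAt I p p))))).trans
    (h _ (extChartAt_to_inv p))

variable [I.Boundaryless]

/-- `mlieBracket` is the flat bracket of the chart fields, pulled back by the derivative of the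
preferred chart; at the base point of that chart the derivative is the identity. -/
theorem mlieBracket_eq_lieBracket_chartField [IsManifold I 1 X] (p : X)
    (V W : ∀ q : X, TangentSpace I q) :
    tangentCoord I (VectorField.mlieBracket I V W p) =
      VectorField.lieBracket ℝ (chartField I p V) (chartField I p W) (extChartAt I p p) := by
  have h1 : VectorField.mlieBracket I V W p = (mfderiv I 𝓘(ℝ, E) (extChartAt I p) p).inverse
    ((VectorField.lieBracketWithin ℝ (chartField I p V) (chartField I p W)
      ((extChartAt I p).symm ⁻¹' univ ∩ range I)) ((extChartAt I p p))) := rfl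
  have h2 : ∀ x : E, (mfderiv I 𝓘(ℝ, E) (extChartAt I p) p).inverse x = x := by
    intro x
    rw [mfderiv_extChartAt_self]
    exact congrArg (fun f : E →L[ℝ] E => f x) (ContinuousLinearMap.inverse_id)
  simp only [I.range_eq_univ, preimage_univ, inter_univ, VectorField.lieBracketWithin_univ] at h1
  exact h1.trans (h2 _)

theorem differentiableAt_chartField [CompleteSpace E] [IsManifold I 2 X] {p : X}
    {V : ∀ q : X, TangentSpace I q}
    (hV : MDifferentiableAt I I.tangent (fun q => (⟨q, V q⟩ : TangentBundle I X)) p) :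
    DifferentiableAt ℝ (chartField I p V) (extChartAt I p p) := by
  have := hV.mdifferentiableWithinAt (s := univ)
    |>.differentiableWithinAt_mpullbackWithin_vectorField
  simp only [I.range_eq_univ, preimage_univ, inter_univ] at this
  rw [← differentiableWithinAt_univ]
  unfold chartField
  rw [I.range_eq_univ]
  exact this

theorem mfderiv_extChartAt_symm_chartField [IsManifold I 1 X] {p : X} {u : E}
    (hu : u ∈ (extChartAt I p).target) (V : ∀ q : X, TangentSpace I q) :
    mfderiv (E := E) 𝓘(ℝ, E) I (extChartAt I p).symm u
      (chartField (E := E) I p V u) = V ((extChartAt I p).symm u) := by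
  have := (isInvertible_mfderivWithin_extChartAt_symm hu).self_apply_inverse
    (V ((extChartAt I p).symm u))
  rw [I.range_eq_univ, mfderivWithin_univ] at this
  unfold chartField
  rw [I.range_eq_univ]
  refine Eq.trans ?_ this
  rw [VectorField.mpullbackWithin_univ]
  rfl

theorem mdifferentiableAt_extChartAt_symm_self [IsManifold I 1 X] {p : X} {u : E}
    (hu : u ∈ (extChartAt I p).target) :
    MDifferentiableAt 𝓘(ℝ, E) I (extChartAt I p).symm u := by
  rw [← mdifferentiableWithinAt_univ, ← I.range_eq_univ]
  exact mdifferentiableWithinAt_extChartAt_symm hu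

/-- The derivative of a function along a vector field can be computed in the chart. -/
theorem dirDeriv_eq_fderiv_chartField [IsManifold I 1 X] {p : X} {u : E}
    (hu : u ∈ (extChartAt I p).target) {f : X → F'}
    (hf : MDifferentiableAt I 𝓘(ℝ, F') f ((extChartAt I p).symm u))
    (V : ∀ q : X, TangentSpace I q) :
    dirDeriv I f ((extChartAt I p).symm u) (V ((extChartAt I p).symm u)) =
      fderiv ℝ (f ∘ (extChartAt I p).symm) u (chartField I p V u) := by
  rw [← mfderiv_eq_fderiv,
    mfderiv_comp (I' := I) u hf (mdifferentiableAt_extChartAt_symm_self hu)]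
  exact congrArg (dirDeriv I f _) (mfderiv_extChartAt_symm_chartField hu V).symm

theorem dirDeriv_eq_fderiv_chartField_self [IsManifold I 1 X] {p : X} {f : X → F'}
    (hf : MDifferentiableAt I 𝓘(ℝ, F') f p) (V : ∀ q : X, TangentSpace I q) :
    dirDeriv I f p (V p) =
      fderiv ℝ (f ∘ (extChartAt I p).symm) (extChartAt I p p) (tangentCoord I (V p)) := by
  have h := dirDeriv_eq_fderiv_chartField (I := I) (mem_extChartAt_target p)
    (f := f) (by rwa [extChartAt_to_inv]) V
  rw [chartField_self] at h
  rw [← h, extChartAt_to_inv]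

/-- Cartan's formula for a vector-valued one-form `a` in a chart. -/
theorem cartan_chart [CompleteSpace E] [IsManifold I 2 X] [IsManifold I 1 X] {p : X}
    {V W : ∀ q : X, TangentSpace I q}
    (hV : MDifferentiableAt I I.tangent (fun q => (⟨q, V q⟩ : TangentBundle I X)) p)
    (hW : MDifferentiableAt I I.tangent (fun q => (⟨q, W q⟩ : TangentBundle I X)) p)
    {a : E → E →L[ℝ] F'} (ha : DifferentiableAt ℝ a (extChartAt I p p)) {h k : X → F'}
    (hh : MDifferentiableAt I 𝓘(ℝ, F') h p) (hk : MDifferentiableAt I 𝓘(ℝ, F') k p)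
    (hh' : ∀ᶠ u in 𝓝 (extChartAt I p p),
      h ((extChartAt I p).symm u) = a u (chartField I p W u))
    (hk' : ∀ᶠ u in 𝓝 (extChartAt I p p),
      k ((extChartAt I p).symm u) = a u (chartField I p V u)) :
    dirDeriv I h p (V p) - dirDeriv I k p (W p) =
      fderiv ℝ a (extChartAt I p p) (tangentCoord I (V p)) (tangentCoord I (W p)) -
        fderiv ℝ a (extChartAt I p p) (tangentCoord I (W p)) (tangentCoord I (V p)) +
        a (extChartAt I p p) (tangentCoord I (VectorField.mlieBracket I V W p)) := by
  -- Both functions are `a` applied to a chart field near the base point. In the product rule, the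
  -- terms that differentiate the chart fields combine to `a` of their flat bracket.
  rw [dirDeriv_eq_fderiv_chartField_self hh, dirDeriv_eq_fderiv_chartField_self hk,
    Filter.EventuallyEq.fderiv_eq (f₁ := h ∘ _) hh',
    Filter.EventuallyEq.fderiv_eq (f₁ := k ∘ _) hk',
    fderiv_clm_apply ha (differentiableAt_chartField hW),
    fderiv_clm_apply ha (differentiableAt_chartField hV), mlieBracket_eq_lieBracket_chartField]
  simp only [VectorField.lieBracket, chartField_self, map_sub]
  simp only [add_apply, ContinuousLinearMap.comp_apply, ContinuousLinearMap.flip_apply]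
  abel

end Chart

/-! ### Lie brackets of related vector fields -/

section Related

variable {E : Type*} [NormedAddCommGroup E] [NormedSpace ℝ E]
  {H : Type*} [TopologicalSpace H] {I : ModelWithCorners ℝ E H}
  {X : Type*} [TopologicalSpace X] [ChartedSpace H X]
  {F' : Type*} [NormedAddCommGroup F'] [NormedSpace ℝ F']
  {E₂ : Type*} [NormedAddCommGroup E₂] [NormedSpace ℝ E₂]
  {H₂ : Type*} [TopologicalSpace H₂] {I₂ : ModelWithCorners ℝ E₂ H₂}
  {Y : Type*} [TopologicalSpace Y] [ChartedSpace H₂ Y]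

theorem dirDeriv_comp {f : X → Y} {g : Y → F'} {p : X}
    (hg : MDifferentiableAt I₂ 𝓘(ℝ, F') g (f p)) (hf : MDifferentiableAt I I₂ f p)
    (v : TangentSpace I p) :
    dirDeriv I (g ∘ f) p v = dirDeriv I₂ g (f p) (mfderiv I I₂ f p v) := by
  rw [dirDeriv, mfderiv_comp (I' := I₂) p hg hf]
  rfl

theorem dirDeriv_congr {f g : X → F'} {p : X} (h : f =ᶠ[𝓝 p] g) (v : TangentSpace I p) :
    dirDeriv I f p v = dirDeriv I g p v := by
  have := h.mfderiv_eq (I := I) (I' := 𝓘(ℝ, F'))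
  exact congrArg (fun L : E →L[ℝ] F' => L v) this

theorem dirDeriv_extChartAt_self [IsManifold I 1 X] {p : X} (v : TangentSpace I p) :
    dirDeriv I (extChartAt I p) p v = tangentCoord I v := by
  have := mfderiv_extChartAt_self (I := I) (x := p)
  exact congrArg (fun L : E →L[ℝ] E => L v) this

theorem mdifferentiableAt_of_chart [IsManifold I 1 X] {p : X} {h : X → F'} {b : E → F'}
    (hb : DifferentiableAt ℝ b (extChartAt I p p))
    (hh : ∀ᶠ u in 𝓝 (extChartAt I p p), h ((extChartAt I p).symm u) = b u) :
    MDifferentiableAt I 𝓘(ℝ, F') h p := by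
  have h1 : MDifferentiableAt I 𝓘(ℝ, F') (b ∘ extChartAt I p) p :=
    hb.mdifferentiableAt.comp (I' := 𝓘(ℝ, E)) p
      (mdifferentiableAt_extChartAt (mem_chart_source _ _))
  refine h1.congr_of_eventuallyEq ?_
  filter_upwards [(continuousAt_extChartAt (I := I) p).eventually hh,
    extChartAt_source_mem_nhds (I := I) p]
    with q hq hqs
  rw [(extChartAt I p).left_inv hqs] at hq
  exact hq

theorem eventually_extChartAt_symm {p : X} {P : X → Prop} (h : ∀ᶠ q in 𝓝 p, P q) :
    ∀ᶠ u in 𝓝 (extChartAt I p p), P ((extChartAt I p).symm u) := by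
  have := continuousAt_extChartAt_symm (I := I) p
  rw [ContinuousAt, extChartAt_to_inv] at this
  exact this.eventually h

variable [I.Boundaryless]

/-- The derivative of a function along a Lie bracket is the commutator of the derivatives. -/
theorem dirDeriv_mlieBracket [CompleteSpace E] [IsManifold I 2 X] {p : X}
    {V W : ∀ q : X, TangentSpace I q}
    (hV : MDifferentiableAt I I.tangent (fun q => (⟨q, V q⟩ : TangentBundle I X)) p)
    (hW : MDifferentiableAt I I.tangent (fun q => (⟨q, W q⟩ : TangentBundle I X)) p)
    {f : X → F'} (hf : ContMDiffAt I 𝓘(ℝ, F') 2 f p) :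
    dirDeriv I f p (VectorField.mlieBracket I V W p) =
      dirDeriv I (fun q => dirDeriv I f q (W q)) p (V p) -
        dirDeriv I (fun q => dirDeriv I f q (V q)) p (W p) := by
  have : IsManifold I 1 X := IsManifold.of_le (n := 2) (by norm_num)
  set φ := (extChartAt I p).symm with hφ
  set u₀ := extChartAt I p p with hu₀
  have hg : ContDiffAt ℝ 2 (f ∘ φ) u₀ := by
    have := (contMDiffAt_iff.1 hf).2
    simp only [I.range_eq_univ, contDiffWithinAt_univ] at this
    exact this
  have ha : DifferentiableAt ℝ (fderiv ℝ (f ∘ φ)) u₀ :=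
    (hg.fderiv_right (m := 1) (by norm_num)).differentiableAt (by norm_num)
  have hne : ∀ᶠ q in 𝓝 p, MDifferentiableAt I 𝓘(ℝ, F') f q := by
    filter_upwards [(contMDiffAt_iff_contMDiffAt_nhds (by simp)).1 hf] with q hq
    exact hq.mdifferentiableAt (by norm_num)
  have key : ∀ Z : ∀ q : X, TangentSpace I q, ∀ᶠ u in 𝓝 u₀,
      dirDeriv I f (φ u) (Z (φ u)) = fderiv ℝ (f ∘ φ) u (chartField I p Z u) := by
    intro Z
    filter_upwards [eventually_extChartAt_symm (I := I) hne, extChartAt_target_mem_nhds p]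
      with u hu hut
    exact dirDeriv_eq_fderiv_chartField hut hu Z
  have hd : ∀ Z : ∀ q : X, TangentSpace I q,
      MDifferentiableAt I I.tangent (fun q => (⟨q, Z q⟩ : TangentBundle I X)) p →
      MDifferentiableAt I 𝓘(ℝ, F') (fun q => dirDeriv I f q (Z q)) p := fun Z hZ =>
    mdifferentiableAt_of_chart (ha.clm_apply (differentiableAt_chartField hZ)) (key Z)
  -- Cartan's formula for the exact form `fderiv (f ∘ φ)`; its exterior derivative is the
  -- antisymmetrised second derivative, which vanishes.
  have hc := cartan_chart hV hW ha (hd W hW) (hd V hV) (key W) (key V)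
  have hs : IsSymmSndFDerivAt ℝ (f ∘ φ) u₀ := hg.isSymmSndFDerivAt (by simp)
  rw [hc, hs.eq, sub_self, zero_add]
  exact dirDeriv_eq_fderiv_chartField_self hne.self_of_nhds (VectorField.mlieBracket I V W)

variable [I₂.Boundaryless]

/-- The Lie bracket of vector fields is compatible with smooth maps. -/
theorem mlieBracket_related [CompleteSpace E] [CompleteSpace E₂]
    [IsManifold I 2 X] [IsManifold I₂ 2 Y] {p : X} {f : X → Y}
    (hf : ContMDiffAt I I₂ 2 f p)
    {V W : ∀ q : X, TangentSpace I q} {V' W' : ∀ q : Y, TangentSpace I₂ q}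
    (hV : MDifferentiableAt I I.tangent (fun q => (⟨q, V q⟩ : TangentBundle I X)) p)
    (hW : MDifferentiableAt I I.tangent (fun q => (⟨q, W q⟩ : TangentBundle I X)) p)
    (hV' : MDifferentiableAt I₂ I₂.tangent (fun q => (⟨q, V' q⟩ : TangentBundle I₂ Y)) (f p))
    (hW' : MDifferentiableAt I₂ I₂.tangent (fun q => (⟨q, W' q⟩ : TangentBundle I₂ Y)) (f p))
    (hVV' : ∀ᶠ q in 𝓝 p, mfderiv I I₂ f q (V q) = V' (f q))
    (hWW' : ∀ᶠ q in 𝓝 p, mfderiv I I₂ f q (W q) = W' (f q)) :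
    mfderiv I I₂ f p (VectorField.mlieBracket I V W p) =
      VectorField.mlieBracket I₂ V' W' (f p) := by
  have : IsManifold I 1 X := IsManifold.of_le (n := 2) (by norm_num)
  have : IsManifold I₂ 1 Y := IsManifold.of_le (n := 2) (by norm_num)
  -- The derivative of this chart at `f p` is the identity, so the two vectors can be compared by
  -- differentiating the function `χ` along them: `χ ∘ f` upstairs, `χ` downstairs.
  set χ : Y → E₂ := ⇑(extChartAt I₂ (f p)) with hχ
  have hχs : ContMDiffAt I₂ 𝓘(ℝ, E₂) 2 χ (f p) := contMDiffAt_extChartAt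
  have hfd : MDifferentiableAt I I₂ f p := hf.mdifferentiableAt (by norm_num)
  have hfe : ∀ᶠ q in 𝓝 p, MDifferentiableAt I I₂ f q := by
    filter_upwards [(contMDiffAt_iff_contMDiffAt_nhds (by simp)).1 hf] with q hq
    exact hq.mdifferentiableAt (by norm_num)
  have hχe : ∀ᶠ q in 𝓝 p, MDifferentiableAt I₂ 𝓘(ℝ, E₂) χ (f q) := by
    filter_upwards [hf.continuousAt.eventually ((contMDiffAt_iff_contMDiffAt_nhds (by simp)).1 hχs)] with q hq
    exact hq.mdifferentiableAt (by norm_num)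
  have hd : ∀ Z : ∀ q : Y, TangentSpace I₂ q,
      MDifferentiableAt I₂ I₂.tangent (fun q => (⟨q, Z q⟩ : TangentBundle I₂ Y)) (f p) →
      MDifferentiableAt I₂ 𝓘(ℝ, E₂) (fun q => dirDeriv I₂ χ q (Z q)) (f p) := fun Z hZ => by
    refine mdifferentiableAt_of_chart (p := f p)
      (b := fun u => fderiv ℝ (χ ∘ (extChartAt I₂ (f p)).symm) u (chartField I₂ (f p) Z u))
      ?_ ?_
    · have hg : ContDiffAt ℝ 2 (χ ∘ (extChartAt I₂ (f p)).symm) (extChartAt I₂ (f p) (f p)) := by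
        have := (contMDiffAt_iff.1 hχs).2
        simp only [I₂.range_eq_univ, contDiffWithinAt_univ] at this
        exact this
      exact ((hg.fderiv_right (m := 1) (by norm_num)).differentiableAt (by norm_num)).clm_apply
        (differentiableAt_chartField hZ)
    · filter_upwards [eventually_extChartAt_symm (I := I₂) ((contMDiffAt_iff_contMDiffAt_nhds (by simp)).1 hχs),
        extChartAt_target_mem_nhds (f p)] with u hu hut
      exact dirDeriv_eq_fderiv_chartField hut (hu.mdifferentiableAt (by norm_num)) Z
  have key : ∀ (Z : ∀ q : X, TangentSpace I q) (Z' : ∀ q : Y, TangentSpace I₂ q),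
      (∀ᶠ q in 𝓝 p, mfderiv I I₂ f q (Z q) = Z' (f q)) →
      (fun q => dirDeriv I (χ ∘ f) q (Z q)) =ᶠ[𝓝 p]
        (fun y => dirDeriv I₂ χ y (Z' y)) ∘ f := by
    intro Z Z' hZ
    filter_upwards [hZ, hfe, hχe] with q hq hq1 hq2
    rw [dirDeriv_comp hq2 hq1, hq]
    rfl
  have h1 := dirDeriv_mlieBracket hV hW (hχs.comp p hf)
  rw [dirDeriv_congr (key W W' hWW'), dirDeriv_congr (key V V' hVV'),
    dirDeriv_comp (hd W' hW') hfd, dirDeriv_comp (hd V' hV') hfd, hVV'.self_of_nhds,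
    hWW'.self_of_nhds, ← dirDeriv_mlieBracket hV' hW' hχs,
    dirDeriv_comp hχe.self_of_nhds hfd] at h1
  rw [dirDeriv_extChartAt_self, dirDeriv_extChartAt_self] at h1
  exact h1

end Related

/-! ### Pointwise smoothness and the exterior derivative of one-forms -/

section Smooth

variable {F : Type*} [NormedAddCommGroup F] [NormedSpace ℝ F]
  {X : Type*} [TopologicalSpace X] [ChartedSpace F X] [IsManifold 𝓘(ℝ, F) ∞ X]

variable (F) in
/-- Smoothness of a vector field at a point. -/
def VecSmoothAt (v : ∀ q : X, TangentSpace 𝓘(ℝ, F) q) (p : X) : Prop :=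
  ContMDiffAt 𝓘(ℝ, F) (𝓘(ℝ, F).prod 𝓘(ℝ, F)) ∞
    (fun p => (Bundle.TotalSpace.mk' F p (v p) :
      Bundle.TotalSpace F (fun p : X => TangentSpace 𝓘(ℝ, F) p))) p

variable (F) in
/-- Smoothness of a one-form at a point. -/
def FormSmoothAt (α : ∀ q : X, TangentSpace 𝓘(ℝ, F) q →L[ℝ] ℝ) (p : X) : Prop :=
  ContMDiffAt 𝓘(ℝ, F) (𝓘(ℝ, F).prod 𝓘(ℝ, F →L[ℝ] ℝ)) ∞
    (fun p => (Bundle.TotalSpace.mk' (F →L[ℝ] ℝ) p (α p) :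
      Bundle.TotalSpace (F →L[ℝ] ℝ) (fun p : X => TangentSpace 𝓘(ℝ, F) p →L[ℝ] ℝ))) p

variable (F) in
/-- Smoothness of a section of the generalized tangent bundle at a point. -/
def SecSmoothAt (s : GSec F X) (p : X) : Prop :=
  VecSmoothAt F (fun q => (s q).1) p ∧ FormSmoothAt F (fun q => (s q).2) p

variable (F) in
/-- Smoothness of a real function at a point. -/
abbrev FunSmoothAt (f : X → ℝ) (p : X) : Prop := ContMDiffAt 𝓘(ℝ, F) 𝓘(ℝ, ℝ) ∞ f p

theorem SmoothOn.secSmoothAt {U : Set X} {s : GSec F X} (hs : SmoothOn F U s) {p : X}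
    (hU : U ∈ 𝓝 p) : SecSmoothAt F s p :=
  ⟨hs.1.contMDiffAt hU, hs.2.contMDiffAt hU⟩

theorem smoothOn_of_secSmoothAt {U : Set X} {s : GSec F X} (h : ∀ p ∈ U, SecSmoothAt F s p) :
    SmoothOn F U s :=
  ⟨fun p hp => (h p hp).1.contMDiffWithinAt, fun p hp => (h p hp).2.contMDiffWithinAt⟩

theorem smoothOn_iff {U : Set X} (hU : IsOpen U) {s : GSec F X} :
    SmoothOn F U s ↔ ∀ p ∈ U, SecSmoothAt F s p :=
  ⟨fun h _ hp => h.secSmoothAt (hU.mem_nhds hp), smoothOn_of_secSmoothAt⟩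

theorem SecSmoothAt.add {s t : GSec F X} {p : X} (hs : SecSmoothAt F s p)
    (ht : SecSmoothAt F t p) : SecSmoothAt F (s + t) p :=
  ⟨hs.1.add_section ht.1, hs.2.add_section ht.2⟩

theorem SecSmoothAt.sub {s t : GSec F X} {p : X} (hs : SecSmoothAt F s p)
    (ht : SecSmoothAt F t p) : SecSmoothAt F (s - t) p :=
  ⟨hs.1.sub_section ht.1, hs.2.sub_section ht.2⟩

theorem SecSmoothAt.neg {s : GSec F X} {p : X} (hs : SecSmoothAt F s p) :
    SecSmoothAt F (-s) p :=
  ⟨hs.1.neg_section, hs.2.neg_section⟩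

theorem SecSmoothAt.zero {p : X} : SecSmoothAt F (0 : GSec F X) p :=
  (SmoothOn.zero F (U := univ)).secSmoothAt univ_mem

theorem SecSmoothAt.smul {s : GSec F X} {f : X → ℝ} {p : X} (hf : FunSmoothAt F f p)
    (hs : SecSmoothAt F s p) : SecSmoothAt F (fun q => f q • s q) p :=
  ⟨hf.smul_section hs.1, hf.smul_section hs.2⟩

theorem SecSmoothAt.sum {ι : Type*} {A : Finset ι} {s : ι → GSec F X} {p : X}
    (hs : ∀ i ∈ A, SecSmoothAt F (s i) p) : SecSmoothAt F (fun q => ∑ i ∈ A, s i q) p := by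
  classical
  induction A using Finset.induction_on with
  | empty => exact SecSmoothAt.zero
  | insert i A hi ih =>
    simp only [Finset.sum_insert hi]
    exact (hs i (by simp)).add (ih fun j hj => hs j (by simp [hj]))

theorem VecSmoothAt.congr {s t : ∀ q : X, TangentSpace 𝓘(ℝ, F) q} {p : X}
    (hs : VecSmoothAt F s p) (h : ∀ᶠ q in 𝓝 p, t q = s q) : VecSmoothAt F t p :=
  ContMDiffAt.congr_of_eventuallyEq hs (h.mono fun q hq => by simp only [hq])

theorem FormSmoothAt.congr {s t : ∀ q : X, TangentSpace 𝓘(ℝ, F) q →L[ℝ] ℝ} {p : X}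
    (hs : FormSmoothAt F s p) (h : ∀ᶠ q in 𝓝 p, t q = s q) : FormSmoothAt F t p :=
  ContMDiffAt.congr_of_eventuallyEq hs (h.mono fun q hq => by simp only [hq])

theorem SecSmoothAt.congr {s t : GSec F X} {p : X} (hs : SecSmoothAt F s p)
    (h : ∀ᶠ q in 𝓝 p, t q = s q) : SecSmoothAt F t p :=
  ⟨hs.1.congr (h.mono fun q hq => by simp only [hq]),
    hs.2.congr (h.mono fun q hq => by simp only [hq])⟩

theorem VecSmoothAt.mdifferentiableAt {v : ∀ q : X, TangentSpace 𝓘(ℝ, F) q} {p : X}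
    (hv : VecSmoothAt F v p) :
    MDifferentiableAt 𝓘(ℝ, F) 𝓘(ℝ, F).tangent
      (fun q => (⟨q, v q⟩ : TangentBundle 𝓘(ℝ, F) X)) p :=
  ContMDiffAt.mdifferentiableAt hv (by simp)

theorem FormSmoothAt.apply {α : ∀ q : X, TangentSpace 𝓘(ℝ, F) q →L[ℝ] ℝ}
    {v : ∀ q : X, TangentSpace 𝓘(ℝ, F) q} {p : X} (hα : FormSmoothAt F α p)
    (hv : VecSmoothAt F v p) : FunSmoothAt F (fun q => α q (v q)) p := by
  have := ContMDiffAt.clm_bundle_apply (𝕜 := ℝ) (F₁ := F) (F₂ := ℝ)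
    (E₁ := fun p : X => TangentSpace 𝓘(ℝ, F) p) (E₂ := fun _ : X => ℝ) hα hv
  exact (contMDiffAt_totalSpace.1 this).2

/-- The vector field with constant coordinate `v` in the preferred chart around `p`. -/
def constField (p : X) (v : F) (q : X) : TangentSpace 𝓘(ℝ, F) q :=
  (trivializationAt F (TangentSpace 𝓘(ℝ, F)) p).symmL ℝ q v

theorem vecSmoothAt_constField' {p q : X} (hq : q ∈ (chartAt F p).source) (v : F) :
    VecSmoothAt F (constField p v) q := by
  have h1 : ContMDiffAt 𝓘(ℝ, F) (𝓘(ℝ, F).prod 𝓘(ℝ, F →L[ℝ] F)) ∞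
      (fun m => TotalSpace.mk' (F →L[ℝ] F) (E := fun q : X => F →L[ℝ] TangentSpace 𝓘(ℝ, F) q) m
        ((trivializationAt F (TangentSpace 𝓘(ℝ, F)) p).symmL ℝ m)) q :=
    Bundle.Trivialization.contMDiffAt_symmL _ hq
  have h2 : ContMDiffAt 𝓘(ℝ, F) (𝓘(ℝ, F).prod 𝓘(ℝ, F)) ∞
      (fun m => TotalSpace.mk' F (E := fun _ : X => F) m v) q := by
    rw [contMDiffAt_totalSpace]
    exact ⟨contMDiffAt_id, contMDiffAt_const⟩
  exact ContMDiffAt.clm_bundle_apply (𝕜 := ℝ) (F₁ := F) (F₂ := F)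
    (E₁ := fun _ : X => F) (E₂ := fun p : X => TangentSpace 𝓘(ℝ, F) p) h1 h2

theorem vecSmoothAt_constField (p : X) (v : F) : VecSmoothAt F (constField p v) p :=
  vecSmoothAt_constField' (mem_chart_source _ _) v

theorem constField_self (p : X) (v : TangentSpace 𝓘(ℝ, F) p) :
    constField (F := F) p v p = v := by
  have h := TangentBundle.symmL_trivializationAt (I := 𝓘(ℝ, F)) (x₀ := p) (x := p)
    (mem_chart_source _ _)
  rw [mfderivWithin_range_extChartAt_symm] at h
  exact congrArg (fun L : F →L[ℝ] F => L v) h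

/-- The coordinates of a one-form in the preferred chart around `p`. -/
def formCoord (p : X) (α : ∀ q : X, TangentSpace 𝓘(ℝ, F) q →L[ℝ] ℝ) (q : X) : F →L[ℝ] ℝ :=
  (α q).comp ((trivializationAt F (TangentSpace 𝓘(ℝ, F)) p).symmL ℝ q)

theorem formSmoothAt_iff_formCoord {α : ∀ q : X, TangentSpace 𝓘(ℝ, F) q →L[ℝ] ℝ} {p : X} :
    FormSmoothAt F α p ↔ ContMDiffAt 𝓘(ℝ, F) 𝓘(ℝ, F →L[ℝ] ℝ) ∞ (formCoord p α) p := by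
  have h := contMDiffAt_hom_bundle (𝕜 := ℝ) (n := ∞) (F₁ := F) (F₂ := ℝ) (IB := 𝓘(ℝ, F))
    (IM := 𝓘(ℝ, F)) (E₁ := fun p : X => TangentSpace 𝓘(ℝ, F) p) (E₂ := fun _ : X => ℝ)
    (fun q => ⟨q, α q⟩) (x₀ := p)
  have h' : (fun q => ContinuousLinearMap.inCoordinates F (fun p : X => TangentSpace 𝓘(ℝ, F) p)
      ℝ (fun _ : X => ℝ) p q p q (α q)) = formCoord p α := by
    ext q v
    simp [ContinuousLinearMap.inCoordinates, formCoord]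
  refine h.trans ?_
  rw [← h']
  exact ⟨fun h => h.2, fun h => ⟨contMDiffAt_id, h⟩⟩

/-- In finite dimension the coordinates of a one-form are its values on the constant-coordinate
fields of a basis, so testing on smooth fields is enough. -/
theorem formSmoothAt_of_apply [FiniteDimensional ℝ F]
    {α : ∀ q : X, TangentSpace 𝓘(ℝ, F) q →L[ℝ] ℝ} {p : X}
    (h : ∀ v, VecSmoothAt F v p → FunSmoothAt F (fun q => α q (v q)) p) :
    FormSmoothAt F α p := by
  rw [formSmoothAt_iff_formCoord]
  let b := Module.finBasis ℝ F
  have key : formCoord p α = fun q => ∑ i, (α q (constField p (b i) q)) •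
      (LinearMap.toContinuousLinearMap (b.coord i)) := by
    ext q v
    have h1 : formCoord p α q v = ∑ i, b.repr v i * formCoord p α q (b i) := by
      conv_lhs => rw [← b.sum_repr v, map_sum]
      simp
    rw [h1]
    simp only [formCoord, constField, ContinuousLinearMap.comp_apply, sum_apply, smul_apply,
      smul_eq_mul, LinearMap.coe_toContinuousLinearMap', Module.Basis.coord_apply, mul_comm]
  rw [key]
  refine ContMDiffAt.sum fun i _ => ?_
  exact (h _ (vecSmoothAt_constField p (b i))).smul contMDiffAt_const

theorem FormSmoothAt.differentiableAt_formInChart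
    {α : ∀ q : X, TangentSpace 𝓘(ℝ, F) q →L[ℝ] ℝ} {p : X} (hα : FormSmoothAt F α p) :
    DifferentiableAt ℝ (formInChart F α p) (extChartAt 𝓘(ℝ, F) p p) := by
  rw [formSmoothAt_iff_formCoord] at hα
  have h1 : ContDiffAt ℝ ∞ (formCoord p α ∘ (extChartAt 𝓘(ℝ, F) p).symm)
      (extChartAt 𝓘(ℝ, F) p p) := by
    have := (contMDiffAt_iff.1 hα).2
    simp only [ModelWithCorners.range_eq_univ, contDiffWithinAt_univ] at this
    exact this
  refine (h1.differentiableAt (by simp)).congr_of_eventuallyEq ?_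
  filter_upwards [extChartAt_target_mem_nhds (I := 𝓘(ℝ, F)) p] with u hu
  have hq : (extChartAt 𝓘(ℝ, F) p).symm u ∈ (chartAt F p).source := by
    rw [← extChartAt_source 𝓘(ℝ, F)]
    exact (extChartAt 𝓘(ℝ, F) p).map_target hu
  have h := TangentBundle.symmL_trivializationAt (I := 𝓘(ℝ, F)) hq
  rw [ModelWithCorners.range_eq_univ, mfderivWithin_univ, (extChartAt 𝓘(ℝ, F) p).right_inv hu] at h
  ext v
  exact (congrArg (fun L : F →L[ℝ] TangentSpace 𝓘(ℝ, F) ((extChartAt 𝓘(ℝ, F) p).symm u) =>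
    α _ (L v)) h).symm

/-- Cartan's formula for the exterior derivative of a one-form. -/
theorem contractD_apply [CompleteSpace F] {α : ∀ q : X, TangentSpace 𝓘(ℝ, F) q →L[ℝ] ℝ}
    {v w : ∀ q : X, TangentSpace 𝓘(ℝ, F) q} {p : X} (hα : FormSmoothAt F α p)
    (hv : VecSmoothAt F v p) (hw : VecSmoothAt F w p) :
    contractD F α p (v p) (w p) =
      dirDeriv 𝓘(ℝ, F) (fun q => α q (w q)) p (v p) -
        dirDeriv 𝓘(ℝ, F) (fun q => α q (v q)) p (w p) -
        α p (VectorField.mlieBracket 𝓘(ℝ, F) v w p) := by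
  have key : ∀ z : ∀ q : X, TangentSpace 𝓘(ℝ, F) q, ∀ᶠ u in 𝓝 (extChartAt 𝓘(ℝ, F) p p),
      α ((extChartAt 𝓘(ℝ, F) p).symm u) (z ((extChartAt 𝓘(ℝ, F) p).symm u)) =
        formInChart F α p u (chartField 𝓘(ℝ, F) p z u) := by
    intro z
    filter_upwards [extChartAt_target_mem_nhds (I := 𝓘(ℝ, F)) p] with u hu
    exact congrArg (α _) (mfderiv_extChartAt_symm_chartField hu z).symm
  have h := cartan_chart hv.mdifferentiableAt hw.mdifferentiableAt
    hα.differentiableAt_formInChart ((hα.apply hw).mdifferentiableAt (by simp))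
    ((hα.apply hv).mdifferentiableAt (by simp)) (key w) (key v)
  have h2 : formInChart F α p (extChartAt 𝓘(ℝ, F) p p)
      (tangentCoord 𝓘(ℝ, F) (VectorField.mlieBracket 𝓘(ℝ, F) v w p)) =
      α p (VectorField.mlieBracket 𝓘(ℝ, F) v w p) := by
    have := (key (VectorField.mlieBracket 𝓘(ℝ, F) v w)).self_of_nhds
    rw [chartField_self] at this
    rw [← this, extChartAt_to_inv]
  rw [h2] at h
  have h3 : contractD F α p (v p) (w p) =
      fderiv ℝ (formInChart F α p) (extChartAt 𝓘(ℝ, F) p p) (tangentCoord 𝓘(ℝ, F) (v p))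
        (tangentCoord 𝓘(ℝ, F) (w p)) -
      fderiv ℝ (formInChart F α p) (extChartAt 𝓘(ℝ, F) p p) (tangentCoord 𝓘(ℝ, F) (w p))
        (tangentCoord 𝓘(ℝ, F) (v p)) := by
    have hA : ∀ x : TangentSpace 𝓘(ℝ, F) p,
        mfderiv 𝓘(ℝ, F) 𝓘(ℝ, F) (extChartAt 𝓘(ℝ, F) p) p x = tangentCoord 𝓘(ℝ, F) x :=
      dirDeriv_extChartAt_self
    have : contractD F α p (v p) (w p) =
      fderiv ℝ (formInChart F α p) (extChartAt 𝓘(ℝ, F) p p)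
        (mfderiv 𝓘(ℝ, F) 𝓘(ℝ, F) (extChartAt 𝓘(ℝ, F) p) p (v p))
        (mfderiv 𝓘(ℝ, F) 𝓘(ℝ, F) (extChartAt 𝓘(ℝ, F) p) p (w p)) -
      fderiv ℝ (formInChart F α p) (extChartAt 𝓘(ℝ, F) p p)
        (mfderiv 𝓘(ℝ, F) 𝓘(ℝ, F) (extChartAt 𝓘(ℝ, F) p) p (w p))
        (mfderiv 𝓘(ℝ, F) 𝓘(ℝ, F) (extChartAt 𝓘(ℝ, F) p) p (v p)) := rfl
    rw [hA, hA] at this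
    exact this
  rw [h3]
  linarith

end Smooth

/-! ### Algebraic properties of the Dorfman bracket -/

section Calculus

variable {F : Type*} [NormedAddCommGroup F] [NormedSpace ℝ F]
  {X : Type*} [TopologicalSpace X] [ChartedSpace F X]

theorem diff_apply (f : X → ℝ) (p : X) (v : TangentSpace 𝓘(ℝ, F) p) :
    diff F f p v = dirDeriv 𝓘(ℝ, F) f p v := rfl

section DirDeriv

variable {f g : X → ℝ} {p : X} (v : TangentSpace 𝓘(ℝ, F) p)

theorem dirDeriv_add_fun (hf : MDifferentiableAt 𝓘(ℝ, F) 𝓘(ℝ, ℝ) f p)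
    (hg : MDifferentiableAt 𝓘(ℝ, F) 𝓘(ℝ, ℝ) g p) :
    dirDeriv 𝓘(ℝ, F) (fun q => f q + g q) p v =
      dirDeriv 𝓘(ℝ, F) f p v + dirDeriv 𝓘(ℝ, F) g p v :=
  congrArg (fun L : F →L[ℝ] ℝ => L v) (hf.hasMFDerivAt.add hg.hasMFDerivAt).mfderiv

theorem dirDeriv_sub_fun (hf : MDifferentiableAt 𝓘(ℝ, F) 𝓘(ℝ, ℝ) f p)
    (hg : MDifferentiableAt 𝓘(ℝ, F) 𝓘(ℝ, ℝ) g p) :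
    dirDeriv 𝓘(ℝ, F) (fun q => f q - g q) p v =
      dirDeriv 𝓘(ℝ, F) f p v - dirDeriv 𝓘(ℝ, F) g p v :=
  congrArg (fun L : F →L[ℝ] ℝ => L v) (hf.hasMFDerivAt.sub hg.hasMFDerivAt).mfderiv

theorem dirDeriv_mul_fun (hf : MDifferentiableAt 𝓘(ℝ, F) 𝓘(ℝ, ℝ) f p)
    (hg : MDifferentiableAt 𝓘(ℝ, F) 𝓘(ℝ, ℝ) g p) :
    dirDeriv 𝓘(ℝ, F) (fun q => f q * g q) p v =
      f p * dirDeriv 𝓘(ℝ, F) g p v + g p * dirDeriv 𝓘(ℝ, F) f p v :=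
  congrArg (fun L : F →L[ℝ] ℝ => L v) (hf.hasMFDerivAt.mul hg.hasMFDerivAt).mfderiv

theorem dirDeriv_const (c : ℝ) : dirDeriv 𝓘(ℝ, F) (fun _ : X => c) p v = 0 :=
  congrArg (fun L : F →L[ℝ] ℝ => L v) (hasMFDerivAt_const c p).mfderiv

theorem dirDeriv_add_vec (v w : TangentSpace 𝓘(ℝ, F) p) :
    dirDeriv 𝓘(ℝ, F) f p (v + w) = dirDeriv 𝓘(ℝ, F) f p v + dirDeriv 𝓘(ℝ, F) f p w :=
  map_add (diff F f p) v w

theorem dirDeriv_smul_vec (c : ℝ) (v : TangentSpace 𝓘(ℝ, F) p) :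
    dirDeriv 𝓘(ℝ, F) f p (c • v) = c * dirDeriv 𝓘(ℝ, F) f p v :=
  map_smul (diff F f p) c v

end DirDeriv

theorem dorfman_congr {x x' y y' : GSec F X} {p : X} (hx : ∀ᶠ q in 𝓝 p, x q = x' q)
    (hy : ∀ᶠ q in 𝓝 p, y q = y' q) :
    dorfman F x y p = dorfman F x' y' p := by
  have hc : ∀ {x x' : GSec F X}, (∀ᶠ q in 𝓝 p, x q = x' q) →
      contractD F (fun q => (x q).2) p = contractD F (fun q => (x' q).2) p := by
    intro x x' hx
    have : formInChart F (fun q => (x q).2) p =ᶠ[𝓝 (extChartAt 𝓘(ℝ, F) p p)]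
        formInChart F (fun q => (x' q).2) p := by
      filter_upwards [eventually_extChartAt_symm (I := 𝓘(ℝ, F)) hx] with u hu
      simp only [formInChart, hu]
    ext v w
    simp only [contractD, this.fderiv_eq]
  unfold dorfman
  have hb : VectorField.mlieBracket 𝓘(ℝ, F) (fun q => (x q).1) (fun q => (y q).1) p =
      VectorField.mlieBracket 𝓘(ℝ, F) (fun q => (x' q).1) (fun q => (y' q).1) p :=
    Filter.EventuallyEq.mlieBracket_vectorField_eq (hx.mono fun q hq => congrArg Prod.fst hq)
      (hy.mono fun q hq => congrArg Prod.fst hq)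
  rw [hb, hc hx, hc hy, hx.self_of_nhds, hy.self_of_nhds]
  have : diff F (fun q => (y q).2 (x q).1) p = diff F (fun q => (y' q).2 (x' q).1) p := by
    ext v
    refine dirDeriv_congr ?_ v
    filter_upwards [hx, hy] with q h1 h2
    rw [h1, h2]
  rw [this]

theorem FunSmoothAt.mdifferentiableAt {f : X → ℝ} {p : X} (hf : FunSmoothAt F f p) :
    MDifferentiableAt 𝓘(ℝ, F) 𝓘(ℝ, ℝ) f p :=
  ContMDiffAt.mdifferentiableAt hf (by simp)

theorem FunSmoothAt.add {f g : X → ℝ} {p : X} (hf : FunSmoothAt F f p) (hg : FunSmoothAt F g p) :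
    FunSmoothAt F (fun q => f q + g q) p :=
  ContMDiffAt.add hf hg

theorem FunSmoothAt.mul {f g : X → ℝ} {p : X} (hf : FunSmoothAt F f p) (hg : FunSmoothAt F g p) :
    FunSmoothAt F (fun q => f q * g q) p :=
  ContMDiffAt.mul hf hg

variable [IsManifold 𝓘(ℝ, F) ∞ X]

theorem FunSmoothAt.pairing {x y : GSec F X} {p : X}
    (hx : SecSmoothAt F x p) (hy : SecSmoothAt F y p) :
    FunSmoothAt F (fun q => pairing F q (x q) (y q)) p := by
  have : (fun q => GenGeom.pairing F q (x q) (y q)) =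
      fun q => (1 / 2 : ℝ) * ((x q).2 (y q).1 + (y q).2 (x q).1) := rfl
  unfold FunSmoothAt
  rw [this]
  exact FunSmoothAt.mul contMDiffAt_const (FunSmoothAt.add (hx.2.apply hy.1) (hy.2.apply hx.1))

/-- Every vector at `p` is the value of a constant-coordinate field. Covectors may thus be compared
on smooth fields, where Cartan's formula applies. -/
theorem gt_ext {p : X} {a b : GT F p} (h1 : a.1 = b.1)
    (h2 : ∀ z : ∀ q : X, TangentSpace 𝓘(ℝ, F) q, VecSmoothAt F z p → a.2 (z p) = b.2 (z p)) :
    a = b := by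
  refine Prod.ext h1 ?_
  ext w
  have := h2 (constField (F := F) p w) (vecSmoothAt_constField (F := F) p w)
  rwa [constField_self] at this

variable [CompleteSpace F]

/-- Cartan's formula for both exterior derivatives; the differential of `(y q).2 (x q).1` cancels.
Only derivatives of functions and Lie brackets remain, the form used in all later computations. -/
theorem dorfman_snd_apply {x y : GSec F X} {z : ∀ q : X, TangentSpace 𝓘(ℝ, F) q} {p : X}
    (hx : SecSmoothAt F x p) (hy : SecSmoothAt F y p) (hz : VecSmoothAt F z p) :
    (dorfman F x y p).2 (z p) =
      dirDeriv 𝓘(ℝ, F) (fun q => (y q).2 (z q)) p (x p).1 -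
        (y p).2 (VectorField.mlieBracket 𝓘(ℝ, F) (fun q => (x q).1) z p) -
        dirDeriv 𝓘(ℝ, F) (fun q => (x q).2 (z q)) p (y p).1 +
        dirDeriv 𝓘(ℝ, F) (fun q => (x q).2 (y q).1) p (z p) +
        (x p).2 (VectorField.mlieBracket 𝓘(ℝ, F) (fun q => (y q).1) z p) := by
  have h1 := contractD_apply hy.2 hx.1 hz
  have h2 := contractD_apply hx.2 hy.1 hz
  have h3 : (dorfman F x y p).2 (z p) = diff F (fun q => (y q).2 (x q).1) p (z p) +
      contractD F (fun q => (y q).2) p (x p).1 (z p) -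
      contractD F (fun q => (x q).2) p (y p).1 (z p) := rfl
  rw [h3, h1, h2, diff_apply]
  ring

/-- The derivative of `f` along the test field `z` occurs twice, in the differential of `(x q).2 (f
q • (y q).1)` and in the bracket of `f y` with `z`. The two terms cancel, which leaves the plain
Leibniz rule in the right slot. -/
theorem dorfman_smul_right {x y : GSec F X} {f : X → ℝ} {p : X}
    (hx : SecSmoothAt F x p) (hy : SecSmoothAt F y p) (hf : FunSmoothAt F f p) :
    dorfman F x (fun q => f q • y q) p =
      f p • dorfman F x y p + dirDeriv 𝓘(ℝ, F) f p (x p).1 • y p := by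
  refine gt_ext ?_ fun z hz => ?_
  · exact (VectorField.mlieBracket_smul_right (V := fun q => (x q).1) hf.mdifferentiableAt
      hy.1.mdifferentiableAt).trans (add_comm _ _)
  · have hb : VectorField.mlieBracket 𝓘(ℝ, F) (fun q => (f q • y q).1) z p =
        -dirDeriv 𝓘(ℝ, F) f p (z p) • (y p).1 +
          f p • VectorField.mlieBracket 𝓘(ℝ, F) (fun q => (y q).1) z p :=
      VectorField.mlieBracket_smul_left (W := z) hf.mdifferentiableAt hy.1.mdifferentiableAt
    rw [dorfman_snd_apply hx (SecSmoothAt.smul hf hy) hz]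
    simp only [Prod.snd_add, Prod.smul_snd, add_apply, smul_apply, smul_eq_mul]
    rw [dorfman_snd_apply hx hy hz, hb]
    simp only [Prod.smul_fst, smul_eq_mul, map_smul, map_add]
    rw [dirDeriv_mul_fun _ hf.mdifferentiableAt (hy.2.apply hz).mdifferentiableAt,
      dirDeriv_mul_fun _ hf.mdifferentiableAt (hx.2.apply hy.1).mdifferentiableAt,
      dirDeriv_smul_vec]
    ring

theorem dorfman_add_right {x y y' : GSec F X} {p : X}
    (hx : SecSmoothAt F x p) (hy : SecSmoothAt F y p) (hy' : SecSmoothAt F y' p) :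
    dorfman F x (y + y') p = dorfman F x y p + dorfman F x y' p := by
  refine gt_ext ?_ fun z hz => ?_
  · exact VectorField.mlieBracket_add_right hy.1.mdifferentiableAt hy'.1.mdifferentiableAt
  · have hb : VectorField.mlieBracket 𝓘(ℝ, F) (fun q => ((y + y') q).1) z p =
        VectorField.mlieBracket 𝓘(ℝ, F) (fun q => (y q).1) z p +
          VectorField.mlieBracket 𝓘(ℝ, F) (fun q => (y' q).1) z p :=
      VectorField.mlieBracket_add_left hy.1.mdifferentiableAt hy'.1.mdifferentiableAt
    rw [dorfman_snd_apply hx (hy.add hy') hz, hb]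
    simp only [Prod.snd_add, add_apply, Pi.add_apply, Prod.fst_add, map_add]
    rw [dorfman_snd_apply hx hy hz, dorfman_snd_apply hx hy' hz,
      dirDeriv_add_fun _ (hy.2.apply hz).mdifferentiableAt (hy'.2.apply hz).mdifferentiableAt,
      dirDeriv_add_fun _ (hx.2.apply hy.1).mdifferentiableAt
        (hx.2.apply hy'.1).mdifferentiableAt, dirDeriv_add_vec]
    ring

/-- On a test field, the Lie brackets and the derivatives along `x` and `y` cancel in pairs. The
bracket is therefore skew on sections whose inner product is constant. -/
theorem dorfman_add_swap {x y : GSec F X} {p : X}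
    (hx : SecSmoothAt F x p) (hy : SecSmoothAt F y p) :
    dorfman F x y p + dorfman F y x p =
      (0, (2 : ℝ) • diff F (fun q => pairing F q (x q) (y q)) p) := by
  refine gt_ext ?_ fun z hz => ?_
  · change VectorField.mlieBracket 𝓘(ℝ, F) _ _ p + VectorField.mlieBracket 𝓘(ℝ, F) _ _ p = 0
    rw [VectorField.mlieBracket_swap_apply, neg_add_cancel]
  · simp only [Prod.snd_add, add_apply, smul_apply, smul_eq_mul]
    rw [dorfman_snd_apply hx hy hz, dorfman_snd_apply hy hx hz, diff_apply]
    have h : (fun q => GenGeom.pairing F q (x q) (y q)) =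
        fun q => (1 / 2 : ℝ) * ((x q).2 (y q).1 + (y q).2 (x q).1) := rfl
    rw [h, dirDeriv_mul_fun _ mdifferentiableAt_const
        (FunSmoothAt.add (hx.2.apply hy.1) (hy.2.apply hx.1)).mdifferentiableAt,
      dirDeriv_add_fun _ (hx.2.apply hy.1).mdifferentiableAt
        (hy.2.apply hx.1).mdifferentiableAt, dirDeriv_const]
    ring

theorem dorfman_add_left {x x' y : GSec F X} {p : X}
    (hx : SecSmoothAt F x p) (hx' : SecSmoothAt F x' p) (hy : SecSmoothAt F y p) :
    dorfman F (x + x') y p = dorfman F x y p + dorfman F x' y p := by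
  refine gt_ext ?_ fun z hz => ?_
  · exact VectorField.mlieBracket_add_left hx.1.mdifferentiableAt hx'.1.mdifferentiableAt
  · have hb : VectorField.mlieBracket 𝓘(ℝ, F) (fun q => ((x + x') q).1) z p =
        VectorField.mlieBracket 𝓘(ℝ, F) (fun q => (x q).1) z p +
          VectorField.mlieBracket 𝓘(ℝ, F) (fun q => (x' q).1) z p :=
      VectorField.mlieBracket_add_left hx.1.mdifferentiableAt hx'.1.mdifferentiableAt
    rw [dorfman_snd_apply (hx.add hx') hy hz, hb]
    simp only [Prod.snd_add, add_apply, Pi.add_apply, Prod.fst_add, map_add]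
    rw [dorfman_snd_apply hx hy hz, dorfman_snd_apply hx' hy hz,
      dirDeriv_add_fun _ (hx.2.apply hz).mdifferentiableAt (hx'.2.apply hz).mdifferentiableAt,
      dirDeriv_add_fun _ (hx.2.apply hy.1).mdifferentiableAt
        (hx'.2.apply hy.1).mdifferentiableAt, dirDeriv_add_vec]
    ring

end Calculus

/-! ### Cut-off functions and global vector fields -/

section Bump

section

variable {F : Type*} [NormedAddCommGroup F] [NormedSpace ℝ F]
  {X : Type*} [TopologicalSpace X] [ChartedSpace F X] [IsManifold 𝓘(ℝ, F) ∞ X]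

/-- A section that is smooth on a set becomes globally smooth when multiplied with a smooth
function supported in it. -/
theorem secSmoothAt_bump_smul {U : Set X} {s : GSec F X} (hs : ∀ q ∈ U, SecSmoothAt F s q)
    {χ : X → ℝ} (hχ : ∀ q, FunSmoothAt F χ q) (hχU : tsupport χ ⊆ U) (q : X) :
    SecSmoothAt F (fun q => χ q • s q) q := by
  by_cases hq : q ∈ tsupport χ
  · exact (hs q (hχU hq)).smul (hχ q)
  · refine SecSmoothAt.zero.congr ?_
    filter_upwards [notMem_tsupport_iff_eventuallyEq.1 hq] with r hr
    rw [hr]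
    simp

end

variable {F : Type*} [NormedAddCommGroup F] [NormedSpace ℝ F] [FiniteDimensional ℝ F]
  {X : Type*} [TopologicalSpace X] [ChartedSpace F X] [IsManifold 𝓘(ℝ, F) ∞ X] [T2Space X]

theorem exists_bump (F) [NormedAddCommGroup F] [NormedSpace ℝ F] [FiniteDimensional ℝ F]
    [ChartedSpace F X] [IsManifold 𝓘(ℝ, F) ∞ X] {p : X} {U : Set X} (hU : U ∈ 𝓝 p) :
    ∃ χ : X → ℝ, (∀ q, FunSmoothAt F χ q) ∧ (∀ᶠ q in 𝓝 p, χ q = 1) ∧ tsupport χ ⊆ U := by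
  obtain ⟨f, -, hf⟩ := (SmoothBumpFunction.nhds_basis_tsupport (I := 𝓘(ℝ, F)) p).mem_iff.1 hU
  exact ⟨f, fun q => f.contMDiffAt, f.eventuallyEq_one, hf⟩

theorem exists_vecSmooth_eq {p : X} (v : TangentSpace 𝓘(ℝ, F) p) :
    ∃ z : ∀ q : X, TangentSpace 𝓘(ℝ, F) q, (∀ q, VecSmoothAt F z q) ∧ z p = v := by
  obtain ⟨χ, h1, h2, h3⟩ := exists_bump F ((chartAt F p).open_source.mem_nhds
    (mem_chart_source F p))
  have hs : ∀ q ∈ (chartAt F p).source,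
      SecSmoothAt F (fun q => ((constField (F := F) p v q, 0) : GT F q)) q :=
    fun q hq => ⟨vecSmoothAt_constField' hq _, SecSmoothAt.zero.2⟩
  refine ⟨fun q => χ q • constField (F := F) p v q,
    fun q => (secSmoothAt_bump_smul hs h1 h3 q).1, ?_⟩
  simp only [h2.self_of_nhds, one_smul, constField_self]

end Bump

/-! ### Smooth dependence of inverse matrices -/

section MatrixInverse

variable {F : Type*} [NormedAddCommGroup F] [NormedSpace ℝ F]
  {X : Type*} [TopologicalSpace X] [ChartedSpace F X]

theorem FunSmoothAt.sum {ι : Type*} {A : Finset ι} {f : ι → X → ℝ} {p : X}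
    (hf : ∀ i ∈ A, FunSmoothAt F (f i) p) : FunSmoothAt F (fun q => ∑ i ∈ A, f i q) p :=
  ContMDiffAt.sum hf

theorem FunSmoothAt.det {ι : Type*} [Fintype ι] [DecidableEq ι] {A : X → Matrix ι ι ℝ} {p : X}
    (hA : ∀ i j, FunSmoothAt F (fun q => A q i j) p) : FunSmoothAt F (fun q => (A q).det) p := by
  simp only [Matrix.det_apply']
  exact FunSmoothAt.sum fun σ _ => FunSmoothAt.mul contMDiffAt_const
    (contMDiffAt_finsetProd fun i _ => hA _ _)

/-- Cramer's rule: the entries are minors of `A` divided by a determinant that does not vanish at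
`p`. -/
theorem FunSmoothAt.matrix_inv {ι : Type*} [Fintype ι] [DecidableEq ι]
    {A : X → Matrix ι ι ℝ} {p : X}
    (hA : ∀ i j, FunSmoothAt F (fun q => A q i j) p) (hp : (A p).det ≠ 0) (i j : ι) :
    FunSmoothAt F (fun q => (A q)⁻¹ i j) p := by
  simp only [Matrix.inv_def, Matrix.smul_apply, Ring.inverse_eq_inv', smul_eq_mul,
    Matrix.adjugate_apply]
  refine FunSmoothAt.mul (ContMDiffAt.inv₀ (FunSmoothAt.det hA) hp) (FunSmoothAt.det ?_)
  intro k l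
  simp only [Matrix.updateRow_apply]
  split_ifs
  · exact contMDiffAt_const
  · exact hA k l

end MatrixInverse

/-! ### Smooth maps applied to smooth vector fields -/

section Push

variable {F : Type*} [NormedAddCommGroup F] [NormedSpace ℝ F]
  {X : Type*} [TopologicalSpace X] [ChartedSpace F X] [IsManifold 𝓘(ℝ, F) ∞ X]
  {F' : Type*} [NormedAddCommGroup F'] [NormedSpace ℝ F']
  {Y : Type*} [TopologicalSpace Y] [ChartedSpace F' Y] [IsManifold 𝓘(ℝ, F') ∞ Y]

theorem contMDiffAt_mfderiv_apply {f : X → Y} {p : X} (hf : ContMDiffAt 𝓘(ℝ, F) 𝓘(ℝ, F') ∞ f p)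
    {v : ∀ q : X, TangentSpace 𝓘(ℝ, F) q} (hv : VecSmoothAt F v p) :
    ContMDiffAt 𝓘(ℝ, F) 𝓘(ℝ, F').tangent ∞
      (fun q => (⟨f q, mfderiv 𝓘(ℝ, F) 𝓘(ℝ, F') f q (v q)⟩ : TangentBundle 𝓘(ℝ, F') Y)) p := by
  have h := ContMDiffAt.mfderiv_const (m := ∞) hf (by simp)
  exact ContMDiffAt.clm_apply_of_inCoordinates (𝕜 := ℝ) (F₁ := F) (F₂ := F')
    (E₁ := fun q : X => TangentSpace 𝓘(ℝ, F) q) (E₂ := fun q : Y => TangentSpace 𝓘(ℝ, F') q)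
    (b₁ := id) (b₂ := f) (v := v) h hv hf

theorem FormSmoothAt.apply_mfderiv {f : X → Y} {p : X}
    (hf : ContMDiffAt 𝓘(ℝ, F) 𝓘(ℝ, F') ∞ f p)
    {v : ∀ q : X, TangentSpace 𝓘(ℝ, F) q} (hv : VecSmoothAt F v p)
    {α : ∀ q : Y, TangentSpace 𝓘(ℝ, F') q →L[ℝ] ℝ} (hα : FormSmoothAt F' α (f p)) :
    FunSmoothAt F (fun q => α (f q) (mfderiv 𝓘(ℝ, F) 𝓘(ℝ, F') f q (v q))) p := by
  have h1 := ContMDiffAt.comp p hα hf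
  have := ContMDiffAt.clm_bundle_apply (𝕜 := ℝ) (F₁ := F') (F₂ := ℝ) (b := f)
    (E₁ := fun p : Y => TangentSpace 𝓘(ℝ, F') p) (E₂ := fun _ : Y => ℝ) h1
    (contMDiffAt_mfderiv_apply hf hv)
  exact (contMDiffAt_totalSpace.1 this).2

theorem FunSmoothAt.dirDeriv {f : X → ℝ} {p : X} (hf : FunSmoothAt F f p)
    {v : ∀ q : X, TangentSpace 𝓘(ℝ, F) q} (hv : VecSmoothAt F v p) :
    FunSmoothAt F (fun q => dirDeriv 𝓘(ℝ, F) f q (v q)) p :=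
  (contMDiff_snd_tangentBundle_modelSpace ℝ 𝓘(ℝ, ℝ)).contMDiffAt.comp p
    (contMDiffAt_mfderiv_apply hf hv)

end Push

end GenGeom

end

noncomputable section

open scoped Topology
open Filter Set

set_option linter.unusedSectionVars false

namespace GenGeom

/-! ### The projection of a principal bundle and its derivative -/

section PrincipalBundle

variable {FM FN FG : Type*} [NormedAddCommGroup FM] [NormedSpace ℝ FM]
  [NormedAddCommGroup FN] [NormedSpace ℝ FN] [NormedAddCommGroup FG] [NormedSpace ℝ FG]
  {M : Type*} [TopologicalSpace M] [ChartedSpace FM M]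
  {N : Type*} [TopologicalSpace N] [ChartedSpace FN N]
  {G : Type*} [TopologicalSpace G] [ChartedSpace FG G] [Group G] [MulAction Gᵐᵒᵖ N]
  {π : N → M}

theorem IsPrincipalBundle.surjective (hπ : IsPrincipalBundle FM FN FG G π) :
    Function.Surjective π := by
  intro p
  obtain ⟨U, e, -, hpU, hs, ht, -, -, h1, -⟩ := hπ.locally_trivial p
  have hx : ((p, 1) : M × G) ∈ e.target := by rw [ht]; exact ⟨hpU, mem_univ _⟩
  refine ⟨e.symm (p, 1), ?_⟩
  rw [← h1 _ (e.map_target hx), e.right_inv hx]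

theorem IsPrincipalBundle.mdifferentiableAt (hπ : IsPrincipalBundle FM FN FG G π) (q : N) :
    MDifferentiableAt 𝓘(ℝ, FN) 𝓘(ℝ, FM) π q :=
  hπ.smooth_proj.contMDiffAt.mdifferentiableAt (by simp)

theorem IsPrincipalBundle.contMDiff_orbit (hπ : IsPrincipalBundle FM FN FG G π) (q : N) :
    ContMDiff 𝓘(ℝ, FG) 𝓘(ℝ, FN) ∞ (fun g : G => MulOpposite.op g • q) :=
  hπ.smooth_action.comp (contMDiff_const.prodMk contMDiff_id)

theorem IsPrincipalBundle.contMDiff_translate (hπ : IsPrincipalBundle FM FN FG G π) (g : G) :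
    ContMDiff 𝓘(ℝ, FN) 𝓘(ℝ, FN) ∞ (fun q : N => MulOpposite.op g • q) :=
  hπ.smooth_action.comp (contMDiff_id.prodMk contMDiff_const)

theorem IsPrincipalBundle.mdifferentiableAt_orbit (hπ : IsPrincipalBundle FM FN FG G π)
    (q : N) (g : G) :
    MDifferentiableAt 𝓘(ℝ, FG) 𝓘(ℝ, FN) (fun g : G => MulOpposite.op g • q) g :=
  (hπ.contMDiff_orbit q).contMDiffAt.mdifferentiableAt (by simp)

theorem IsPrincipalBundle.mdifferentiableAt_translate (hπ : IsPrincipalBundle FM FN FG G π)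
    (g : G) (q : N) :
    MDifferentiableAt 𝓘(ℝ, FN) 𝓘(ℝ, FN) (fun q : N => MulOpposite.op g • q) q :=
  (hπ.contMDiff_translate g).contMDiffAt.mdifferentiableAt (by simp)

/-- A local trivialization turns `π` into the first projection of a product, whose derivative is
onto. -/
theorem IsPrincipalBundle.mfderiv_surjective (hπ : IsPrincipalBundle FM FN FG G π) (q : N)
    (u : TangentSpace 𝓘(ℝ, FM) (π q)) :
    ∃ w : TangentSpace 𝓘(ℝ, FN) q, mfderiv 𝓘(ℝ, FN) 𝓘(ℝ, FM) π q w = u := by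
  obtain ⟨U, e, hU, hpU, hs, ht, -, h2, h1, -⟩ := hπ.locally_trivial (π q)
  have hq : q ∈ e.source := by rw [hs]; exact hpU
  have hopen : e.target ∈ 𝓝 (e q) := e.open_target.mem_nhds (e.map_source hq)
  have hd : MDifferentiableAt (𝓘(ℝ, FM).prod 𝓘(ℝ, FG)) 𝓘(ℝ, FN) e.symm (e q) :=
    (h2.contMDiffAt hopen).mdifferentiableAt (by simp)
  have hcomp : (π ∘ e.symm) =ᶠ[𝓝 (e q)] Prod.fst := by
    filter_upwards [hopen] with x hx
    rw [Function.comp_apply, ← h1 _ (e.map_target hx), e.right_inv hx]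
  have hder := hcomp.mfderiv_eq (I := 𝓘(ℝ, FM).prod 𝓘(ℝ, FG)) (I' := 𝓘(ℝ, FM))
  rw [mfderiv_comp (I' := 𝓘(ℝ, FN)) (e q) (hπ.mdifferentiableAt _) hd, mfderiv_fst] at hder
  have h3 : ∀ x : FM × FG, (mfderiv 𝓘(ℝ, FN) 𝓘(ℝ, FM) π (e.symm (e q)) : FN →L[ℝ] FM)
      ((mfderiv (𝓘(ℝ, FM).prod 𝓘(ℝ, FG)) 𝓘(ℝ, FN) e.symm (e q) : FM × FG →L[ℝ] FN) x) = x.1 :=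
    fun x => congrArg (fun L : FM × FG →L[ℝ] FM => L x) hder
  rw [e.left_inv hq] at h3
  exact ⟨_, h3 (u, 0)⟩

/-- `π` is constant along orbits; differentiate at the identity. -/
theorem IsPrincipalBundle.mfderiv_fundamentalField (hπ : IsPrincipalBundle FM FN FG G π)
    (v : GroupLieAlgebra 𝓘(ℝ, FG) G) (q : N) :
    mfderiv 𝓘(ℝ, FN) 𝓘(ℝ, FM) π q (fundamentalField FN FG v q) = 0 := by
  have hc : π ∘ (fun g : G => MulOpposite.op g • q) = fun _ => π q := by
    ext g; exact hπ.proj_smul q g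
  have hd := hπ.mdifferentiableAt_orbit q 1
  have h := mfderiv_comp (I' := 𝓘(ℝ, FN)) (1 : G) (hπ.mdifferentiableAt _) hd
  rw [hc, mfderiv_const] at h
  have h3 : (mfderiv 𝓘(ℝ, FN) 𝓘(ℝ, FM) π (MulOpposite.op (1 : G) • q) : FN →L[ℝ] FM)
      (fundamentalField FN FG v q) = 0 :=
    (congrArg (fun L : FG →L[ℝ] FM => L v) h).symm
  rw [MulOpposite.op_one, one_smul] at h3
  exact h3

end PrincipalBundle

/-! ### Fundamental fields and the vertical tangent spaces -/

section Fundamental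

variable {FM FN FG : Type*} [NormedAddCommGroup FM] [NormedSpace ℝ FM]
  [NormedAddCommGroup FN] [NormedSpace ℝ FN] [NormedAddCommGroup FG] [NormedSpace ℝ FG]
  {M : Type*} [TopologicalSpace M] [ChartedSpace FM M]
  {N : Type*} [TopologicalSpace N] [ChartedSpace FN N]
  {G : Type*} [TopologicalSpace G] [ChartedSpace FG G] [Group G] [LieGroup 𝓘(ℝ, FG) ∞ G]
  [MulAction Gᵐᵒᵖ N] {π : N → M}

theorem mdifferentiableAt_mul_left_lie (g h : G) :
    MDifferentiableAt 𝓘(ℝ, FG) 𝓘(ℝ, FG) (g * ·) h :=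
  (contMDiff_mul_left (I := 𝓘(ℝ, FG)) (n := ∞)).contMDiffAt.mdifferentiableAt (by simp)

/-- Left translation by the inverse undoes left translation, on tangent vectors. -/
theorem mfderiv_mul_left_comp (g h k : G) (hk : g * k = h) :
    ∀ v : FG, (mfderiv 𝓘(ℝ, FG) 𝓘(ℝ, FG) (g⁻¹ * ·) h : FG →L[ℝ] FG)
      ((mfderiv 𝓘(ℝ, FG) 𝓘(ℝ, FG) (g * ·) k : FG →L[ℝ] FG) v) = v := by
  subst hk
  have hc : (g⁻¹ * ·) ∘ (g * ·) = (id : G → G) := by ext x; simp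
  have h := mfderiv_comp (I' := 𝓘(ℝ, FG)) k (mdifferentiableAt_mul_left_lie (FG := FG) g⁻¹ (g * k))
    (mdifferentiableAt_mul_left_lie g k)
  rw [hc, mfderiv_id] at h
  exact fun v => (congrArg (fun L : FG →L[ℝ] FG => L v) h).symm

/-- Near each point of a principal bundle there is an equivariant smooth map to the group which,
together with the projection, separates tangent vectors. -/
theorem IsPrincipalBundle.exists_equivariant (hπ : IsPrincipalBundle FM FN FG G π) (q : N) :
    ∃ f : N → G, MDifferentiableAt 𝓘(ℝ, FN) 𝓘(ℝ, FG) f q ∧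
      (∀ g : G, f (MulOpposite.op g • q) = f q * g) ∧
      ∀ w : TangentSpace 𝓘(ℝ, FN) q, mfderiv 𝓘(ℝ, FN) 𝓘(ℝ, FM) π q w = 0 →
        mfderiv 𝓘(ℝ, FN) 𝓘(ℝ, FG) f q w = 0 → w = 0 := by
  obtain ⟨U, e, hU, hpU, hs, ht, h1, h2, h3, h4⟩ := hπ.locally_trivial (π q)
  have hq : q ∈ e.source := by rw [hs]; exact hpU
  have hsn : e.source ∈ 𝓝 q := e.open_source.mem_nhds hq
  have hf : MDifferentiableAt 𝓘(ℝ, FN) 𝓘(ℝ, FG) (fun r => (e r).2) q :=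
    (contMDiffAt_snd.comp q (h1.contMDiffAt hsn)).mdifferentiableAt (by simp)
  refine ⟨fun r => (e r).2, hf, fun g => h4 q hq g, fun w hw1 hw2 => ?_⟩
  have he : e =ᶠ[𝓝 q] fun r => (π r, (e r).2) := by
    filter_upwards [hsn] with r hr
    rw [← h3 r hr]
  have hde := he.mfderiv_eq (I := 𝓘(ℝ, FN)) (I' := 𝓘(ℝ, FM).prod 𝓘(ℝ, FG))
  rw [mfderiv_prodMk (hπ.mdifferentiableAt q) hf] at hde
  have hdw : (mfderiv 𝓘(ℝ, FN) (𝓘(ℝ, FM).prod 𝓘(ℝ, FG)) e q : FN →L[ℝ] FM × FG) w = 0 := by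
    have := congrArg (fun L : FN →L[ℝ] FM × FG => L w) hde
    exact this.trans (Prod.ext hw1 hw2)
  have hopen : e.target ∈ 𝓝 (e q) := e.open_target.mem_nhds (e.map_source hq)
  have hd : MDifferentiableAt (𝓘(ℝ, FM).prod 𝓘(ℝ, FG)) 𝓘(ℝ, FN) e.symm (e q) :=
    (h2.contMDiffAt hopen).mdifferentiableAt (by simp)
  have hid : e.symm ∘ e =ᶠ[𝓝 q] id := by
    filter_upwards [hsn] with r hr
    exact e.left_inv hr
  have hdid := hid.mfderiv_eq (I := 𝓘(ℝ, FN)) (I' := 𝓘(ℝ, FN))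
  rw [mfderiv_comp (I' := 𝓘(ℝ, FM).prod 𝓘(ℝ, FG)) q hd
    ((h1.contMDiffAt hsn).mdifferentiableAt (by simp)), mfderiv_id] at hdid
  have h5 : (mfderiv (𝓘(ℝ, FM).prod 𝓘(ℝ, FG)) 𝓘(ℝ, FN) e.symm (e q) : FM × FG →L[ℝ] FN)
      ((mfderiv 𝓘(ℝ, FN) (𝓘(ℝ, FM).prod 𝓘(ℝ, FG)) e q : FN →L[ℝ] FM × FG) w) = w :=
    congrArg (fun L : FN →L[ℝ] FN => L w) hdid
  rw [hdw] at h5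
  exact h5.symm.trans (map_zero _)

/-- An equivariant map composed with the orbit map of `q` is left translation by `f q`;
differentiate at the identity. -/
theorem mfderiv_equivariant (hπ : IsPrincipalBundle FM FN FG G π) {q : N} {f : N → G}
    (hf : MDifferentiableAt 𝓘(ℝ, FN) 𝓘(ℝ, FG) f q)
    (hfe : ∀ g : G, f (MulOpposite.op g • q) = f q * g) (v : GroupLieAlgebra 𝓘(ℝ, FG) G) :
    (mfderiv 𝓘(ℝ, FN) 𝓘(ℝ, FG) f q : FN →L[ℝ] FG) (fundamentalField FN FG v q) =
      (mfderiv 𝓘(ℝ, FG) 𝓘(ℝ, FG) (f q * ·) (1 : G) : FG →L[ℝ] FG) v := by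
  have hc : f ∘ (fun g : G => MulOpposite.op g • q) = (f q * ·) := funext hfe
  have hq : MulOpposite.op (1 : G) • q = q := by simp
  have h := mfderiv_comp (I' := 𝓘(ℝ, FN)) (g := f) (1 : G) (by rwa [hq])
    (hπ.mdifferentiableAt_orbit q 1)
  rw [hc] at h
  have h3 : (mfderiv 𝓘(ℝ, FN) 𝓘(ℝ, FG) f (MulOpposite.op (1 : G) • q) : FN →L[ℝ] FG)
      (fundamentalField FN FG v q) =
      (mfderiv 𝓘(ℝ, FG) 𝓘(ℝ, FG) (f q * ·) (1 : G) : FG →L[ℝ] FG) v :=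
    (congrArg (fun L : FG →L[ℝ] FG => L v) h).symm
  rw [hq] at h3
  exact h3

/-- The derivative of an equivariant map sends the fundamental vector to a left translate of `v`,
and left translation is invertible. -/
theorem IsPrincipalBundle.fundamentalField_eq_zero (hπ : IsPrincipalBundle FM FN FG G π)
    {q : N} {v : GroupLieAlgebra 𝓘(ℝ, FG) G} (h : fundamentalField FN FG v q = 0) : v = 0 := by
  obtain ⟨f, hf, hfe, -⟩ := hπ.exists_equivariant q
  have h1 := mfderiv_equivariant hπ hf hfe v
  rw [h] at h1
  rw [← mfderiv_mul_left_comp (FG := FG) (f q) (f q) 1 (mul_one _) v, ← h1]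
  exact (congrArg _ (map_zero (mfderiv 𝓘(ℝ, FN) 𝓘(ℝ, FG) f q : FN →L[ℝ] FG))).trans (map_zero _)

/-- A vertical vector is determined by its image under an equivariant map to the group. Translating
this image back to the identity gives the required element of the Lie algebra. -/
theorem IsPrincipalBundle.exists_fundamentalField_eq (hπ : IsPrincipalBundle FM FN FG G π)
    {q : N} {w : TangentSpace 𝓘(ℝ, FN) q} (hw : mfderiv 𝓘(ℝ, FN) 𝓘(ℝ, FM) π q w = 0) :
    ∃ v : GroupLieAlgebra 𝓘(ℝ, FG) G, fundamentalField FN FG v q = w := by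
  obtain ⟨f, hf, hfe, hinj⟩ := hπ.exists_equivariant q
  let u : FG := (mfderiv 𝓘(ℝ, FN) 𝓘(ℝ, FG) f q : FN →L[ℝ] FG) w
  let v : GroupLieAlgebra 𝓘(ℝ, FG) G :=
    (mfderiv 𝓘(ℝ, FG) 𝓘(ℝ, FG) ((f q)⁻¹ * ·) (f q) : FG →L[ℝ] FG) u
  have hv : (mfderiv 𝓘(ℝ, FG) 𝓘(ℝ, FG) (f q * ·) (1 : G) : FG →L[ℝ] FG) v = u := by
    have := mfderiv_mul_left_comp (FG := FG) (f q)⁻¹ 1 (f q) (by simp) u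
    rw [inv_inv] at this
    exact this
  refine ⟨v, ?_⟩
  have h1 := mfderiv_equivariant hπ hf hfe v
  rw [← sub_eq_zero]
  refine hinj _ ?_ ?_
  · rw [map_sub, hπ.mfderiv_fundamentalField, hw, sub_zero]
  · exact (map_sub _ _ _).trans (sub_eq_zero.2 (h1.trans hv))

end Fundamental

section FundamentalSmooth

variable {FM FN FG : Type*} [NormedAddCommGroup FM] [NormedSpace ℝ FM]
  [NormedAddCommGroup FN] [NormedSpace ℝ FN] [NormedAddCommGroup FG] [NormedSpace ℝ FG]
  {M : Type*} [TopologicalSpace M] [ChartedSpace FM M]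
  {N : Type*} [TopologicalSpace N] [ChartedSpace FN N] [IsManifold 𝓘(ℝ, FN) ∞ N]
  {G : Type*} [TopologicalSpace G] [ChartedSpace FG G] [Group G] [LieGroup 𝓘(ℝ, FG) ∞ G]
  [MulAction Gᵐᵒᵖ N] {π : N → M}

variable (N G) in
/-- The action, as a map `N × G → N`. -/
def actionMap (x : N × G) : N := MulOpposite.op x.2 • x.1

theorem mfderiv_actionMap (hπ : IsPrincipalBundle FM FN FG G π) (q : N) (g : G) (a : FN) (b : FG) :
    (mfderiv (𝓘(ℝ, FN).prod 𝓘(ℝ, FG)) 𝓘(ℝ, FN) (actionMap N G) (q, g) : FN × FG →L[ℝ] FN)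
      (a, b) =
    (mfderiv 𝓘(ℝ, FN) 𝓘(ℝ, FN) (fun r : N => MulOpposite.op g • r) q : FN →L[ℝ] FN) a +
      (mfderiv 𝓘(ℝ, FG) 𝓘(ℝ, FN) (fun h : G => MulOpposite.op h • q) g : FG →L[ℝ] FN) b :=
  mfderiv_prod_eq_add_apply (p := (q, g))
    (hπ.smooth_action.contMDiffAt.mdifferentiableAt (by simp))

theorem mfderiv_actionMap_left (hπ : IsPrincipalBundle FM FN FG G π) (q : N) (g : G) (a : FN) :
    (mfderiv (𝓘(ℝ, FN).prod 𝓘(ℝ, FG)) 𝓘(ℝ, FN) (actionMap N G) (q, g) : FN × FG →L[ℝ] FN)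
      (a, 0) =
    (mfderiv 𝓘(ℝ, FN) 𝓘(ℝ, FN) (fun r : N => MulOpposite.op g • r) q : FN →L[ℝ] FN) a := by
  have h0 (L : FN →L[ℝ] FN) (L' : FG →L[ℝ] FN) : L a + L' 0 = L a := by simp
  exact (mfderiv_actionMap hπ q g a 0).trans (h0 _ _)

theorem mfderiv_actionMap_right (hπ : IsPrincipalBundle FM FN FG G π) (q : N) (g : G) (b : FG) :
    (mfderiv (𝓘(ℝ, FN).prod 𝓘(ℝ, FG)) 𝓘(ℝ, FN) (actionMap N G) (q, g) : FN × FG →L[ℝ] FN)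
      (0, b) =
    (mfderiv 𝓘(ℝ, FG) 𝓘(ℝ, FN) (fun h : G => MulOpposite.op h • q) g : FG →L[ℝ] FN) b := by
  have h0 (L : FN →L[ℝ] FN) (L' : FG →L[ℝ] FN) : L 0 + L' b = L' b := by simp
  exact (mfderiv_actionMap hπ q g 0 b).trans (h0 _ _)

/-- The field is the tangent map of the action applied to the pairs `(0, v)` over the points `(r,
1)`, and these depend smoothly on `r`. -/
theorem IsPrincipalBundle.vecSmoothAt_fundamentalField (hπ : IsPrincipalBundle FM FN FG G π)
    (v : GroupLieAlgebra 𝓘(ℝ, FG) G) (q : N) : VecSmoothAt FN (fundamentalField FN FG v) q := by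
  have s1 : ContMDiff 𝓘(ℝ, FN) (𝓘(ℝ, FN).tangent.prod 𝓘(ℝ, FG).tangent) ∞
      (fun r : N => ((⟨r, 0⟩, ⟨1, v⟩) : TangentBundle 𝓘(ℝ, FN) N × TangentBundle 𝓘(ℝ, FG) G)) :=
    (Bundle.contMDiff_zeroSection ℝ _).prodMk contMDiff_const
  have s2 := (contMDiff_equivTangentBundleProd_symm (I := 𝓘(ℝ, FN)) (M := N) (I' := 𝓘(ℝ, FG))
    (M' := G) (n := ∞)).comp s1
  have s3 := (hπ.smooth_action.contMDiff_tangentMap (m := ∞) (by simp)).comp s2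
  refine (s3.contMDiffAt (x := q)).congr_of_eventuallyEq (Eventually.of_forall fun r => ?_)
  -- The tangent map has base point `r · 1`, which is `r` only propositionally.
  have h1 : ∀ r' (_ : r' = r) (x : FN), (⟨r, x⟩ : TangentBundle 𝓘(ℝ, FN) N) = ⟨r', x⟩ := by
    rintro _ rfl _; rfl
  have h2 := mfderiv_actionMap_right hπ r 1 v
  refine (h1 (MulOpposite.op (1 : G) • r) (by simp) _).trans ?_
  exact congrArg (fun x : FN => (⟨MulOpposite.op (1 : G) • r, x⟩ : TangentBundle 𝓘(ℝ, FN) N))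
    h2.symm

end FundamentalSmooth

/-! ### Horizontal lifts of tangent vectors -/

section LinearLift

variable {E E' : Type*} [NormedAddCommGroup E] [NormedSpace ℝ E] [FiniteDimensional ℝ E]
  [NormedAddCommGroup E'] [NormedSpace ℝ E'] [FiniteDimensional ℝ E']
  {L : E →L[ℝ] E'} {K : Submodule ℝ E}

theorem bijective_comp_subtypeL (hK : IsCompl K L.ker)
    (hL : ∀ u, ∃ w, L w = u) : Function.Bijective (L.comp K.subtypeL) := by
  constructor
  · rw [injective_iff_map_eq_zero]
    intro x hx
    have : (x : E) ∈ K ⊓ L.ker := ⟨x.2, hx⟩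
    rw [hK.inf_eq_bot] at this
    exact Subtype.ext this
  · intro u
    obtain ⟨w, hw⟩ := hL u
    obtain ⟨a, ha, b, hb, hab⟩ := Submodule.mem_sup.1 (hK.sup_eq_top ▸ Submodule.mem_top (x := w))
    refine ⟨⟨a, ha⟩, ?_⟩
    have hb' : L b = 0 := hb
    rw [← hw, ← hab, map_add, hb', add_zero]
    rfl

theorem isInvertible_comp_subtypeL (hK : IsCompl K L.ker)
    (hL : ∀ u, ∃ w, L w = u) : (L.comp K.subtypeL).IsInvertible :=
  ⟨(LinearEquiv.ofBijective (L.comp K.subtypeL).toLinearMap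
    (bijective_comp_subtypeL hK hL)).toContinuousLinearEquiv, by ext x; rfl⟩

end LinearLift

section Horizontal

variable {FM FN FG : Type*} [NormedAddCommGroup FM] [NormedSpace ℝ FM] [FiniteDimensional ℝ FM]
  [NormedAddCommGroup FN] [NormedSpace ℝ FN] [FiniteDimensional ℝ FN]
  [NormedAddCommGroup FG] [NormedSpace ℝ FG] [FiniteDimensional ℝ FG]
  {M : Type*} [TopologicalSpace M] [ChartedSpace FM M]
  {N : Type*} [TopologicalSpace N] [ChartedSpace FN N] [IsManifold 𝓘(ℝ, FN) ∞ N]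
  {G : Type*} [TopologicalSpace G] [ChartedSpace FG G] [Group G] [LieGroup 𝓘(ℝ, FG) ∞ G]
  [MulAction Gᵐᵒᵖ N] {π : N → M} {H : Distribution FN N}
  (hπ : IsPrincipalBundle FM FN FG G π) (hH : IsFlatConnection FM FN FG G π H)

theorem horLift_mem (q : N) (u : TangentSpace 𝓘(ℝ, FM) (π q)) :
    horLift FM FN π H q u ∈ H q := Submodule.coe_mem _

include hπ hH

theorem isInvertible_mfderiv_comp_subtypeL (q : N) :
    ((mfderiv 𝓘(ℝ, FN) 𝓘(ℝ, FM) π q).comp (H q).subtypeL).IsInvertible :=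
  isInvertible_comp_subtypeL (E := FN) (E' := FM) (hH.isCompl q) (hπ.mfderiv_surjective q)

theorem mfderiv_horLift (q : N) (u : TangentSpace 𝓘(ℝ, FM) (π q)) :
    mfderiv 𝓘(ℝ, FN) 𝓘(ℝ, FM) π q (horLift FM FN π H q u) = u :=
  (isInvertible_mfderiv_comp_subtypeL hπ hH q).self_apply_inverse u

theorem horLift_mfderiv {q : N} {w : TangentSpace 𝓘(ℝ, FN) q} (hw : w ∈ H q) :
    horLift FM FN π H q (mfderiv 𝓘(ℝ, FN) 𝓘(ℝ, FM) π q w) = w :=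
  congrArg Subtype.val
    ((isInvertible_mfderiv_comp_subtypeL hπ hH q).inverse_apply_self (⟨w, hw⟩ : H q))

theorem eq_horLift {q : N} {w : TangentSpace 𝓘(ℝ, FN) q} (hw : w ∈ H q)
    {u : TangentSpace 𝓘(ℝ, FM) (π q)} (h : mfderiv 𝓘(ℝ, FN) 𝓘(ℝ, FM) π q w = u) :
    horLift FM FN π H q u = w := by
  rw [← h, horLift_mfderiv hπ hH hw]

/-- Every tangent vector is the sum of a horizontal lift and a fundamental vector. -/
theorem exists_eq_horLift_add (q : N) (w : TangentSpace 𝓘(ℝ, FN) q) :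
    ∃ (u : TangentSpace 𝓘(ℝ, FM) (π q)) (v : GroupLieAlgebra 𝓘(ℝ, FG) G),
      w = horLift FM FN π H q u + fundamentalField FN FG v q := by
  obtain ⟨v, hv⟩ := hπ.exists_fundamentalField_eq (q := q)
    (w := w - horLift FM FN π H q (mfderiv 𝓘(ℝ, FN) 𝓘(ℝ, FM) π q w)) (by
      rw [map_sub, mfderiv_horLift hπ hH, sub_self])
  exact ⟨_, v, by rw [hv]; abel⟩

omit hπ hH in
variable (π H) in
/-- The horizontal lift of a vector field. -/
def horField (s : ∀ p : M, TangentSpace 𝓘(ℝ, FM) p) (q : N) : TangentSpace 𝓘(ℝ, FN) q :=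
  horLift FM FN π H q (s (π q))

/-- `H` is invariant and translation does not change `π`, so the translate of a lift is a horizontal
vector over the same vector of the base. -/
theorem mfderiv_translate_horField (s : ∀ p : M, TangentSpace 𝓘(ℝ, FM) p) (g : G) (q : N) :
    mfderiv 𝓘(ℝ, FN) 𝓘(ℝ, FN) (fun r : N => MulOpposite.op g • r) q (horField π H s q) =
      horField π H s (MulOpposite.op g • q) := by
  symm
  refine eq_horLift hπ hH ?_ ?_
  · rw [← hH.invariant q g]
    exact Submodule.mem_map_of_mem (horLift_mem q _)
  · have hc : π ∘ (fun r : N => MulOpposite.op g • r) = π := funext fun r => hπ.proj_smul r g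
    have h := mfderiv_comp (I' := 𝓘(ℝ, FN)) q (hπ.mdifferentiableAt _)
      (hπ.mdifferentiableAt_translate g q)
    rw [hc] at h
    have h1 : (mfderiv 𝓘(ℝ, FN) 𝓘(ℝ, FM) π (MulOpposite.op g • q) : FN →L[ℝ] FM)
        (mfderiv 𝓘(ℝ, FN) 𝓘(ℝ, FN) (fun r : N => MulOpposite.op g • r) q (horField π H s q)) =
        tangentCoord 𝓘(ℝ, FM) (s (π q)) :=
      (congrArg (fun L : FN →L[ℝ] FM => L (horField π H s q)) h).symm.trans
        (mfderiv_horLift hπ hH q (s (π q)))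
    have h2 : ∀ p (_ : p = π q), tangentCoord 𝓘(ℝ, FM) (s (π q)) = tangentCoord 𝓘(ℝ, FM) (s p) := by
      rintro _ rfl; rfl
    exact h1.trans (h2 _ (hπ.proj_smul q g))

end Horizontal

/-! ### Smooth coefficients in a frame, by Cramer's rule -/

section Coefficients

variable {F : Type*} [NormedAddCommGroup F] [NormedSpace ℝ F]
  {X : Type*} [TopologicalSpace X] [ChartedSpace F X] [IsManifold 𝓘(ℝ, F) ∞ X]
  {F' : Type*} [NormedAddCommGroup F'] [NormedSpace ℝ F'] [FiniteDimensional ℝ F']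
  {Y : Type*} [TopologicalSpace Y] [ChartedSpace F' Y] [IsManifold 𝓘(ℝ, F') ∞ Y]

/-- If the differential of `f : X → Y` is invertible on the span of the smooth fields `eᵢ`, then
a field in their span has smooth coefficients as soon as its image under `f` is smooth. -/
theorem exists_smooth_coeffs {ι : Type*} [Fintype ι] {f : X → Y} {p : X}
    (hf : ContMDiffAt 𝓘(ℝ, F) 𝓘(ℝ, F') ∞ f p) (e : ι → ∀ q : X, TangentSpace 𝓘(ℝ, F) q)
    (he : ∀ i, VecSmoothAt F (e i) p) (hι : Fintype.card ι = Module.finrank ℝ F')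
    (hinj : ∀ c : ι → ℝ, mfderiv 𝓘(ℝ, F) 𝓘(ℝ, F') f p (∑ i, c i • e i p) = 0 → c = 0)
    (w : ∀ q : X, TangentSpace 𝓘(ℝ, F) q)
    (hw : ∀ᶠ q in 𝓝 p, ∃ c : ι → ℝ, w q = ∑ i, c i • e i q)
    (hw' : ∀ ξ : Y → ℝ, FunSmoothAt F' ξ (f p) →
      FunSmoothAt F (fun q => dirDeriv 𝓘(ℝ, F) (ξ ∘ f) q (w q)) p) :
    ∃ c : ι → X → ℝ, (∀ i, FunSmoothAt F (c i) p) ∧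
      ∀ᶠ q in 𝓝 p, w q = ∑ i, c i q • e i q := by
  classical
  have hcard : Fintype.card (Fin (Module.finrank ℝ F')) = Fintype.card ι := by simp [hι]
  let b : Module.Basis ι ℝ F' :=
    (Module.finBasis ℝ F').reindex (Fintype.equivOfCardEq hcard)
  -- Differentiating the chart coordinates along `w` turns the expansion of `w` into a square linear
  -- system with smooth entries.
  let ξ : ι → Y → ℝ := fun j y => b.coord j (extChartAt 𝓘(ℝ, F') (f p) y)
  have hξ : ∀ j, FunSmoothAt F' (ξ j) (f p) := fun j =>
    ((LinearMap.toContinuousLinearMap (b.coord j)).contMDiff.contMDiffAt).comp (f p)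
      contMDiffAt_extChartAt
  have hξf : ∀ j, FunSmoothAt F (ξ j ∘ f) p := fun j => (hξ j).comp p hf
  let A : X → Matrix ι ι ℝ := fun q =>
    Matrix.of fun j i => dirDeriv 𝓘(ℝ, F) (ξ j ∘ f) q (e i q)
  let β : X → ι → ℝ := fun q j => dirDeriv 𝓘(ℝ, F) (ξ j ∘ f) q (w q)
  have hA : ∀ j i, FunSmoothAt F (fun q => A q j i) p := fun j i => (hξf j).dirDeriv (he i)
  have hβ : ∀ j, FunSmoothAt F (fun q => β q j) p := fun j => hw' _ (hξ j)
  have hsum : ∀ q (c : ι → ℝ) j, dirDeriv 𝓘(ℝ, F) (ξ j ∘ f) q (∑ i, c i • e i q) =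
      (A q).mulVec c j := by
    intro q c j
    have h0 (L : F →L[ℝ] ℝ) (x : ι → F) : L (∑ i, c i • x i) = ∑ i, L (x i) * c i := by
      simp [mul_comm]
    exact h0 (mfderiv 𝓘(ℝ, F) 𝓘(ℝ, ℝ) (ξ j ∘ f) q) (fun i => e i q)
  -- All chart coordinates of the image under `mfderiv f p` would vanish on a kernel vector of the
  -- matrix, and `hinj` excludes this.
  have hdet : (A p).det ≠ 0 := by
    intro h0
    obtain ⟨c, hc0, hc⟩ := Matrix.exists_mulVec_eq_zero_iff.2 h0
    refine hc0 (hinj c ?_)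
    have h1 : ∀ j, b.coord j (tangentCoord 𝓘(ℝ, F')
        (mfderiv 𝓘(ℝ, F) 𝓘(ℝ, F') f p (∑ i, c i • e i p))) = 0 := by
      intro j
      have h2 := hsum p c j
      rw [hc, dirDeriv_comp (hξ j).mdifferentiableAt (hf.mdifferentiableAt (by simp))] at h2
      have h3 := dirDeriv_comp (I := 𝓘(ℝ, F')) (p := f p) (I₂ := 𝓘(ℝ, F'))
        (g := LinearMap.toContinuousLinearMap (b.coord j)) (f := extChartAt 𝓘(ℝ, F') (f p))
        ((LinearMap.toContinuousLinearMap (b.coord j)).contMDiff.contMDiffAt.mdifferentiableAt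
          (n := ∞) (by simp))
        (contMDiffAt_extChartAt.mdifferentiableAt (n := ∞) (by simp))
        (mfderiv 𝓘(ℝ, F) 𝓘(ℝ, F') f p (∑ i, c i • e i p))
      have h4 := dirDeriv_extChartAt_self (I := 𝓘(ℝ, F')) (p := f p)
        (mfderiv 𝓘(ℝ, F) 𝓘(ℝ, F') f p (∑ i, c i • e i p))
      rw [← h4]
      refine Eq.trans ?_ h2
      refine Eq.trans ?_ h3.symm
      have h5 (L : F' →L[ℝ] ℝ) (x y : F') : L x = mfderiv 𝓘(ℝ, F') 𝓘(ℝ, ℝ) L y x := by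
        rw [mfderiv_eq_fderiv, ContinuousLinearMap.fderiv]; rfl
      exact h5 (LinearMap.toContinuousLinearMap (b.coord j)) _ _
    exact (b.ext_elem_iff (y := 0)).2 fun j => by
      rw [map_zero, Finsupp.zero_apply]
      exact h1 j
  have hev : ∀ᶠ q in 𝓝 p, (A q).det ≠ 0 :=
    (FunSmoothAt.det hA).continuousAt.eventually_ne hdet
  refine ⟨fun i q => ∑ j, (A q)⁻¹ i j * β q j, fun i => FunSmoothAt.sum fun j _ =>
    FunSmoothAt.mul (FunSmoothAt.matrix_inv hA hdet i j) (hβ j), ?_⟩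
  filter_upwards [hev, hw] with q hq ⟨c, hc⟩
  have h1 : (A q).mulVec c = β q := funext fun j => by rw [← hsum, ← hc]
  have h2 : c = (A q)⁻¹.mulVec (β q) := by
    rw [← h1, Matrix.mulVec_mulVec, Matrix.nonsing_inv_mul _ (isUnit_iff_ne_zero.2 hq),
      Matrix.one_mulVec]
  rw [hc]
  refine Finset.sum_congr rfl fun i _ => ?_
  rw [h2]
  rfl

end Coefficients

/-! ### Horizontal lifts of vector fields and flatness -/

section Horizontal

variable {FM FN FG : Type*} [NormedAddCommGroup FM] [NormedSpace ℝ FM] [FiniteDimensional ℝ FM]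
  [NormedAddCommGroup FN] [NormedSpace ℝ FN] [FiniteDimensional ℝ FN]
  [NormedAddCommGroup FG] [NormedSpace ℝ FG] [FiniteDimensional ℝ FG]
  {M : Type*} [TopologicalSpace M] [ChartedSpace FM M] [IsManifold 𝓘(ℝ, FM) ∞ M]
  {N : Type*} [TopologicalSpace N] [ChartedSpace FN N] [IsManifold 𝓘(ℝ, FN) ∞ N]
  {G : Type*} [TopologicalSpace G] [ChartedSpace FG G] [Group G] [LieGroup 𝓘(ℝ, FG) ∞ G]
  [MulAction Gᵐᵒᵖ N] {π : N → M} {H : Distribution FN N}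
  (hπ : IsPrincipalBundle FM FN FG G π) (hH : IsFlatConnection FM FN FG G π H)

include hπ hH

/-- A smooth local frame of the horizontal distribution, on which the differential of the
projection is injective. -/
theorem exists_horizontal_frame (q₀ : N) :
    ∃ (r : ℕ) (e : Fin r → ∀ q : N, TangentSpace 𝓘(ℝ, FN) q), r = Module.finrank ℝ FM ∧
      (∀ i, VecSmoothAt FN (e i) q₀) ∧
      (∀ᶠ q in 𝓝 q₀, ∀ w ∈ H q, ∃ c : Fin r → ℝ, w = ∑ i, c i • e i q) ∧
      (∀ᶠ q in 𝓝 q₀, ∀ i, e i q ∈ H q) ∧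
      ∀ c : Fin r → ℝ, mfderiv 𝓘(ℝ, FN) 𝓘(ℝ, FM) π q₀ (∑ i, c i • e i q₀) = 0 → c = 0 := by
  obtain ⟨U, hU, hqU, r, e, he, hspan⟩ := hH.subbundle q₀
  have hUn := hU.mem_nhds hqU
  refine ⟨r, e, ?_, fun i => (he i).contMDiffAt hUn, ?_, ?_, ?_⟩
  · have h1 : Module.finrank ℝ (H q₀) = r := by
      rw [← (hspan q₀ hqU).2, finrank_span_eq_card (hspan q₀ hqU).1, Fintype.card_fin]
    have h0 (L : FN →L[ℝ] FM) (K : Submodule ℝ FN) (hK : IsCompl K L.ker)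
        (hL : ∀ u, ∃ w, L w = u) : Module.finrank ℝ K = Module.finrank ℝ FM :=
      (LinearEquiv.ofBijective (L.comp K.subtypeL).toLinearMap
        (bijective_comp_subtypeL hK hL)).finrank_eq
    exact h1.symm.trans (h0 _ _ (hH.isCompl q₀) (hπ.mfderiv_surjective q₀))
  · filter_upwards [hUn] with q hq w hw
    rw [← (hspan q hq).2] at hw
    obtain ⟨c, hc⟩ := (Submodule.mem_span_range_iff_exists_fun ℝ).1 hw
    exact ⟨c, hc.symm⟩
  · filter_upwards [hUn] with q hq i
    rw [← (hspan q hq).2]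
    exact Submodule.subset_span (mem_range_self i)
  · intro c hc
    have hm : (∑ i, c i • e i q₀) ∈ H q₀ := by
      rw [← (hspan q₀ hqU).2]
      exact Submodule.sum_mem _ fun i _ =>
        Submodule.smul_mem _ _ (Submodule.subset_span (mem_range_self i))
    have h0 : (∑ i, c i • e i q₀) = 0 := by
      have : (∑ i, c i • e i q₀) ∈ H q₀ ⊓ (mfderiv 𝓘(ℝ, FN) 𝓘(ℝ, FM) π q₀).ker := ⟨hm, hc⟩
      rwa [(hH.isCompl q₀).inf_eq_bot] at this
    exact funext fun i => Fintype.linearIndependent_iff.1 (hspan q₀ hqU).1 c h0 i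

/-- The lift is defined by pointwise inversion, so smoothness needs an argument. The derivative of
`ξ ∘ π` along the lift is the smooth function `dξ(s) ∘ π`, and `exists_smooth_coeffs` for `π` and a
horizontal frame supplies smooth coefficients. -/
theorem vecSmoothAt_horField {s : ∀ p : M, TangentSpace 𝓘(ℝ, FM) p} {q₀ : N}
    (hs : VecSmoothAt FM s (π q₀)) : VecSmoothAt FN (horField π H s) q₀ := by
  obtain ⟨r, e, hr, he, hspan, -, hinj⟩ := exists_horizontal_frame hπ hH q₀
  have key : ∀ ξ : M → ℝ, FunSmoothAt FM ξ (π q₀) →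
      FunSmoothAt FN (fun q => dirDeriv 𝓘(ℝ, FN) (ξ ∘ π) q (horField π H s q)) q₀ := by
    intro ξ hξ
    have h1 : ContMDiffAt 𝓘(ℝ, FN) 𝓘(ℝ, ℝ) ∞
        (fun q => dirDeriv 𝓘(ℝ, FM) ξ (π q) (s (π q))) q₀ :=
      ContMDiffAt.comp (g := fun p => dirDeriv 𝓘(ℝ, FM) ξ p (s p)) q₀ (hξ.dirDeriv hs)
        hπ.smooth_proj.contMDiffAt
    have h2 := (contMDiffAt_iff_contMDiffAt_nhds (by simp)).1 (hξ.of_le (m := 1) (by simp))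
    refine h1.congr_of_eventuallyEq ?_
    filter_upwards [hπ.smooth_proj.continuous.continuousAt.eventually h2] with q hq
    rw [dirDeriv_comp (hq.mdifferentiableAt (by simp)) (hπ.mdifferentiableAt q)]
    exact congrArg _ (mfderiv_horLift hπ hH q (s (π q)))
  obtain ⟨c, hc, hw⟩ := exists_smooth_coeffs hπ.smooth_proj.contMDiffAt e he
    (by rw [Fintype.card_fin, hr]) hinj (horField π H s)
    (hspan.mono fun q hq => hq _ (horLift_mem q _)) key
  have h1 : ContMDiffAt 𝓘(ℝ, FN) (𝓘(ℝ, FN).prod 𝓘(ℝ, FN)) ∞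
      (fun q => (Bundle.TotalSpace.mk' FN q (∑ i, c i q • e i q) :
        Bundle.TotalSpace FN (fun p : N => TangentSpace 𝓘(ℝ, FN) p))) q₀ :=
    ContMDiffAt.sum_section fun i _ => (hc i).smul_section (he i)
  exact VecSmoothAt.congr h1 hw

/-- This is where flatness enters: the bracket of two lifts projects to the bracket on the base, and
by involutivity it is horizontal, so it is the lift of its projection. -/
theorem horField_bracket_related {s t : ∀ p : M, TangentSpace 𝓘(ℝ, FM) p} {q : N}
    (hs : ∀ p, VecSmoothAt FM s p) (ht : ∀ p, VecSmoothAt FM t p) :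
    VectorField.mlieBracket 𝓘(ℝ, FN) (horField π H s) (horField π H t) q =
      horField π H (VectorField.mlieBracket 𝓘(ℝ, FM) s t) q := by
  have h1 := mlieBracket_related (I := 𝓘(ℝ, FN)) (I₂ := 𝓘(ℝ, FM)) (p := q)
    (hπ.smooth_proj.contMDiffAt.of_le ENat.LEInfty.out)
    (vecSmoothAt_horField hπ hH (hs (π q))).mdifferentiableAt
    (vecSmoothAt_horField hπ hH (ht (π q))).mdifferentiableAt
    (hs (π q)).mdifferentiableAt (ht (π q)).mdifferentiableAt
    (Eventually.of_forall fun q => mfderiv_horLift hπ hH q _)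
    (Eventually.of_forall fun q => mfderiv_horLift hπ hH q _)
  exact (eq_horLift hπ hH (hH.involutive _ _
    (fun r _ => (vecSmoothAt_horField hπ hH (hs (π r))).contMDiffWithinAt)
    (fun r _ => (vecSmoothAt_horField hπ hH (ht (π r))).contMDiffWithinAt)
    (fun r => horLift_mem r _) (fun r => horLift_mem r _) q) h1).symm

end Horizontal

/-! ### Brackets of lifts and fundamental fields -/

section Brackets

variable {FM FN FG : Type*} [NormedAddCommGroup FM] [NormedSpace ℝ FM] [FiniteDimensional ℝ FM]
  [NormedAddCommGroup FN] [NormedSpace ℝ FN] [FiniteDimensional ℝ FN]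
  [NormedAddCommGroup FG] [NormedSpace ℝ FG] [FiniteDimensional ℝ FG]
  {M : Type*} [TopologicalSpace M] [ChartedSpace FM M] [IsManifold 𝓘(ℝ, FM) ∞ M]
  {N : Type*} [TopologicalSpace N] [ChartedSpace FN N] [IsManifold 𝓘(ℝ, FN) ∞ N]
  {G : Type*} [TopologicalSpace G] [ChartedSpace FG G] [Group G] [LieGroup 𝓘(ℝ, FG) ∞ G]
  [MulAction Gᵐᵒᵖ N] {π : N → M} {H : Distribution FN N}

theorem mdifferentiableAt_invariantField (v : GroupLieAlgebra 𝓘(ℝ, FG) G) (g : G) :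
    MDifferentiableAt 𝓘(ℝ, FG) 𝓘(ℝ, FG).tangent
      (fun g => (⟨g, mulInvariantVectorField v g⟩ : TangentBundle 𝓘(ℝ, FG) G)) g := by
  have : LieGroup 𝓘(ℝ, FG) (minSmoothness ℝ 3) G :=
    LieGroup.of_le (n := ∞) (by rw [minSmoothness_of_isRCLikeNormedField]; exact ENat.LEInfty.out)
  exact mdifferentiableAt_mulInvariantVectorField v

/-- Differentiate `q · (g h) = (q · g) · h` at `h = 1`. The orbit map thus relates left-invariant
fields to fundamental ones, so that their brackets correspond. -/
theorem mfderiv_orbit_invariantField (hπ : IsPrincipalBundle FM FN FG G π)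
    (v : GroupLieAlgebra 𝓘(ℝ, FG) G) (q : N) (g : G) :
    mfderiv 𝓘(ℝ, FG) 𝓘(ℝ, FN) (fun h : G => MulOpposite.op h • q) g
      (mulInvariantVectorField v g) = fundamentalField FN FG v (MulOpposite.op g • q) := by
  have hc : (fun h : G => MulOpposite.op h • q) ∘ (g * ·) =
      fun h : G => MulOpposite.op h • MulOpposite.op g • q :=
    funext fun h => by simp [mul_smul]
  have h := mfderiv_comp (I' := 𝓘(ℝ, FG)) (g := fun h : G => MulOpposite.op h • q) (1 : G)
    (hπ.mdifferentiableAt_orbit q _) (mdifferentiableAt_mul_left_lie (FG := FG) g 1)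
  rw [hc] at h
  have h3 : (mfderiv 𝓘(ℝ, FG) 𝓘(ℝ, FN) (fun h : G => MulOpposite.op h • q) (g * 1) : FG →L[ℝ] FN)
      (mulInvariantVectorField v g) = fundamentalField FN FG v (MulOpposite.op g • q) :=
    (congrArg (fun L : FG →L[ℝ] FN => L v) h).symm
  rw [mul_one] at h3
  exact h3

/-- The bracket of two fundamental fields is fundamental. -/
theorem mlieBracket_fundamentalField (hπ : IsPrincipalBundle FM FN FG G π)
    (v w : GroupLieAlgebra 𝓘(ℝ, FG) G) (q : N) :
    VectorField.mlieBracket 𝓘(ℝ, FN) (fundamentalField FN FG v) (fundamentalField FN FG w) q =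
      fundamentalField FN FG (⁅v, w⁆ : GroupLieAlgebra 𝓘(ℝ, FG) G) q := by
  have h1 := mlieBracket_related (I := 𝓘(ℝ, FG)) (I₂ := 𝓘(ℝ, FN)) (p := (1 : G))
    (f := fun h : G => MulOpposite.op h • q)
    ((hπ.contMDiff_orbit q).contMDiffAt.of_le ENat.LEInfty.out)
    (mdifferentiableAt_invariantField v 1) (mdifferentiableAt_invariantField w 1)
    (hπ.vecSmoothAt_fundamentalField v _).mdifferentiableAt
    (hπ.vecSmoothAt_fundamentalField w _).mdifferentiableAt
    (Eventually.of_forall fun g => mfderiv_orbit_invariantField hπ v q g)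
    (Eventually.of_forall fun g => mfderiv_orbit_invariantField hπ w q g)
  have h2 : ∀ r (_ : r = q), tangentCoord 𝓘(ℝ, FN) (VectorField.mlieBracket 𝓘(ℝ, FN)
      (fundamentalField FN FG v) (fundamentalField FN FG w) r) =
      tangentCoord 𝓘(ℝ, FN) (VectorField.mlieBracket 𝓘(ℝ, FN)
      (fundamentalField FN FG v) (fundamentalField FN FG w) q) := by
    rintro _ rfl; rfl
  exact (h2 _ (by simp)).symm.trans h1.symm

/-- A vector field on a product, from one on each factor. -/
theorem mdifferentiableAt_prodField {v : ∀ q : N, TangentSpace 𝓘(ℝ, FN) q}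
    {w : ∀ g : G, TangentSpace 𝓘(ℝ, FG) g} {q : N} {g : G}
    (hv : MDifferentiableAt 𝓘(ℝ, FN) 𝓘(ℝ, FN).tangent
      (fun q => (⟨q, v q⟩ : TangentBundle 𝓘(ℝ, FN) N)) q)
    (hw : MDifferentiableAt 𝓘(ℝ, FG) 𝓘(ℝ, FG).tangent
      (fun g => (⟨g, w g⟩ : TangentBundle 𝓘(ℝ, FG) G)) g) :
    MDifferentiableAt (𝓘(ℝ, FN).prod 𝓘(ℝ, FG)) (𝓘(ℝ, FN).prod 𝓘(ℝ, FG)).tangent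
      (fun x : N × G => (⟨x, (v x.1, w x.2)⟩ :
        TangentBundle (𝓘(ℝ, FN).prod 𝓘(ℝ, FG)) (N × G))) (q, g) := by
  have h1 := (hv.comp (q, g) (f := Prod.fst) (I := 𝓘(ℝ, FN).prod 𝓘(ℝ, FG)) mdifferentiableAt_fst).prodMk
    (hw.comp (q, g) (f := Prod.snd) (I := 𝓘(ℝ, FN).prod 𝓘(ℝ, FG)) mdifferentiableAt_snd)
  exact ((contMDiff_equivTangentBundleProd_symm (I := 𝓘(ℝ, FN)) (M := N) (I' := 𝓘(ℝ, FG))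
    (M' := G) (n := 1)).contMDiffAt.mdifferentiableAt (by simp)).comp (q, g) h1

/-- Under either projection one of the two fields is related to the zero field, so both components
of the bracket vanish. -/
theorem mlieBracket_prodField {v : ∀ q : N, TangentSpace 𝓘(ℝ, FN) q}
    {w : ∀ g : G, TangentSpace 𝓘(ℝ, FG) g} {q : N} {g : G}
    (hv : MDifferentiableAt 𝓘(ℝ, FN) 𝓘(ℝ, FN).tangent
      (fun q => (⟨q, v q⟩ : TangentBundle 𝓘(ℝ, FN) N)) q)
    (hw : MDifferentiableAt 𝓘(ℝ, FG) 𝓘(ℝ, FG).tangent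
      (fun g => (⟨g, w g⟩ : TangentBundle 𝓘(ℝ, FG) G)) g) :
    (VectorField.mlieBracket (𝓘(ℝ, FN).prod 𝓘(ℝ, FG)) (fun x : N × G => ((v x.1, 0) : FN × FG))
      (fun x : N × G => ((0, w x.2) : FN × FG)) (q, g) : FN × FG) = 0 := by
  have z1 : MDifferentiableAt 𝓘(ℝ, FN) 𝓘(ℝ, FN).tangent
      (fun q => (⟨q, 0⟩ : TangentBundle 𝓘(ℝ, FN) N)) q :=
    (Bundle.contMDiff_zeroSection (n := 1) ℝ _).contMDiffAt.mdifferentiableAt (by simp)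
  have z2 : MDifferentiableAt 𝓘(ℝ, FG) 𝓘(ℝ, FG).tangent
      (fun q => (⟨q, 0⟩ : TangentBundle 𝓘(ℝ, FG) G)) g :=
    (Bundle.contMDiff_zeroSection (n := 1) ℝ _).contMDiffAt.mdifferentiableAt (by simp)
  have a := mdifferentiableAt_prodField hv z2
  have b := mdifferentiableAt_prodField z1 hw
  have h1 := mlieBracket_related (I := 𝓘(ℝ, FN).prod 𝓘(ℝ, FG)) (I₂ := 𝓘(ℝ, FN)) (p := (q, g))
    (f := Prod.fst) contMDiffAt_fst a b hv z1
    (Eventually.of_forall fun x => by rw [mfderiv_fst]; rfl)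
    (Eventually.of_forall fun x => by rw [mfderiv_fst]; rfl)
  have h2 := mlieBracket_related (I := 𝓘(ℝ, FN).prod 𝓘(ℝ, FG)) (I₂ := 𝓘(ℝ, FG)) (p := (q, g))
    (f := Prod.snd) contMDiffAt_snd a b z2 hw
    (Eventually.of_forall fun x => by rw [mfderiv_snd]; rfl)
    (Eventually.of_forall fun x => by rw [mfderiv_snd]; rfl)
  rw [mfderiv_fst] at h1
  rw [mfderiv_snd] at h2
  have e1 : VectorField.mlieBracket 𝓘(ℝ, FN) v (fun q : N => 0) q = 0 :=
    congrFun VectorField.mlieBracket_zero_right q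
  have e2 : VectorField.mlieBracket 𝓘(ℝ, FG) (fun q : G => 0) w g = 0 :=
    congrFun VectorField.mlieBracket_zero_left g
  exact Prod.ext (h1.trans e1) (h2.trans e2)

/-- The action map `N × G → N` relates the lift on the first factor to the lift, by invariance of
`H`, and the left-invariant field on the second factor to the fundamental field. On the product
these two fields commute. -/
theorem mlieBracket_horField_fundamentalField (hπ : IsPrincipalBundle FM FN FG G π)
    (hH : IsFlatConnection FM FN FG G π H) {s : ∀ p : M, TangentSpace 𝓘(ℝ, FM) p} {q : N}
    (hs : ∀ p, VecSmoothAt FM s p) (v : GroupLieAlgebra 𝓘(ℝ, FG) G) :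
    VectorField.mlieBracket 𝓘(ℝ, FN) (horField π H s) (fundamentalField FN FG v) q = 0 := by
  have ha : ∀ r, MDifferentiableAt 𝓘(ℝ, FN) 𝓘(ℝ, FN).tangent
      (fun q => (⟨q, horField π H s q⟩ : TangentBundle 𝓘(ℝ, FN) N)) r := fun r =>
    (vecSmoothAt_horField hπ hH (hs (π r))).mdifferentiableAt
  have z1 : MDifferentiableAt 𝓘(ℝ, FN) 𝓘(ℝ, FN).tangent
      (fun q => (⟨q, 0⟩ : TangentBundle 𝓘(ℝ, FN) N)) q :=
    (Bundle.contMDiff_zeroSection (n := 1) ℝ _).contMDiffAt.mdifferentiableAt (by simp)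
  have z2 : MDifferentiableAt 𝓘(ℝ, FG) 𝓘(ℝ, FG).tangent
      (fun q => (⟨q, 0⟩ : TangentBundle 𝓘(ℝ, FG) G)) 1 :=
    (Bundle.contMDiff_zeroSection (n := 1) ℝ _).contMDiffAt.mdifferentiableAt (by simp)
  have h1 := mlieBracket_related (I := 𝓘(ℝ, FN).prod 𝓘(ℝ, FG)) (I₂ := 𝓘(ℝ, FN)) (p := (q, (1 : G)))
    (f := actionMap N G) (hπ.smooth_action.contMDiffAt.of_le ENat.LEInfty.out)
    (mdifferentiableAt_prodField (ha q) z2)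
    (mdifferentiableAt_prodField z1 (mdifferentiableAt_invariantField v 1))
    (ha _) (hπ.vecSmoothAt_fundamentalField v _).mdifferentiableAt
    (Eventually.of_forall fun x => (mfderiv_actionMap_left hπ x.1 x.2 _).trans
      (mfderiv_translate_horField hπ hH s x.2 x.1))
    (Eventually.of_forall fun x => (mfderiv_actionMap_right hπ x.1 x.2 _).trans
      (mfderiv_orbit_invariantField hπ v x.1 x.2))
  have h2 : ∀ r (_ : r = q), tangentCoord 𝓘(ℝ, FN) (VectorField.mlieBracket 𝓘(ℝ, FN)
      (horField π H s) (fundamentalField FN FG v) r) =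
      tangentCoord 𝓘(ℝ, FN) (VectorField.mlieBracket 𝓘(ℝ, FN)
      (horField π H s) (fundamentalField FN FG v) q) := by
    rintro _ rfl; rfl
  refine (h2 _ (show MulOpposite.op (1 : G) • q = q by simp)).symm.trans (h1.symm.trans ?_)
  have h3 := mlieBracket_prodField (ha q) (mdifferentiableAt_invariantField v (1 : G))
  exact (congrArg (mfderiv (𝓘(ℝ, FN).prod 𝓘(ℝ, FG)) 𝓘(ℝ, FN) (actionMap N G) (q, 1) :
    FN × FG →L[ℝ] FN) h3).trans (map_zero _)

end Brackets

/-! ### Dorfman brackets of lifted sections and of the vertical framing -/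

section Lift

variable {FM FN FG : Type*} [NormedAddCommGroup FM] [NormedSpace ℝ FM] [FiniteDimensional ℝ FM]
  [NormedAddCommGroup FN] [NormedSpace ℝ FN] [FiniteDimensional ℝ FN]
  [NormedAddCommGroup FG] [NormedSpace ℝ FG] [FiniteDimensional ℝ FG]
  {M : Type*} [TopologicalSpace M] [ChartedSpace FM M] [IsManifold 𝓘(ℝ, FM) ∞ M]
  {N : Type*} [TopologicalSpace N] [ChartedSpace FN N] [IsManifold 𝓘(ℝ, FN) ∞ N]
  {G : Type*} [TopologicalSpace G] [ChartedSpace FG G] [Group G] [LieGroup 𝓘(ℝ, FG) ∞ G]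
  [MulAction Gᵐᵒᵖ N] {π : N → M} {H : Distribution FN N}
  (hπ : IsPrincipalBundle FM FN FG G π) (hH : IsFlatConnection FM FN FG G π H)

theorem pullSec_fst (s : GSec FM M) :
    (fun q => (pullSec FM FN π H s q).1) = horField π H fun p => (s p).1 := rfl

theorem pullSec_snd_apply (s : GSec FM M) (q : N) (w : TangentSpace 𝓘(ℝ, FN) q) :
    (pullSec FM FN π H s q).2 w = (s (π q)).2 (mfderiv 𝓘(ℝ, FN) 𝓘(ℝ, FM) π q w) := rfl

include hπ

theorem pullSec_snd_fundamentalField (s : GSec FM M) (q : N) (v : GroupLieAlgebra 𝓘(ℝ, FG) G) :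
    (pullSec FM FN π H s q).2 (fundamentalField FN FG v q) = 0 := by
  rw [pullSec_snd_apply, hπ.mfderiv_fundamentalField]
  exact map_zero _

include hH

theorem pullSec_snd_horField (s : GSec FM M) (t : ∀ p : M, TangentSpace 𝓘(ℝ, FM) p) (q : N) :
    (pullSec FM FN π H s q).2 (horField π H t q) = (s (π q)).2 (t (π q)) := by
  rw [pullSec_snd_apply]
  exact congrArg _ (mfderiv_horLift hπ hH q _)

theorem secSmoothAt_pullSec {s : GSec FM M} {q : N} (hs : SecSmoothAt FM s (π q)) :
    SecSmoothAt FN (pullSec FM FN π H s) q := by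
  refine ⟨vecSmoothAt_horField hπ hH hs.1, formSmoothAt_of_apply fun v hv => ?_⟩
  exact hs.2.apply_mfderiv hπ.smooth_proj.contMDiffAt hv

/-- Elements of a fibre of the generalized tangent bundle of the total space are determined by
their vector part and by the values of their covector part on lifted fields and on fundamental
fields. -/
theorem gt_ext_lift [T2Space M] {q : N} {a b : GT FN q} (h1 : a.1 = b.1)
    (h2 : ∀ t : ∀ p : M, TangentSpace 𝓘(ℝ, FM) p, (∀ p, VecSmoothAt FM t p) →
      a.2 (horField π H t q) = b.2 (horField π H t q))
    (h3 : ∀ v : GroupLieAlgebra 𝓘(ℝ, FG) G,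
      a.2 (fundamentalField FN FG v q) = b.2 (fundamentalField FN FG v q)) : a = b := by
  refine Prod.ext h1 (ContinuousLinearMap.ext fun w => ?_)
  obtain ⟨u, v, rfl⟩ := exists_eq_horLift_add hπ hH q w
  obtain ⟨t, ht, rfl⟩ := exists_vecSmooth_eq (F := FM) u
  exact (map_add _ _ _).trans
    ((congrArg₂ (· + ·) (h2 t ht) (h3 v)).trans (map_add _ _ _).symm)

theorem dirDeriv_comp_proj_horField {f : M → ℝ} {q : N} (hf : FunSmoothAt FM f (π q))
    (t : ∀ p : M, TangentSpace 𝓘(ℝ, FM) p) :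
    dirDeriv 𝓘(ℝ, FN) (fun r => f (π r)) q (horField π H t q) =
      dirDeriv 𝓘(ℝ, FM) f (π q) (t (π q)) :=
  (dirDeriv_comp hf.mdifferentiableAt (hπ.mdifferentiableAt q) _).trans
    (congrArg _ (mfderiv_horLift hπ hH q _))

omit hH in
theorem dirDeriv_comp_proj_fundamentalField {f : M → ℝ} {q : N} (hf : FunSmoothAt FM f (π q))
    (v : GroupLieAlgebra 𝓘(ℝ, FG) G) :
    dirDeriv 𝓘(ℝ, FN) (fun r => f (π r)) q (fundamentalField FN FG v q) = 0 := by
  refine (dirDeriv_comp hf.mdifferentiableAt (hπ.mdifferentiableAt q) _).trans ?_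
  rw [hπ.mfderiv_fundamentalField]
  exact map_zero _

/-- The lift of sections is compatible with the Dorfman bracket. -/
theorem dorfman_pullSec [T2Space M] {x y : GSec FM M} (hx : ∀ p, SecSmoothAt FM x p)
    (hy : ∀ p, SecSmoothAt FM y p) (q : N) :
    dorfman FN (pullSec FM FN π H x) (pullSec FM FN π H y) q =
      pullSec FM FN π H (dorfman FM x y) q := by
  have hx' := secSmoothAt_pullSec hπ hH (hx (π q))
  have hy' := secSmoothAt_pullSec hπ hH (hy (π q))
  have hb : ∀ s t : ∀ p : M, TangentSpace 𝓘(ℝ, FM) p, (∀ p, VecSmoothAt FM s p) →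
      (∀ p, VecSmoothAt FM t p) → VectorField.mlieBracket 𝓘(ℝ, FN) (horField π H s)
        (horField π H t) q = horField π H (VectorField.mlieBracket 𝓘(ℝ, FM) s t) q :=
    fun s t hs ht => horField_bracket_related hπ hH hs ht
  refine gt_ext_lift hπ hH (hb _ _ (fun p => (hx p).1) fun p => (hy p).1) (fun t ht => ?_)
    fun v => ?_
  -- On a lifted field every term is the pull-back of the corresponding term on `M`.
  · rw [dorfman_snd_apply hx' hy' (vecSmoothAt_horField hπ hH (ht _)), pullSec_snd_horField hπ hH,
      dorfman_snd_apply (hx _) (hy _) (ht _)]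
    simp only [pullSec_fst]
    rw [hb _ _ (fun p => (hx p).1) ht, hb _ _ (fun p => (hy p).1) ht,
      pullSec_snd_horField hπ hH, pullSec_snd_horField hπ hH]
    have e : ∀ (s : GSec FM M) (t : ∀ p : M, TangentSpace 𝓘(ℝ, FM) p),
        (fun r => (pullSec FM FN π H s r).2 (horField π H t r)) =
          fun r => (s (π r)).2 (t (π r)) := fun s t =>
      funext fun r => pullSec_snd_horField hπ hH s t r
    have e' : ∀ (s t : GSec FM M),
        (fun r => (pullSec FM FN π H s r).2 (pullSec FM FN π H t r).1) =
          fun r => (s (π r)).2 ((t (π r)).1) := fun s t => e s fun p => (t p).1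
    rw [e, e, e']
    have d : ∀ {f : M → ℝ}, FunSmoothAt FM f (π q) → ∀ t : ∀ p : M, TangentSpace 𝓘(ℝ, FM) p,
        dirDeriv 𝓘(ℝ, FN) (fun r => f (π r)) q (horField π H t q) =
          dirDeriv 𝓘(ℝ, FM) f (π q) (t (π q)) := fun hf t =>
      dirDeriv_comp_proj_horField hπ hH hf t
    have d1 := d ((hy (π q)).2.apply (ht _)) fun p => (x p).1
    have d2 := d ((hx (π q)).2.apply (ht _)) fun p => (y p).1
    have d3 := d ((hx (π q)).2.apply (hy _).1) t
    exact congrArg₂ (· + ·) (congrArg₂ (· + ·) (congrArg₂ (· - ·)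
      (congrArg₂ (· - ·) d1 rfl) d2) d3) rfl
  -- On a fundamental field both sides vanish: lifted forms annihilate it, lifted fields commute
  -- with it, and functions pulled back from `M` are constant along it.
  · rw [dorfman_snd_apply hx' hy' (hπ.vecSmoothAt_fundamentalField v q),
      pullSec_snd_fundamentalField hπ]
    simp only [pullSec_fst, pullSec_snd_fundamentalField hπ]
    rw [mlieBracket_horField_fundamentalField hπ hH (fun p => (hx p).1),
      mlieBracket_horField_fundamentalField hπ hH (fun p => (hy p).1)]
    have e' : (fun r => (pullSec FM FN π H x r).2 (pullSec FM FN π H y r).1) =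
          fun r => (x (π r)).2 ((y (π r)).1) := 
      funext fun r => pullSec_snd_horField hπ hH x (fun p => (y p).1) r
    rw [e', dirDeriv_comp_proj_fundamentalField hπ (f := fun p => (x p).2 (y p).1)
      ((hx (π q)).2.apply (hy _).1), dirDeriv_const, dirDeriv_const]
    simp

/-- Every smooth field near a point is a combination of horizontal fields and fundamental fields,
with smooth coefficients. -/
theorem exists_adapted_coeffs {z : ∀ q : N, TangentSpace 𝓘(ℝ, FN) q} {q₀ : N}
    (hz : VecSmoothAt FN z q₀) :
    ∃ (k : ℕ) (b : Fin k → GroupLieAlgebra 𝓘(ℝ, FG) G) (d : Fin k → N → ℝ),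
      (∀ a, FunSmoothAt FN (d a) q₀) ∧
      ∀ᶠ q in 𝓝 q₀, z q - ∑ a, d a q • fundamentalField FN FG (b a) q ∈ H q := by
  obtain ⟨r, e, hr, he, hspan, heH, hinj⟩ := exists_horizontal_frame hπ hH q₀
  let b : Module.Basis (Fin (Module.finrank ℝ FG)) ℝ FG := Module.finBasis ℝ FG
  let E : Fin r ⊕ Fin (Module.finrank ℝ FG) → ∀ q : N, TangentSpace 𝓘(ℝ, FN) q :=
    Sum.elim e fun a => fundamentalField FN FG (G := G) (b a)
  have hf : ∀ (d : Fin (Module.finrank ℝ FG) → ℝ) (q : N),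
      ∑ a, d a • fundamentalField FN FG (G := G) (b a) q =
        fundamentalField FN FG (G := G) (∑ a, d a • b a : FG) q := by
    intro d q
    have h0 (L : FG →L[ℝ] FN) : ∑ a, d a • L (b a) = L (∑ a, d a • b a) := by simp
    exact h0 _
  have hsum : ∀ (c : Fin r ⊕ Fin (Module.finrank ℝ FG) → ℝ) (q : N), ∑ i, c i • E i q =
      ∑ i, c (Sum.inl i) • e i q + fundamentalField FN FG (G := G)
        (∑ a, c (Sum.inr a) • b a : FG) q := by
    intro c q
    rw [← hf]
    exact Fintype.sum_sum_type _
  have hinj' : ∀ c : Fin r ⊕ Fin (Module.finrank ℝ FG) → ℝ, ∑ i, c i • E i q₀ = 0 → c = 0 := by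
    intro c hc
    rw [hsum] at hc
    have h1 := congrArg (mfderiv 𝓘(ℝ, FN) 𝓘(ℝ, FM) π q₀) hc
    have h1' := hπ.mfderiv_fundamentalField
      ((∑ a, c (Sum.inr a) • b a : FG) : GroupLieAlgebra 𝓘(ℝ, FG) G) q₀
    have h0 (L : FN →L[ℝ] FM) (x y : FN) (h : L (x + y) = L 0) (hy : L y = 0) : L x = 0 := by
      rwa [map_add, hy, add_zero, map_zero] at h
    have h2 := hinj _ (h0 _ _ _ h1 h1')
    have h3 : ∀ i, c (Sum.inl i) = 0 := fun i => congrFun h2 i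
    simp only [h3, zero_smul, Finset.sum_const_zero, zero_add] at hc
    have h4 := hπ.fundamentalField_eq_zero hc
    have h5 := Fintype.linearIndependent_iff.1 b.linearIndependent _ h4
    exact funext fun i => i.rec h3 h5
  have hspan' : ∀ᶠ q in 𝓝 q₀, ∀ w : TangentSpace 𝓘(ℝ, FN) q,
      ∃ c : Fin r ⊕ Fin (Module.finrank ℝ FG) → ℝ, w = ∑ i, c i • E i q := by
    filter_upwards [hspan] with q hq w
    obtain ⟨u, v, rfl⟩ := exists_eq_horLift_add hπ hH q w
    obtain ⟨c, hc⟩ := hq _ (horLift_mem q u)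
    refine ⟨Sum.elim c (b.repr (v : FG)), ?_⟩
    rw [hsum, hc]
    exact congrArg (fun v => _ + fundamentalField FN FG v q) (b.sum_repr v).symm
  have hcard : Fintype.card (Fin r ⊕ Fin (Module.finrank ℝ FG)) = Module.finrank ℝ FN := by
    have h0 (x : Fin r ⊕ Fin (Module.finrank ℝ FG) → FN)
        (h1 : ∀ c : Fin r ⊕ Fin (Module.finrank ℝ FG) → ℝ, ∑ i, c i • x i = 0 → c = 0)
        (h2 : ∀ w, ∃ c : _ → ℝ, w = ∑ i, c i • x i) :
        Fintype.card (Fin r ⊕ Fin (Module.finrank ℝ FG)) = Module.finrank ℝ FN := by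
      have hb : Function.Bijective (Fintype.linearCombination ℝ x) :=
        ⟨(injective_iff_map_eq_zero _).2 fun c hc => h1 c hc,
          fun w => (h2 w).imp fun c hc => hc.symm⟩
      rw [← (LinearEquiv.ofBijective _ hb).finrank_eq, Module.finrank_fintype_fun_eq_card]
    exact h0 (fun i => E i q₀) hinj' hspan'.self_of_nhds
  have hE : ∀ i, VecSmoothAt FN (E i) q₀ := by
    rintro (i | a)
    · exact he i
    · exact hπ.vecSmoothAt_fundamentalField _ _
  obtain ⟨c, hc, hzc⟩ := exists_smooth_coeffs (f := (id : N → N)) contMDiffAt_id E hE hcard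
    (fun c hc => hinj' c (by rw [mfderiv_id] at hc; exact hc)) z (hspan'.mono fun q hq => hq _)
    (fun ξ hξ => FunSmoothAt.dirDeriv (f := ξ) hξ hz)
  refine ⟨_, fun a => b a, fun a => c (Sum.inr a), fun a => hc _, ?_⟩
  filter_upwards [hzc, heH] with q hq hq'
  rw [hq, hsum, hf, add_sub_cancel_right]
  exact Submodule.sum_mem _ fun i _ => Submodule.smul_mem _ _ (hq' i)

/-- A section of the vertical framing is smooth. -/
theorem secSmoothAt_of_mem_verticalFraming {s : GSec FN N} (hs : s ∈ verticalFraming FN FG G H)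
    (q₀ : N) : SecSmoothAt FN s q₀ := by
  obtain ⟨v, l, h⟩ := hs
  refine ⟨(hπ.vecSmoothAt_fundamentalField v q₀).congr (Eventually.of_forall fun q => (h q).1),
    formSmoothAt_of_apply fun z hz => ?_⟩
  -- The form annihilates the horizontal part of `z` and takes the constant values `l (b a)` on the
  -- fundamental fields.
  obtain ⟨k, b, d, hd, hzd⟩ := exists_adapted_coeffs hπ hH hz
  have h1 : FunSmoothAt FN (fun q => ∑ a, d a q * l (b a)) q₀ :=
    FunSmoothAt.sum fun a _ => (hd a).mul contMDiffAt_const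
  refine h1.congr_of_eventuallyEq ?_
  filter_upwards [hzd] with q hq
  have h2 := (h q).2.1 _ hq
  rw [map_sub, sub_eq_zero] at h2
  rw [h2, map_sum]
  exact Finset.sum_congr rfl fun a _ => (map_smul _ _ _).trans (congrArg _ ((h q).2.2 _))

omit hH in
theorem mem_vertical_of_mem_verticalFraming {s : GSec FN N} (hs : s ∈ verticalFraming FN FG G H)
    (q : N) : s q ∈ vertical FM FN π H q := by
  obtain ⟨v, l, h⟩ := hs
  exact ⟨by rw [(h q).1]; exact hπ.mfderiv_fundamentalField v q, (h q).2.1⟩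

/-- The vertical framing commutes with lifted sections. -/
theorem dorfman_pullSec_verticalFraming [T2Space M] {x : GSec FM M}
    (hx : ∀ p, SecSmoothAt FM x p) {c : GSec FN N} (hc : c ∈ verticalFraming FN FG G H) (q : N) :
    dorfman FN (pullSec FM FN π H x) c q = 0 := by
  have hx' := secSmoothAt_pullSec hπ hH (hx (π q))
  have hc' := secSmoothAt_of_mem_verticalFraming hπ hH hc q
  obtain ⟨v, l, h⟩ := hc
  have h1 : (fun r => (c r).1) = fundamentalField FN FG v := funext fun r => (h r).1
  have h2 : ∀ t r, (c r).2 (horField (FM := FM) π H t r) = 0 := fun t r => (h r).2.1 _ (horLift_mem r _)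
  have h3 := fun r => (h r).2.2
  have hb : ∀ s : ∀ p : M, TangentSpace 𝓘(ℝ, FM) p, (∀ p, VecSmoothAt FM s p) →
      ∀ w : GroupLieAlgebra 𝓘(ℝ, FG) G,
      VectorField.mlieBracket 𝓘(ℝ, FN) (fundamentalField FN FG w) (horField π H s) q = 0 := by
    intro s hs w
    rw [VectorField.mlieBracket_swap_apply, mlieBracket_horField_fundamentalField hπ hH hs]
    exact neg_zero
  have e1 : (fun r => (pullSec FM FN π H x r).2 (c r).1) = fun _ => 0 := funext fun r => by
    rw [(h r).1, pullSec_snd_fundamentalField hπ]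
  refine gt_ext_lift hπ hH ?_ (fun t ht => ?_) fun w => ?_
  · show VectorField.mlieBracket 𝓘(ℝ, FN) _ (fun r => (c r).1) q = 0
    rw [h1, pullSec_fst]
    exact mlieBracket_horField_fundamentalField hπ hH (fun p => (hx p).1) v
  · rw [dorfman_snd_apply hx' hc' (vecSmoothAt_horField hπ hH (ht _))]
    simp only [h2, e1]
    have e : (fun r => (pullSec FM FN π H x r).2 (horField π H t r)) =
        fun r => (x (π r)).2 (t (π r)) := funext fun r => pullSec_snd_horField hπ hH x t r
    rw [e, (h q).1, dirDeriv_comp_proj_fundamentalField hπ (f := fun p => (x p).2 (t p))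
      ((hx (π q)).2.apply (ht _)), h1, hb t ht, pullSec_fst,
      horField_bracket_related hπ hH (fun p => (hx p).1) ht, h2, dirDeriv_const, dirDeriv_const]
    simp
  -- The vertical form has constant values on fundamental fields, and the lifted form annihilates
  -- the bracket of two fundamental fields, which is again fundamental.
  · rw [dorfman_snd_apply hx' hc' (hπ.vecSmoothAt_fundamentalField w q)]
    simp only [h3, e1, pullSec_snd_fundamentalField hπ]
    rw [h1, mlieBracket_fundamentalField hπ, pullSec_fst,
      mlieBracket_horField_fundamentalField hπ hH (fun p => (hx p).1),
      pullSec_snd_fundamentalField hπ, dirDeriv_const, dirDeriv_const, dirDeriv_const]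
    simp

theorem pairing_pullSec_vertical {q : N} (x : GT FM (π q)) {c : GT FN q}
    (hc : c ∈ vertical FM FN π H q) : pairing FN q (liftAt FM FN π H q x) c = 0 := by
  have h1 : x.2 (mfderiv 𝓘(ℝ, FN) 𝓘(ℝ, FM) π q c.1) = 0 := by
    rw [hc.1]; exact map_zero _
  have h2 : c.2 (horLift FM FN π H q x.1) = 0 := hc.2 _ (horLift_mem q _)
  show (1 / 2 : ℝ) * (x.2 (mfderiv 𝓘(ℝ, FN) 𝓘(ℝ, FM) π q c.1) +
    c.2 (horLift FM FN π H q x.1)) = 0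
  rw [h1, h2]; simp

/-- Lifts are orthogonal to vertical sections, so exchanging the arguments only changes the sign. -/
theorem dorfman_verticalFraming_pullSec [T2Space M] {x : GSec FM M}
    (hx : ∀ p, SecSmoothAt FM x p) {c : GSec FN N} (hc : c ∈ verticalFraming FN FG G H) (q : N) :
    dorfman FN c (pullSec FM FN π H x) q = 0 := by
  have h := dorfman_add_swap (secSmoothAt_pullSec hπ hH (hx (π q)))
    (secSmoothAt_of_mem_verticalFraming hπ hH hc q)
  rw [dorfman_pullSec_verticalFraming hπ hH hx hc, zero_add] at h
  rw [h]
  have : (fun q => pairing FN q (pullSec FM FN π H x q) (c q)) = fun _ => 0 := funext fun r =>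
    pairing_pullSec_vertical hπ hH _ (mem_vertical_of_mem_verticalFraming hπ hc r)
  rw [this]
  refine Prod.ext rfl (ContinuousLinearMap.ext fun w => ?_)
  show (2 : ℝ) * dirDeriv 𝓘(ℝ, FN) (fun _ : N => (0 : ℝ)) q w = 0
  rw [dirDeriv_const, mul_zero]

/-- The vertical framing is closed under the Dorfman bracket. -/
theorem dorfman_mem_verticalFraming [T2Space M] {c c' : GSec FN N}
    (hc : c ∈ verticalFraming FN FG G H) (hc' : c' ∈ verticalFraming FN FG G H) :
    dorfman FN c c' ∈ verticalFraming FN FG G H := by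
  have hs := secSmoothAt_of_mem_verticalFraming hπ hH hc
  have hs' := secSmoothAt_of_mem_verticalFraming hπ hH hc'
  obtain ⟨v, l, h⟩ := hc
  obtain ⟨v', l', h'⟩ := hc'
  have h1 : (fun r => (c r).1) = fundamentalField FN FG v := funext fun r => (h r).1
  have h1' : (fun r => (c' r).1) = fundamentalField FN FG v' := funext fun r => (h' r).1
  have h2 : ∀ t r, (c r).2 (horField (FM := FM) π H t r) = 0 := fun t r => (h r).2.1 _ (horLift_mem r _)
  have h2' : ∀ t r, (c' r).2 (horField (FM := FM) π H t r) = 0 := fun t r => (h' r).2.1 _ (horLift_mem r _)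
  have h3 := fun r => (h r).2.2
  have h3' := fun r => (h' r).2.2
  have e1 : (fun r => (c r).2 (c' r).1) = fun _ => l v' := funext fun r => by
    rw [(h' r).1, h3]
  have hb : ∀ s : ∀ p : M, TangentSpace 𝓘(ℝ, FM) p, (∀ p, VecSmoothAt FM s p) →
      ∀ (w : GroupLieAlgebra 𝓘(ℝ, FG) G) q,
      VectorField.mlieBracket 𝓘(ℝ, FN) (fundamentalField FN FG w) (horField π H s) q = 0 := by
    intro s hs w q
    rw [VectorField.mlieBracket_swap_apply, mlieBracket_horField_fundamentalField hπ hH hs]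
    exact neg_zero
  have k1 : ∀ q, (dorfman FN c c' q).1 =
      fundamentalField FN FG (⁅v, v'⁆ : GroupLieAlgebra 𝓘(ℝ, FG) G) q := by
    intro q
    show VectorField.mlieBracket 𝓘(ℝ, FN) (fun r => (c r).1) (fun r => (c' r).1) q = _
    rw [h1, h1']
    exact mlieBracket_fundamentalField hπ v v' q
  have k2 : ∀ q, ∀ w ∈ H q, (dorfman FN c c' q).2 w = 0 := by
    intro q w hw
    obtain ⟨t, ht, htq⟩ := exists_vecSmooth_eq (F := FM) (mfderiv 𝓘(ℝ, FN) 𝓘(ℝ, FM) π q w)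
    have hw' : horField π H t q = w := eq_horLift hπ hH hw htq.symm
    rw [← hw', dorfman_snd_apply (hs q) (hs' q) (vecSmoothAt_horField hπ hH (ht _))]
    simp only [h2, h2', e1, h1, h1']
    rw [hb t ht, hb t ht, dirDeriv_const, dirDeriv_const, dirDeriv_const]
    simp
  -- The right-hand side is independent of `q`: only structure constants of the Lie algebra appear.
  have k3 : ∀ q, ∀ w : GroupLieAlgebra 𝓘(ℝ, FG) G,
      (dorfman FN c c' q).2 (fundamentalField FN FG w q) =
        l (⁅v', w⁆ : GroupLieAlgebra 𝓘(ℝ, FG) G) - l' (⁅v, w⁆ : GroupLieAlgebra 𝓘(ℝ, FG) G) := by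
    intro q w
    rw [dorfman_snd_apply (hs q) (hs' q) (hπ.vecSmoothAt_fundamentalField w q)]
    simp only [h3, h3', e1, h1, h1']
    rw [mlieBracket_fundamentalField hπ, mlieBracket_fundamentalField hπ, h3, h3',
      dirDeriv_const, dirDeriv_const, dirDeriv_const]
    ring
  rcases isEmpty_or_nonempty N with hN | ⟨⟨q₀⟩⟩
  · exact ⟨0, 0, fun q => (hN.false q).elim⟩
  -- The required linear form is read off at one point `q₀`, where it is continuous by construction;
  -- by `k3` any other point gives the same values.
  · refine ⟨(⁅v, v'⁆ : GroupLieAlgebra 𝓘(ℝ, FG) G),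
      (((dorfman FN c c' q₀).2 : FN →L[ℝ] ℝ).comp (mfderiv 𝓘(ℝ, FG) 𝓘(ℝ, FN)
        (fun g : G => MulOpposite.op g • q₀) 1 : FG →L[ℝ] FN) : FG →L[ℝ] ℝ),
      fun q => ⟨k1 q, k2 q, fun w => ?_⟩⟩
    exact (k3 q w).trans (k3 q₀ w).symm

end Lift

/-! ### Neutral signature and definite subspaces -/

section LinearAlgebra

variable {W : Type*} [AddCommGroup W] [Module ℝ W] [FiniteDimensional ℝ W]
  {B : LinearMap.BilinForm ℝ W} {A : Submodule ℝ W} {k : ℕ}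

/-- Definite subspaces of dimension `k` bound both indices of inertia below by `k`; as the indices
and the dimension of the radical add up to `2 * k`, both bounds are attained. Definite subspaces are
easier to add and to transport than indices. -/
theorem hasSignature_iff (hA : Module.finrank ℝ A = 2 * k) :
    HasSignature (QuadraticMap.restrict B.toQuadraticMap A) k k ↔
      (∃ P ≤ A, Module.finrank ℝ P = k ∧ ∀ x ∈ P, x ≠ 0 → 0 < B x x) ∧
        ∃ P ≤ A, Module.finrank ℝ P = k ∧ ∀ x ∈ P, x ≠ 0 → B x x < 0 := by
  have e : ∀ P : Submodule ℝ A, Module.finrank ℝ (P.map A.subtype) = Module.finrank ℝ P :=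
    fun P => (Submodule.equivMapOfInjective _ A.subtype_injective P).finrank_eq.symm
  constructor
  · rintro ⟨h1, h2⟩
    obtain ⟨P, hP, hP'⟩ := exists_finrank_eq_sigPos_and_posDef
      (QuadraticMap.restrict B.toQuadraticMap A)
    obtain ⟨P₁, hP₁, hP₁'⟩ := exists_finrank_eq_sigNeg_and_negDef
      (QuadraticMap.restrict B.toQuadraticMap A)
    refine ⟨⟨P.map A.subtype, Submodule.map_subtype_le A P, by rw [e, hP, h1], ?_⟩,
      P₁.map A.subtype, Submodule.map_subtype_le A P₁, by rw [e, hP₁, h2], ?_⟩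
    · rintro _ ⟨x, hx, rfl⟩ hx0
      exact hP' ⟨x, hx⟩ fun h => hx0 (congrArg (fun z => A.subtype (Subtype.val z)) h)
    · rintro _ ⟨x, hx, rfl⟩ hx0
      have := hP₁' ⟨x, hx⟩ fun h => hx0 (congrArg (fun z => A.subtype (Subtype.val z)) h)
      exact neg_pos.1 this
  · rintro ⟨⟨P, hPA, hP, hP'⟩, P₁, hPA₁, hP₁, hP₁'⟩
    have h := QuadraticForm.sigPos_add_sigNeg_add_radical
      (Q := QuadraticMap.restrict B.toQuadraticMap A)
    have h1 : k ≤ sigPos (QuadraticMap.restrict B.toQuadraticMap A) := by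
      rw [← hP, ← (Submodule.comapSubtypeEquivOfLe hPA).finrank_eq]
      refine le_sigPos_of_posDef _ fun x hx => hP' _ x.2 fun h => hx ?_
      exact Subtype.ext (Subtype.ext h)
    have h2 : k ≤ sigNeg (QuadraticMap.restrict B.toQuadraticMap A) := by
      rw [← hP₁, ← (Submodule.comapSubtypeEquivOfLe hPA₁).finrank_eq]
      refine le_sigNeg_of_negDef _ fun x hx => neg_pos.2 (hP₁' _ x.2 fun h => hx ?_)
      exact Subtype.ext (Subtype.ext h)
    rw [HasSignature]
    omega

theorem eq_zero_of_hasSignature (hA : Module.finrank ℝ A = 2 * k)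
    (h : HasSignature (QuadraticMap.restrict B.toQuadraticMap A) k k) (hB : ∀ x y, B x y = B y x)
    {x : W} (hx : x ∈ A) (hx' : ∀ y ∈ A, B x y = 0) : x = 0 := by
  have h1 := QuadraticForm.sigPos_add_sigNeg_add_radical
    (Q := QuadraticMap.restrict B.toQuadraticMap A)
  rw [h.1, h.2, hA] at h1
  have h2 : (QuadraticMap.restrict B.toQuadraticMap A).radical = ⊥ :=
    Submodule.finrank_eq_zero.1 (by omega)
  have h3 : (⟨x, hx⟩ : A) ∈ (QuadraticMap.restrict B.toQuadraticMap A).radical := by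
    rw [QuadraticMap.mem_radical_iff']
    refine ⟨hx' x hx, fun y => ?_⟩
    show B (x + y) (x + y) = B y y
    rw [map_add, map_add, LinearMap.add_apply, LinearMap.add_apply, hx' x hx, hx' y y.2, hB y x, hx' y y.2]
    simp
  rw [h2] at h3
  exact congrArg Subtype.val ((Submodule.mem_bot ℝ).1 h3)

theorem finrank_sup_of_disjoint {P P' : Submodule ℝ W} (h : Disjoint P P') :
    Module.finrank ℝ ↥(P ⊔ P') = Module.finrank ℝ P + Module.finrank ℝ P' := by
  have := Submodule.finrank_sup_add_finrank_inf_eq P P'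
  rwa [h.eq_bot, finrank_bot, add_zero] at this

theorem disjoint_of_orthogonal {A' : Submodule ℝ W} (hB : ∀ x y, B x y = B y x)
    (hA : ∀ x ∈ A, (∀ y ∈ A, B x y = 0) → x = 0) (hAA' : ∀ x ∈ A, ∀ y ∈ A', B x y = 0) :
    Disjoint A A' := by
  rw [Submodule.disjoint_def]
  exact fun x hx hx' => hA x hx fun y hy => by rw [hB]; exact hAA' y hy x hx'

theorem add_self_of_orthogonal (hB : ∀ x y, B x y = B y x) {x y : W} (h : B x y = 0) :
    B (x + y) (x + y) = B x x + B y y := by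
  rw [map_add, map_add, LinearMap.add_apply, LinearMap.add_apply, hB y x, h]
  ring

/-- An orthogonal sum of positive definite subspaces is positive definite, likewise for negative
ones, and nondegeneracy of `A` makes the sum direct. -/
theorem hasSignature_sup {A' : Submodule ℝ W} {k' : ℕ} (hB : ∀ x y, B x y = B y x)
    (hA : Module.finrank ℝ A = 2 * k) (h : HasSignature (QuadraticMap.restrict B.toQuadraticMap A) k k)
    (hA' : Module.finrank ℝ A' = 2 * k')
    (h' : HasSignature (QuadraticMap.restrict B.toQuadraticMap A') k' k')
    (hAA' : ∀ x ∈ A, ∀ y ∈ A', B x y = 0) :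
    Module.finrank ℝ ↥(A ⊔ A') = 2 * (k + k') ∧
      HasSignature (QuadraticMap.restrict B.toQuadraticMap (A ⊔ A')) (k + k') (k + k') := by
  have hd : Disjoint A A' :=
    disjoint_of_orthogonal hB (fun x => eq_zero_of_hasSignature hA h hB) hAA'
  have hf : Module.finrank ℝ ↥(A ⊔ A') = 2 * (k + k') := by
    rw [finrank_sup_of_disjoint hd, hA, hA']; ring
  refine ⟨hf, (hasSignature_iff hf).2 ?_⟩
  obtain ⟨⟨P, hP1, hP2, hP3⟩, N, hN1, hN2, hN3⟩ := (hasSignature_iff hA).1 h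
  obtain ⟨⟨P', hP1', hP2', hP3'⟩, N', hN1', hN2', hN3'⟩ := (hasSignature_iff hA').1 h'
  refine ⟨⟨P ⊔ P', sup_le_sup hP1 hP1', ?_, ?_⟩, N ⊔ N', sup_le_sup hN1 hN1', ?_, ?_⟩
  · rw [finrank_sup_of_disjoint (hd.mono hP1 hP1'), hP2, hP2']
  · intro x hx hx0
    obtain ⟨a, ha, b, hb, rfl⟩ := Submodule.mem_sup.1 hx
    rw [add_self_of_orthogonal hB (hAA' a (hP1 ha) b (hP1' hb))]
    rcases eq_or_ne a 0 with rfl | ha0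
    · have := hP3' b hb (by simpa using hx0)
      simpa using this
    · rcases eq_or_ne b 0 with rfl | hb0
      · simpa using hP3 a ha ha0
      · exact add_pos (hP3 a ha ha0) (hP3' b hb hb0)
  · rw [finrank_sup_of_disjoint (hd.mono hN1 hN1'), hN2, hN2']
  · intro x hx hx0
    obtain ⟨a, ha, b, hb, rfl⟩ := Submodule.mem_sup.1 hx
    rw [add_self_of_orthogonal hB (hAA' a (hN1 ha) b (hN1' hb))]
    rcases eq_or_ne a 0 with rfl | ha0
    · have := hN3' b hb (by simpa using hx0)
      simpa using this
    · rcases eq_or_ne b 0 with rfl | hb0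
      · simpa using hN3 a ha ha0
      · exact add_neg (hN3 a ha ha0) (hN3' b hb hb0)

theorem hasSignature_map {W' : Type*} [AddCommGroup W'] [Module ℝ W'] [FiniteDimensional ℝ W']
    {B' : LinearMap.BilinForm ℝ W'} {L : W →ₗ[ℝ] W'} (hL : Function.Injective L)
    (hBL : ∀ x y, B' (L x) (L y) = B x y) (hA : Module.finrank ℝ A = 2 * k)
    (h : HasSignature (QuadraticMap.restrict B.toQuadraticMap A) k k) :
    HasSignature (QuadraticMap.restrict B'.toQuadraticMap (A.map L)) k k := by
  have e : ∀ P : Submodule ℝ W, Module.finrank ℝ (P.map L) = Module.finrank ℝ P :=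
    fun P => (Submodule.equivMapOfInjective _ hL P).finrank_eq.symm
  obtain ⟨⟨P, hP1, hP2, hP3⟩, N, hN1, hN2, hN3⟩ := (hasSignature_iff hA).1 h
  refine (hasSignature_iff ((e A).trans hA)).2 ⟨⟨P.map L, Submodule.map_mono hP1,
    (e P).trans hP2, ?_⟩, N.map L, Submodule.map_mono hN1, (e N).trans hN2, ?_⟩
  · rintro _ ⟨x, hx, rfl⟩ hx0
    rw [hBL]
    exact hP3 x hx fun h => hx0 (by rw [h, map_zero])
  · rintro _ ⟨x, hx, rfl⟩ hx0
    rw [hBL]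
    exact hN3 x hx fun h => hx0 (by rw [h, map_zero])

end LinearAlgebra

/-! ### Split structures and their orthogonal sums -/

section Fibres

variable {F : Type*} [NormedAddCommGroup F] [NormedSpace ℝ F] [FiniteDimensional ℝ F]
  {X : Type*} [TopologicalSpace X] [ChartedSpace F X] [IsManifold 𝓘(ℝ, F) ∞ X]

instance finiteDimensional_GT (p : X) : FiniteDimensional ℝ (GT F p) :=
  inferInstanceAs (FiniteDimensional ℝ (F × (F →L[ℝ] ℝ)))

theorem pairing_comm (p : X) (x y : GT F p) : pairing F p x y = pairing F p y x := by
  show (1 / 2 : ℝ) * (x.2 y.1 + y.2 x.1) = (1 / 2 : ℝ) * (y.2 x.1 + x.2 y.1)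
  ring

theorem IsSubbundle.finrank_eq {E : GFam F X} {r : ℕ} (h : IsSubbundle F E r) (p : X) :
    Module.finrank ℝ (E p) = r := by
  obtain ⟨U, -, hp, e, -, he⟩ := h p
  rw [← (he p hp).2, finrank_span_eq_card (he p hp).1, Fintype.card_fin]

/-- The inner product is nondegenerate on a split structure. -/
theorem IsSplit.eq_zero {E : GFam F X} (h : IsSplit F E) {p : X} {x : GT F p} (hx : x ∈ E p)
    (hx' : ∀ y ∈ E p, pairing F p x y = 0) : x = 0 := by
  obtain ⟨k, h1, h2⟩ := h
  exact eq_zero_of_hasSignature (h1.finrank_eq p) (h2 p) (pairing_comm p) hx hx'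

theorem Orthogonal.symm {E E' : GFam F X} (h : Orthogonal F E E') : Orthogonal F E' E :=
  fun p x hx y hy => by rw [pairing_comm]; exact h p y hy x hx

theorem IsSplit.disjoint {E E' : GFam F X} (h : IsSplit F E) (h' : Orthogonal F E E') (p : X) :
    Disjoint (E p) (E' p) :=
  disjoint_of_orthogonal (pairing_comm p) (fun _ hx => h.eq_zero hx) (h' p)

theorem IsSplit.sup {E E' : GFam F X} (h : IsSplit F E) (h' : IsSplit F E')
    (hEE' : Orthogonal F E E') : IsSplit F (E ⊔ E') := by
  have hd := h.disjoint hEE'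
  obtain ⟨k, h1, h2⟩ := h
  obtain ⟨k', h1', h2'⟩ := h'
  refine ⟨k + k', fun p => ?_, fun p => (hasSignature_sup (pairing_comm p) (h1.finrank_eq p) (h2 p)
    (h1'.finrank_eq p) (h2' p) (hEE' p)).2⟩
  obtain ⟨U, hU, hp, e, he, he'⟩ := h1 p
  obtain ⟨U', hU', hp', e', he1, he1'⟩ := h1' p
  rw [mul_add]
  refine ⟨U ∩ U', hU.inter hU', ⟨hp, hp'⟩, Fin.addCases e e', fun i => ?_, fun q hq => ?_⟩
  · refine Fin.addCases (fun i => ?_) (fun i => ?_) i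
    · simp only [Fin.addCases_left]
      exact ⟨(he i).1.mono inter_subset_left, (he i).2.mono inter_subset_left⟩
    · simp only [Fin.addCases_right]
      exact ⟨(he1 i).1.mono inter_subset_right, (he1 i).2.mono inter_subset_right⟩
  · have hf : (fun i => (Fin.addCases e e' i : GSec F X) q) ∘ finSumFinEquiv =
        Sum.elim (fun i => e i q) fun i => e' i q := by
      ext1 i
      rcases i with i | i
      · simp
      · simp
    have hs : range (fun i => (Fin.addCases e e' i : GSec F X) q) =
        range (Sum.elim (fun i => e i q) fun i => e' i q) := by
      rw [← hf, finSumFinEquiv.surjective.range_comp]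
    constructor
    · rw [← linearIndependent_equiv finSumFinEquiv, hf]
      refine LinearIndependent.sum_type (he' q hq.1).1 (he1' q hq.2).1 ?_
      rw [(he' q hq.1).2, (he1' q hq.2).2]
      exact hd q
    · rw [hs, Sum.elim_range, Submodule.span_union, (he' q hq.1).2, (he1' q hq.2).2]
      rfl

end Fibres

/-! ### Gram matrices and smooth orthogonal projection -/

section Gram

variable {F : Type*} [NormedAddCommGroup F] [NormedSpace ℝ F] [FiniteDimensional ℝ F]
  {X : Type*} [TopologicalSpace X] [ChartedSpace F X] [IsManifold 𝓘(ℝ, F) ∞ X]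
  {ι : Type*} [Fintype ι] [DecidableEq ι]

/-- The Gram matrix of a family of sections. -/
def gram (e : ι → GSec F X) (q : X) : Matrix ι ι ℝ :=
  Matrix.of fun i j => pairing F q (e i q) (e j q)

/-- The coefficients of the orthogonal projection of a section to the span of a family of
sections. -/
def gramCoeff (e : ι → GSec F X) (s : GSec F X) (i : ι) (q : X) : ℝ :=
  ((gram e q)⁻¹.mulVec fun j => pairing F q (s q) (e j q)) i

theorem funSmoothAt_gramCoeff {e : ι → GSec F X} {s : GSec F X} {q : X}
    (he : ∀ i, SecSmoothAt F (e i) q) (hs : SecSmoothAt F s q) (hdet : (gram e q).det ≠ 0) (i : ι) :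
    FunSmoothAt F (gramCoeff e s i) q :=
  FunSmoothAt.sum fun j _ => FunSmoothAt.mul
    (FunSmoothAt.matrix_inv (A := gram e) (fun i j => FunSmoothAt.pairing (he i) (he j)) hdet i j)
    (FunSmoothAt.pairing hs (he j))

/-- A kernel vector of the Gram matrix gives a combination of the `e i q` that is orthogonal to
their whole span. -/
theorem gram_det_ne_zero {e : ι → GSec F X} {q : X} (h : LinearIndependent ℝ fun i => e i q)
    (h' : ∀ x ∈ Submodule.span ℝ (range fun i => e i q),
      (∀ y ∈ Submodule.span ℝ (range fun i => e i q), pairing F q x y = 0) → x = 0) :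
    (gram e q).det ≠ 0 := by
  intro h0
  obtain ⟨c, hc0, hc⟩ := Matrix.exists_mulVec_eq_zero_iff.2 h0
  refine hc0 (funext (Fintype.linearIndependent_iff.1 h c (h' _ (Submodule.sum_mem _ fun i _ =>
    Submodule.smul_mem _ _ (Submodule.subset_span (mem_range_self i))) fun y hy => ?_)))
  induction hy using Submodule.span_induction with
  | mem y hy =>
    obtain ⟨i, rfl⟩ := hy
    have := congrFun hc i
    rw [pairing_comm, map_sum]
    simp only [map_smul, smul_eq_mul]
    refine Eq.trans ?_ this
    exact Finset.sum_congr rfl fun j _ => mul_comm _ _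
  | zero => exact map_zero _
  | add y z _ _ hy hz => rw [map_add, hy, hz, add_zero]
  | smul a y _ hy => rw [map_smul, hy, smul_zero]

theorem pairing_sub_gramCoeff {e : ι → GSec F X} {q : X} (hdet : (gram e q).det ≠ 0)
    (s : GSec F X) {y : GT F q} (hy : y ∈ Submodule.span ℝ (range fun i => e i q)) :
    pairing F q (s q - ∑ i, gramCoeff e s i q • e i q) y = 0 := by
  induction hy using Submodule.span_induction with
  | mem y hy =>
    obtain ⟨j, rfl⟩ := hy
    have h1 : (gram e q).mulVec (fun i => gramCoeff e s i q) j = pairing F q (s q) (e j q) := by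
      have : (fun i => gramCoeff e s i q) =
        (gram e q)⁻¹.mulVec fun j => pairing F q (s q) (e j q) := rfl
      rw [this, Matrix.mulVec_mulVec, Matrix.mul_nonsing_inv _ (isUnit_iff_ne_zero.2 hdet),
        Matrix.one_mulVec]
    rw [pairing_comm, map_sub, map_sum, pairing_comm q (e j q), ← h1, sub_eq_zero]
    simp only [map_smul, smul_eq_mul]
    exact Finset.sum_congr rfl fun i _ => mul_comm _ _
  | zero => exact map_zero _
  | add y z _ _ hy hz => rw [map_add, hy, hz, add_zero]
  | smul a y _ hy => rw [map_smul, hy, smul_zero]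

/-- A split structure has, near each point, a smooth frame with invertible Gram matrix. -/
theorem IsSplit.exists_frame {E : GFam F X} (h : IsSplit F E) (p : X) :
    ∃ U : Set X, IsOpen U ∧ p ∈ U ∧ ∃ (r : ℕ) (e : Fin r → GSec F X),
      (∀ i, SmoothOn F U (e i)) ∧ (∀ q ∈ U, ∀ i, e i q ∈ E q) ∧
      (∀ q ∈ U, (gram e q).det ≠ 0) ∧
      ∀ q ∈ U, Submodule.span ℝ (range fun i => e i q) = E q := by
  have hne := fun q x => h.eq_zero (p := q) (x := x)
  obtain ⟨k, h1, -⟩ := h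
  obtain ⟨U, hU, hp, e, he, he'⟩ := h1 p
  refine ⟨U, hU, hp, _, e, he, fun q hq i => ?_, fun q hq => gram_det_ne_zero (he' q hq).1 ?_,
    fun q hq => (he' q hq).2⟩
  · rw [← (he' q hq).2]
    exact Submodule.subset_span (mem_range_self i)
  · rw [(he' q hq).2]
    exact hne q

variable [T2Space X]

/-- A local section of a family of subspaces agrees, near a point, with a global one. -/
theorem exists_global_section {E : GFam F X} {U : Set X} (hU : IsOpen U) {s : GSec F X}
    (hs : s ∈ sections F U E) {p : X} (hp : p ∈ U) :
    ∃ t ∈ sections F univ E, ∀ᶠ q in 𝓝 p, t q = s q := by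
  obtain ⟨χ, hχ, hχ1, hχU⟩ := exists_bump F (hU.mem_nhds hp)
  refine ⟨fun q => χ q • s q, ⟨smoothOn_of_secSmoothAt fun q _ =>
    secSmoothAt_bump_smul ((smoothOn_iff hU).1 hs.1) hχ hχU q, fun q _ => ?_⟩, ?_⟩
  · by_cases hq : q ∈ tsupport χ
    · exact Submodule.smul_mem _ _ (hs.2 q (hχU hq))
    · simp only [image_eq_zero_of_notMem_tsupport hq, zero_smul]
      exact zero_mem _
  · filter_upwards [hχ1] with q hq
    rw [hq, one_smul]

/-- Every element of a fibre of a split structure is the value of a global section. -/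
theorem IsSplit.exists_section {E : GFam F X} (h : IsSplit F E) {p : X} {x : GT F p}
    (hx : x ∈ E p) : ∃ s ∈ sections F univ E, s p = x := by
  obtain ⟨U, hU, hp, r, e, he, heE, -, hspan⟩ := h.exists_frame p
  rw [← hspan p hp] at hx
  obtain ⟨c, hc⟩ := (Submodule.mem_span_range_iff_exists_fun ℝ).1 hx
  obtain ⟨t, ht, ht'⟩ := exists_global_section hU (E := E) (s := fun q => ∑ i, c i • e i q)
    ⟨(smoothOn_iff hU).2 fun q hq => SecSmoothAt.sum fun i _ =>
      SecSmoothAt.smul (f := fun _ => c i) contMDiffAt_const ((smoothOn_iff hU).1 (he i) q hq),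
      fun q hq => Submodule.sum_mem _ fun i _ => Submodule.smul_mem _ _ (heE q hq i)⟩ hp
  exact ⟨t, ht, ht'.self_of_nhds.trans hc⟩

end Gram

/-! ### The eigenbundle of a split generalized F-structure -/

section Eigenbundle

variable {F : Type*} [NormedAddCommGroup F] [NormedSpace ℝ F] [FiniteDimensional ℝ F]
  {X : Type*} [TopologicalSpace X] [ChartedSpace F X] [IsManifold 𝓘(ℝ, F) ∞ X]
  {E : GFam F X} {J : GEnd F X}

/-- For `y ∈ E` one has `⟨JJx, y⟩ = -⟨Jx, Jy⟩ = -⟨x, y⟩`, and the inner product is nondegenerate on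
`E`. -/
theorem IsSGF.sq (h : IsSGF F E J) {p : X} {x : GT F p} (hx : x ∈ E p) :
    J p (J p x) = -x := by
  rw [← sub_eq_zero, sub_neg_eq_add]
  refine h.split.eq_zero (add_mem (h.mapsTo p _ (h.mapsTo p _ hx)) hx) fun y hy => ?_
  rw [map_add, LinearMap.add_apply, h.skew p _ (h.mapsTo p _ hx) y hy, h.orthogonal p x hx y hy]
  ring

theorem IsSGF.eq_zero (h : IsSGF F E J) {p : X} {x : GT F p} (hx : x ∈ E p) (hx' : J p x = 0) :
    x = 0 := by
  rw [← neg_eq_zero, ← h.sq hx, hx', map_zero]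

theorem mem_eigenbundle_iff {p : X} {z : Cx (GT F p)} :
    z ∈ eigenbundle F E J p ↔ z.re ∈ E p ∧ z.im = -(J p z.re) := by
  constructor
  · rintro ⟨x, hx, rfl⟩
    exact ⟨hx, rfl⟩
  · rintro ⟨h1, h2⟩
    exact ⟨z.re, h1, Cx.ext rfl h2⟩

theorem eigenbundle_add {p : X} {z w : Cx (GT F p)} (hz : z ∈ eigenbundle F E J p)
    (hw : w ∈ eigenbundle F E J p) : z + w ∈ eigenbundle F E J p := by
  rw [mem_eigenbundle_iff] at *
  refine ⟨add_mem hz.1 hw.1, ?_⟩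
  rw [Cx.im_add, Cx.re_add, hz.2, hw.2, map_add]
  abel

theorem IsSGF.eigenbundle_smul (h : IsSGF F E J) {p : X} {z : Cx (GT F p)} (c : ℂ)
    (hz : z ∈ eigenbundle F E J p) : c • z ∈ eigenbundle F E J p := by
  rw [mem_eigenbundle_iff] at *
  rw [Cx.re_smul, Cx.im_smul, hz.2]
  have hJ := h.mapsTo p _ hz.1
  refine ⟨sub_mem (Submodule.smul_mem _ _ hz.1) (Submodule.smul_mem _ _ (neg_mem hJ)), ?_⟩
  rw [map_sub, map_smul, map_smul, map_neg, h.sq hz.1]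
  module

theorem zero_mem_eigenbundle {p : X} : (0 : Cx (GT F p)) ∈ eigenbundle F E J p :=
  mem_eigenbundle_iff.2 ⟨zero_mem _, by simp⟩

/-- The fibres of the eigenbundle are complex subspaces. -/
def IsSGF.eigenSubmodule (h : IsSGF F E J) (p : X) : Submodule ℂ (Cx (GT F p)) where
  carrier := eigenbundle F E J p
  add_mem' := eigenbundle_add
  zero_mem' := zero_mem_eigenbundle
  smul_mem' c _ hz := h.eigenbundle_smul c hz

/-- The section `x - iJx` of the eigenbundle. -/
theorem IsSGF.mem_eigensections (h : IsSGF F E J) {x : GSec F X} (hx : x ∈ sections F univ E) :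
    csec x (fun p => -(J p (x p))) ∈ eigensections F E J :=
  ⟨⟨hx.1, smoothOn_of_secSmoothAt fun _ _ =>
    ((h.smooth univ isOpen_univ x hx).secSmoothAt univ_mem).neg⟩,
    fun p => ⟨x p, hx.2 p (mem_univ p), rfl⟩⟩

theorem re_mem_sections {s : CSec F X} (hs : s ∈ eigensections F E J) :
    reSec s ∈ sections F univ E :=
  ⟨hs.1.1, fun p _ => (mem_eigenbundle_iff.1 (hs.2 p)).1⟩

end Eigenbundle

/-! ### The complex Dorfman bracket: Leibniz rule and skew-symmetry -/

section ComplexBracket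

variable {F : Type*} [NormedAddCommGroup F] [NormedSpace ℝ F] [FiniteDimensional ℝ F]
  {X : Type*} [TopologicalSpace X] [ChartedSpace F X] [IsManifold 𝓘(ℝ, F) ∞ X]

theorem Cx.re_sum {W ι : Type*} [AddCommGroup W] (A : Finset ι) (z : ι → Cx W) :
    (∑ i ∈ A, z i).re = ∑ i ∈ A, (z i).re :=
  map_sum (⟨⟨Cx.re, rfl⟩, fun _ _ => rfl⟩ : Cx W →+ W) z A

theorem Cx.im_sum {W ι : Type*} [AddCommGroup W] (A : Finset ι) (z : ι → Cx W) :
    (∑ i ∈ A, z i).im = ∑ i ∈ A, (z i).im :=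
  map_sum (⟨⟨Cx.im, rfl⟩, fun _ _ => rfl⟩ : Cx W →+ W) z A

@[simp] theorem Cx.re_neg {W : Type*} [AddCommGroup W] (z : Cx W) : (-z).re = -z.re := rfl
@[simp] theorem Cx.im_neg {W : Type*} [AddCommGroup W] (z : Cx W) : (-z).im = -z.im := rfl
@[simp] theorem Cx.re_sub {W : Type*} [AddCommGroup W] (z w : Cx W) : (z - w).re = z.re - w.re := by
  rw [sub_eq_add_neg, Cx.re_add, Cx.re_neg, sub_eq_add_neg]
@[simp] theorem Cx.im_sub {W : Type*} [AddCommGroup W] (z w : Cx W) : (z - w).im = z.im - w.im := by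
  rw [sub_eq_add_neg, Cx.im_add, Cx.im_neg, sub_eq_add_neg]

/-- Smoothness of a complex section at a point. -/
def CSmoothAt (s : CSec F X) (p : X) : Prop :=
  SecSmoothAt F (reSec s) p ∧ SecSmoothAt F (imSec s) p

theorem CSmooth.cSmoothAt {s : CSec F X} (hs : CSmooth F s) (p : X) : CSmoothAt s p :=
  ⟨hs.1.secSmoothAt univ_mem, hs.2.secSmoothAt univ_mem⟩

theorem re_cdorfman (s t : CSec F X) (p : X) : (cdorfman F s t p).re =
    dorfman F (reSec s) (reSec t) p - dorfman F (imSec s) (imSec t) p := rfl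

theorem im_cdorfman (s t : CSec F X) (p : X) : (cdorfman F s t p).im =
    dorfman F (reSec s) (imSec t) p + dorfman F (imSec s) (reSec t) p := rfl

theorem cdorfman_congr {s s' t t' : CSec F X} {p : X} (hs : ∀ᶠ q in 𝓝 p, s q = s' q)
    (ht : ∀ᶠ q in 𝓝 p, t q = t' q) : cdorfman F s t p = cdorfman F s' t' p := by
  have h1 : ∀ᶠ q in 𝓝 p, reSec s q = reSec s' q := hs.mono fun q hq => congrArg Cx.re hq
  have h2 : ∀ᶠ q in 𝓝 p, imSec s q = imSec s' q := hs.mono fun q hq => congrArg Cx.im hq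
  have h3 : ∀ᶠ q in 𝓝 p, reSec t q = reSec t' q := ht.mono fun q hq => congrArg Cx.re hq
  have h4 : ∀ᶠ q in 𝓝 p, imSec t q = imSec t' q := ht.mono fun q hq => congrArg Cx.im hq
  refine Cx.ext ?_ ?_
  · rw [re_cdorfman, re_cdorfman, dorfman_congr h1 h3, dorfman_congr h2 h4]
  · rw [im_cdorfman, im_cdorfman, dorfman_congr h1 h4, dorfman_congr h2 h3]

theorem CSmoothAt.add {s t : CSec F X} {p : X} (hs : CSmoothAt s p) (ht : CSmoothAt t p) :
    CSmoothAt (s + t) p := ⟨hs.1.add ht.1, hs.2.add ht.2⟩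

theorem CSmoothAt.smul {g : X → ℂ} {t : CSec F X} {p : X}
    (hr : FunSmoothAt F (fun q => (g q).re) p) (hi : FunSmoothAt F (fun q => (g q).im) p)
    (ht : CSmoothAt t p) : CSmoothAt (fun q => g q • t q) p :=
  ⟨(ht.1.smul hr).sub (ht.2.smul hi), (ht.2.smul hr).add (ht.1.smul hi)⟩

theorem cdorfman_add_right {s t t' : CSec F X} {p : X} (hs : CSmoothAt s p) (ht : CSmoothAt t p)
    (ht' : CSmoothAt t' p) : cdorfman F s (t + t') p = cdorfman F s t p + cdorfman F s t' p := by
  have e1 : reSec (t + t') = reSec t + reSec t' := rfl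
  have e2 : imSec (t + t') = imSec t + imSec t' := rfl
  refine Cx.ext ?_ ?_
  · rw [Cx.re_add, re_cdorfman, re_cdorfman, re_cdorfman, e1, e2,
      dorfman_add_right hs.1 ht.1 ht'.1, dorfman_add_right hs.2 ht.2 ht'.2]
    abel
  · rw [Cx.im_add, im_cdorfman, im_cdorfman, im_cdorfman, e1, e2,
      dorfman_add_right hs.1 ht.2 ht'.2, dorfman_add_right hs.2 ht.1 ht'.1]
    abel

theorem cdorfman_add_left {s s' t : CSec F X} {p : X} (hs : CSmoothAt s p) (hs' : CSmoothAt s' p)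
    (ht : CSmoothAt t p) : cdorfman F (s + s') t p = cdorfman F s t p + cdorfman F s' t p := by
  have e1 : reSec (s + s') = reSec s + reSec s' := rfl
  have e2 : imSec (s + s') = imSec s + imSec s' := rfl
  refine Cx.ext ?_ ?_
  · rw [Cx.re_add, re_cdorfman, re_cdorfman, re_cdorfman, e1, e2,
      dorfman_add_left hs.1 hs'.1 ht.1, dorfman_add_left hs.2 hs'.2 ht.2]
    abel
  · rw [Cx.im_add, im_cdorfman, im_cdorfman, im_cdorfman, e1, e2,
      dorfman_add_left hs.1 hs'.1 ht.2, dorfman_add_left hs.2 hs'.2 ht.1]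
    abel

theorem dorfman_sub_right {x y y' : GSec F X} {p : X}
    (hx : SecSmoothAt F x p) (hy : SecSmoothAt F y p) (hy' : SecSmoothAt F y' p) :
    dorfman F x (y - y') p = dorfman F x y p - dorfman F x y' p := by
  rw [eq_sub_iff_add_eq, ← dorfman_add_right hx (hy.sub hy') hy', sub_add_cancel]

/-- The Leibniz rule for the complex Dorfman bracket. -/
theorem cdorfman_smul_right {s t : CSec F X} {g : X → ℂ} {p : X} (hs : CSmoothAt s p)
    (ht : CSmoothAt t p) (hr : FunSmoothAt F (fun q => (g q).re) p)
    (hi : FunSmoothAt F (fun q => (g q).im) p) :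
    ∃ d : ℂ, cdorfman F s (fun q => g q • t q) p = g p • cdorfman F s t p + d • t p := by
  refine ⟨⟨dirDeriv 𝓘(ℝ, F) (fun q => (g q).re) p (reSec s p).1 -
    dirDeriv 𝓘(ℝ, F) (fun q => (g q).im) p (imSec s p).1,
    dirDeriv 𝓘(ℝ, F) (fun q => (g q).im) p (reSec s p).1 +
    dirDeriv 𝓘(ℝ, F) (fun q => (g q).re) p (imSec s p).1⟩, ?_⟩
  have e1 : reSec (fun q => g q • t q) =
    (fun q => (g q).re • reSec t q) - fun q => (g q).im • imSec t q := rfl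
  have e2 : imSec (fun q => g q • t q) =
    (fun q => (g q).re • imSec t q) + fun q => (g q).im • reSec t q := rfl
  have rr := ht.1.smul hr
  have ri := ht.2.smul hr
  have ir := ht.1.smul hi
  have ii := ht.2.smul hi
  have hre : reSec t p = (t p).re := rfl
  have him : imSec t p = (t p).im := rfl
  refine Cx.ext ?_ ?_
  · rw [re_cdorfman, e1, e2, dorfman_sub_right hs.1 rr ii, dorfman_add_right hs.2 ri ir,
      dorfman_smul_right hs.1 ht.1 hr, dorfman_smul_right hs.1 ht.2 hi,
      dorfman_smul_right hs.2 ht.2 hr, dorfman_smul_right hs.2 ht.1 hi,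
      Cx.re_add, Cx.re_smul, Cx.re_smul, re_cdorfman, im_cdorfman, hre, him]
    module
  · rw [im_cdorfman, e1, e2, dorfman_sub_right hs.2 rr ii, dorfman_add_right hs.1 ri ir,
      dorfman_smul_right hs.1 ht.2 hr, dorfman_smul_right hs.1 ht.1 hi,
      dorfman_smul_right hs.2 ht.1 hr, dorfman_smul_right hs.2 ht.2 hi,
      Cx.im_add, Cx.im_smul, Cx.im_smul, re_cdorfman, im_cdorfman, hre, him]
    module

/-- By the Leibniz rule, the derivatives of the coefficients only contribute multiples of the `τ i
p`, which lie in `L`. Closure can therefore be tested on generators. Smoothness of the partial sums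
is carried along in the induction because additivity of the bracket needs it. -/
theorem cdorfman_sum_mem {ι : Type*} (A : Finset ι) {s : CSec F X} {τ : ι → CSec F X}
    {g : ι → X → ℂ} {p : X} (L : Submodule ℂ (Cx (GT F p))) (hs : CSmoothAt s p)
    (hτ : ∀ i ∈ A, CSmoothAt (τ i) p) (hr : ∀ i ∈ A, FunSmoothAt F (fun q => (g i q).re) p)
    (hi : ∀ i ∈ A, FunSmoothAt F (fun q => (g i q).im) p) (hL : ∀ i ∈ A, τ i p ∈ L)
    (hL' : ∀ i ∈ A, cdorfman F s (τ i) p ∈ L) :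
    CSmoothAt (fun q => ∑ i ∈ A, g i q • τ i q) p ∧
      cdorfman F s (fun q => ∑ i ∈ A, g i q • τ i q) p ∈ L := by
  classical
  induction A using Finset.induction_on with
  | empty =>
    have h0 : CSmoothAt (0 : CSec F X) p := ⟨SecSmoothAt.zero, SecSmoothAt.zero⟩
    refine ⟨h0, ?_⟩
    have h1 := cdorfman_add_right hs h0 h0
    rw [add_zero, left_eq_add] at h1
    exact (congrArg (· ∈ L) h1).mpr (zero_mem L)
  | insert i A hiA ih =>
    obtain ⟨h1, h2⟩ := ih (fun j hj => hτ j (Finset.mem_insert_of_mem hj))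
      (fun j hj => hr j (Finset.mem_insert_of_mem hj))
      (fun j hj => hi j (Finset.mem_insert_of_mem hj))
      (fun j hj => hL j (Finset.mem_insert_of_mem hj))
      (fun j hj => hL' j (Finset.mem_insert_of_mem hj))
    have hm := Finset.mem_insert_self i A
    have h3 := (hτ i hm).smul (hr i hm) (hi i hm)
    have e : (fun q => ∑ j ∈ insert i A, g j q • τ j q) =
        (fun q => g i q • τ i q) + fun q => ∑ j ∈ A, g j q • τ j q :=
      funext fun q => Finset.sum_insert hiA
    obtain ⟨d, hd⟩ := cdorfman_smul_right hs (hτ i hm) (hr i hm) (hi i hm)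
    rw [e, cdorfman_add_right hs h3 h1, hd]
    exact ⟨h3.add h1, add_mem (add_mem (L.smul_mem _ (hL' i hm)) (L.smul_mem _ (hL i hm))) h2⟩

/-- The Dorfman bracket is skew-symmetric on sections of an eigenbundle. -/
theorem IsSGF.cdorfman_swap {E : GFam F X} {J : GEnd F X} (h : IsSGF F E J) {s t : CSec F X}
    (hs : s ∈ eigensections F E J) (ht : t ∈ eigensections F E J) (p : X) :
    cdorfman F s t p = -cdorfman F t s p := by
  rw [eq_neg_iff_add_eq_zero]
  have hs1 := hs.1.cSmoothAt p
  have ht1 := ht.1.cSmoothAt p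
  have a1 := dorfman_add_swap hs1.1 ht1.1
  have a2 := dorfman_add_swap hs1.2 ht1.2
  have a3 := dorfman_add_swap hs1.1 ht1.2
  have a4 := dorfman_add_swap hs1.2 ht1.1
  -- `f1` and `f2` are the real and imaginary parts of `⟨s, t⟩ = 0`: the eigenbundle is isotropic,
  -- so the exact symmetric part of the bracket vanishes.
  have f1 : (fun q => pairing F q (imSec s q) (imSec t q)) =
      fun q => pairing F q (reSec s q) (reSec t q) := funext fun q => by
    have u := mem_eigenbundle_iff.1 (hs.2 q)
    have v := mem_eigenbundle_iff.1 (ht.2 q)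
    show pairing F q (s q).im (t q).im = pairing F q (s q).re (t q).re
    rw [u.2, v.2, map_neg, map_neg, LinearMap.neg_apply, neg_neg, h.orthogonal q _ u.1 _ v.1]
  have f2 : (fun q => pairing F q (imSec s q) (reSec t q)) =
      fun q => -pairing F q (reSec s q) (imSec t q) := funext fun q => by
    have u := mem_eigenbundle_iff.1 (hs.2 q)
    have v := mem_eigenbundle_iff.1 (ht.2 q)
    show pairing F q (s q).im (t q).re = -pairing F q (s q).re (t q).im
    rw [u.2, v.2, map_neg, map_neg, LinearMap.neg_apply, h.skew q _ u.1 _ v.1]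
  have f3 : diff F (fun q => -pairing F q (reSec s q) (imSec t q)) p =
      -diff F (fun q => pairing F q (reSec s q) (imSec t q)) p := by
    have h1 := (FunSmoothAt.pairing hs1.1 ht1.2).mdifferentiableAt
    refine ContinuousLinearMap.ext fun w => ?_
    have h2 := dirDeriv_sub_fun (v := w) (mdifferentiableAt_const (c := (0 : ℝ))) h1
    simp only [zero_sub, dirDeriv_const] at h2
    exact h2
  rw [f1] at a2
  rw [f2, f3] at a4
  refine Cx.ext ?_ ?_
  · rw [Cx.re_add, re_cdorfman, re_cdorfman, Cx.re_zero]
    calc _ = (dorfman F (reSec s) (reSec t) p + dorfman F (reSec t) (reSec s) p) -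
          (dorfman F (imSec s) (imSec t) p + dorfman F (imSec t) (imSec s) p) := by abel
      _ = 0 := by rw [a1, a2, sub_self]
  · rw [Cx.im_add, im_cdorfman, im_cdorfman, Cx.im_zero]
    calc _ = (dorfman F (reSec s) (imSec t) p + dorfman F (imSec t) (reSec s) p) +
          (dorfman F (imSec s) (reSec t) p + dorfman F (reSec t) (imSec s) p) := by abel
      _ = 0 := by rw [a3, a4, Prod.mk_add_mk, smul_neg, add_neg_cancel, add_zero]; rfl

end ComplexBracket

/-! ### Pull-back of split structures and the structure on the sum -/

section Drop

variable {FM FN FG : Type*} [NormedAddCommGroup FM] [NormedSpace ℝ FM] [FiniteDimensional ℝ FM]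
  [NormedAddCommGroup FN] [NormedSpace ℝ FN] [FiniteDimensional ℝ FN]
  [NormedAddCommGroup FG] [NormedSpace ℝ FG] [FiniteDimensional ℝ FG]
  {M : Type*} [TopologicalSpace M] [ChartedSpace FM M] [IsManifold 𝓘(ℝ, FM) ∞ M]
  {N : Type*} [TopologicalSpace N] [ChartedSpace FN N] [IsManifold 𝓘(ℝ, FN) ∞ N]
  {G : Type*} [TopologicalSpace G] [ChartedSpace FG G] [Group G] [LieGroup 𝓘(ℝ, FG) ∞ G]
  [MulAction Gᵐᵒᵖ N] {π : N → M} {H : Distribution FN N}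
  (hπ : IsPrincipalBundle FM FN FG G π) (hH : IsFlatConnection FM FN FG G π H)

/-- `dropAt` is the adjoint of `liftAt`. As it is also a left inverse, lifting is isometric. -/
theorem pairing_dropAt (q : N) (x : GT FN q) (u : GT FM (π q)) :
    pairing FM (π q) (dropAt FM FN π H q x) u = pairing FN q x (liftAt FM FN π H q u) := rfl

theorem dropAt_vertical {q : N} {c : GT FN q} (hc : c ∈ vertical FM FN π H q) :
    dropAt FM FN π H q c = 0 :=
  Prod.ext hc.1 (ContinuousLinearMap.ext fun u => hc.2 _ (horLift_mem q u))

include hπ hH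

theorem dropAt_liftAt (q : N) (x : GT FM (π q)) :
    dropAt FM FN π H q (liftAt FM FN π H q x) = x :=
  Prod.ext (mfderiv_horLift hπ hH q x.1)
    (ContinuousLinearMap.ext fun u => congrArg x.2 (mfderiv_horLift hπ hH q u))

theorem liftAt_injective (q : N) : Function.Injective (liftAt FM FN π H q) :=
  Function.LeftInverse.injective (dropAt_liftAt hπ hH q)

theorem pairing_liftAt (q : N) (x y : GT FM (π q)) :
    pairing FN q (liftAt FM FN π H q x) (liftAt FM FN π H q y) = pairing FM (π q) x y := by
  rw [← pairing_dropAt, dropAt_liftAt hπ hH]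

theorem gram_pullSec {ι : Type*} (e : ι → GSec FM M) (q : N) :
    gram (fun i => pullSec FM FN π H (e i)) q = gram e (π q) :=
  Matrix.ext fun i j => pairing_liftAt hπ hH q (e i (π q)) (e j (π q))

theorem IsSplit.pullFam {E : GFam FM M} (h : IsSplit FM E) : IsSplit FN (pullFam FM FN π H E) := by
  obtain ⟨k, h1, h2⟩ := h
  refine ⟨k, fun q => ?_, fun q => hasSignature_map (liftAt_injective hπ hH q)
    (pairing_liftAt hπ hH q) (h1.finrank_eq _) (h2 _)⟩
  obtain ⟨U, hU, hp, e, he, he'⟩ := h1 (π q)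
  have hU' : IsOpen (π ⁻¹' U) := hU.preimage hπ.smooth_proj.continuous
  refine ⟨π ⁻¹' U, hU', hp, fun i => pullSec FM FN π H (e i), fun i => ?_, fun r hr => ⟨?_, ?_⟩⟩
  · exact (smoothOn_iff hU').2 fun r hr =>
      secSmoothAt_pullSec hπ hH ((smoothOn_iff hU).1 (he i) _ hr)
  · have := (he' _ hr).1.map' (liftAt FM FN π H r)
      (LinearMap.ker_eq_bot.2 (liftAt_injective hπ hH r))
    exact this
  · have : (range fun i => pullSec FM FN π H (e i) r) =
        liftAt FM FN π H r '' range fun i => e i (π r) := by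
      rw [← range_comp]; rfl
    rw [this, Submodule.span_image, (he' _ hr).2]
    rfl

theorem liftAt_mem_pullFam {E : GFam FM M} {q : N} {x : GT FM (π q)} (hx : x ∈ E (π q)) :
    liftAt FM FN π H q x ∈ pullFam FM FN π H E q := Submodule.mem_map_of_mem hx

theorem orthogonal_pullFam {E E' : GFam FM M} (hEE' : Orthogonal FM E E') :
    Orthogonal FN (pullFam FM FN π H E) (pullFam FM FN π H E' ⊔ vertical FM FN π H) := by
  rintro q _ ⟨x, hx, rfl⟩ y hy
  obtain ⟨_, ⟨b, hb, rfl⟩, c, hc, rfl⟩ := Submodule.mem_sup.1 hy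
  rw [map_add, pairing_pullSec_vertical hπ hH x hc, add_zero, pairing_liftAt hπ hH]
  exact hEE' _ x hx b hb

omit hπ hH in
variable (FM FN π H) in
-- In this grouping the two summands are the bundles on which `π^*J` and `Ψ` act.
theorem pullFam_sup_vertical (E E' : GFam FM M) :
    pullFam FM FN π H (E ⊔ E') ⊔ vertical FM FN π H =
      pullFam FM FN π H E ⊔ (pullFam FM FN π H E' ⊔ vertical FM FN π H) := by
  rw [← sup_assoc]
  congr 1
  exact funext fun q => Submodule.map_sup _ _ _

theorem dropAt_mem {E' : GFam FM M} {q : N} {y : GT FN q}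
    (hy : y ∈ (pullFam FM FN π H E' ⊔ vertical FM FN π H) q) :
    dropAt FM FN π H q y ∈ E' (π q) := by
  obtain ⟨_, ⟨b, hb, rfl⟩, c, hc, rfl⟩ := Submodule.mem_sup.1 hy
  rw [map_add, dropAt_liftAt hπ hH, dropAt_vertical hc, add_zero]
  exact hb

variable {E E' : GFam FM M} {J : GEnd FM M} {Ψ : GEnd FN N} (hJ : IsSGF FM E J)
  (hΨ : IsSGF FN (pullFam FM FN π H E' ⊔ vertical FM FN π H) Ψ) (hEE' : Orthogonal FM E E')

include hJ hEE' in
-- `J` vanishes on the orthogonal complement of `E`, and `dropAt` maps the second summand into `E'`.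
theorem IsSGF.pullEnd_eq_zero {q : N} {y : GT FN q}
    (hy : y ∈ (pullFam FM FN π H E' ⊔ vertical FM FN π H) q) : pullEnd FM FN π H J q y = 0 := by
  show liftAt FM FN π H q (J (π q) (dropAt FM FN π H q y)) = 0
  rw [hJ.zero _ _ fun x hx => hEE'.symm _ _ (dropAt_mem hπ hH hy) x hx, map_zero]

include hΨ hEE' in
theorem IsSGF.liftAt_eq_zero {q : N} {x : GT FM (π q)} (hx : x ∈ E (π q)) :
    Ψ q (liftAt FM FN π H q x) = 0 :=
  hΨ.zero _ _ fun y hy => orthogonal_pullFam hπ hH hEE' q _ (liftAt_mem_pullFam hπ hH hx) y hy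

include hΨ hEE' in
theorem sumEnd_liftAt {q : N} {x : GT FM (π q)} (hx : x ∈ E (π q)) :
    (pullEnd FM FN π H J + Ψ) q (liftAt FM FN π H q x) = liftAt FM FN π H q (J (π q) x) := by
  show liftAt FM FN π H q (J (π q) (dropAt FM FN π H q (liftAt FM FN π H q x))) +
    Ψ q (liftAt FM FN π H q x) = _
  rw [dropAt_liftAt hπ hH, hΨ.liftAt_eq_zero hπ hH hEE' hx, add_zero]

include hJ hEE' in
theorem sumEnd_apply {q : N} {y : GT FN q}
    (hy : y ∈ (pullFam FM FN π H E' ⊔ vertical FM FN π H) q) :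
    (pullEnd FM FN π H J + Ψ) q y = Ψ q y := by
  show pullEnd FM FN π H J q y + Ψ q y = _
  rw [hJ.pullEnd_eq_zero hπ hH hEE' hy, zero_add]

include hEE' in
/-- Near each point, a section of `π^*E'' ⊕ vertical` is a combination of lifted global sections of
`E` and of a section of the complement of `π^*E`. -/
theorem exists_decomposition [T2Space M] (hE : IsSplit FM E)
    {U : Set N} (hU : IsOpen U) {s : GSec FN N}
    (hs : s ∈ sections FN U (pullFam FM FN π H (E ⊔ E') ⊔ vertical FM FN π H)) {q₀ : N}
    (hq₀ : q₀ ∈ U) :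
    ∃ (W : Set N) (r : ℕ) (e : Fin r → GSec FM M) (c : Fin r → N → ℝ) (y : GSec FN N),
      IsOpen W ∧ q₀ ∈ W ∧ (∀ i, e i ∈ sections FM univ E) ∧
      (∀ i, ∀ q ∈ W, FunSmoothAt FN (c i) q) ∧
      y ∈ sections FN W (pullFam FM FN π H E' ⊔ vertical FM FN π H) ∧
      ∀ q ∈ W, s q = ∑ i, c i q • pullSec FM FN π H (e i) q + y q := by
  obtain ⟨U₁, hU₁, hp, r, e, he, heE, hdet, hspan⟩ := hE.exists_frame (π q₀)
  -- The local frame is replaced by global sections because the bracket formulas for lifts assume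
  -- smoothness on all of `M`.
  choose t ht ht' using fun i => exists_global_section (E := E) hU₁
    (s := e i) ⟨he i, fun q hq => heE q hq i⟩ hp
  obtain ⟨U₂, hU₂, hU₂o, hp₂⟩ := eventually_nhds_iff.1 (eventually_all.2 ht')
  have hdet' : ∀ q, π q ∈ U₁ ∩ U₂ → (gram (fun i => pullSec FM FN π H (t i)) q).det ≠ 0 := by
    intro q hq
    rw [gram_pullSec hπ hH]
    have : gram t (π q) = gram e (π q) := Matrix.ext fun i j => by
      show pairing FM _ _ _ = pairing FM _ _ _
      rw [hU₂ _ hq.2 i, hU₂ _ hq.2 j]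
    rw [this]
    exact hdet _ hq.1
  have hW : IsOpen (U ∩ π ⁻¹' (U₁ ∩ U₂)) :=
    hU.inter ((hU₁.inter hU₂o).preimage hπ.smooth_proj.continuous)
  have ht1 : ∀ i q, SecSmoothAt FN (pullSec FM FN π H (t i)) q := fun i q =>
    secSmoothAt_pullSec hπ hH ((ht i).1.secSmoothAt univ_mem)
  have hc : ∀ i, ∀ q ∈ U ∩ π ⁻¹' (U₁ ∩ U₂),
      FunSmoothAt FN (gramCoeff (fun i => pullSec FM FN π H (t i)) s i) q := fun i q hq =>
    funSmoothAt_gramCoeff (fun j => ht1 j q) ((smoothOn_iff hU).1 hs.1 q hq.1) (hdet' q hq.2) i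
  refine ⟨_, r, t, gramCoeff (fun i => pullSec FM FN π H (t i)) s,
    fun q => s q - ∑ i, gramCoeff (fun i => pullSec FM FN π H (t i)) s i q •
      pullSec FM FN π H (t i) q, hW, ⟨hq₀, hp, hp₂⟩, ht, hc, ⟨(smoothOn_iff hW).2 fun q hq => ?_,
      fun q hq => ?_⟩, fun q hq => (add_sub_cancel _ _).symm⟩
  · exact ((smoothOn_iff hU).1 hs.1 q hq.1).sub
      (SecSmoothAt.sum fun i _ => (ht1 i q).smul (hc i q hq))
  · have hspan' : Submodule.span ℝ (range fun i => pullSec FM FN π H (t i) q) =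
        pullFam FM FN π H E q := by
      have : (range fun i => pullSec FM FN π H (t i) q) =
          liftAt FM FN π H q '' range fun i => e i (π q) := by
        rw [← range_comp]
        exact congrArg range (funext fun i => congrArg (liftAt FM FN π H q) (hU₂ _ hq.2.2 i))
      rw [this, Submodule.span_image, hspan _ hq.2.1]
      rfl
    have h1 : (s q - ∑ i, gramCoeff (fun i => pullSec FM FN π H (t i)) s i q •
        pullSec FM FN π H (t i) q) ∈
        (pullFam FM FN π H E ⊔ (pullFam FM FN π H E' ⊔ vertical FM FN π H)) q := by
      have h2 := hs.2 q hq.1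
      rw [pullFam_sup_vertical FM FN π H] at h2
      refine sub_mem h2 (Submodule.mem_sup_left (Submodule.sum_mem _ fun i _ =>
        Submodule.smul_mem _ _ ?_))
      rw [← hspan']
      exact Submodule.subset_span (mem_range_self i)
    obtain ⟨a, ha, b, hb, hab⟩ := Submodule.mem_sup.1 h1
    -- The remainder is orthogonal to `π^*E`, so its component there is orthogonal to `π^*E` too,
    -- and nondegeneracy kills it.
    have h3 : a = 0 := (hE.pullFam hπ hH).eq_zero ha fun y hy => by
      have h4 := pairing_sub_gramCoeff (hdet' q hq.2) s (y := y) (by rw [hspan']; exact hy)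
      rw [← hab, map_add, LinearMap.add_apply, pairing_comm q b y,
        orthogonal_pullFam hπ hH hEE' q y hy b hb, add_zero] at h4
      exact h4
    rw [h3, zero_add] at hab
    exact (congrArg (· ∈ _) hab).mp hb

include hJ hΨ hEE'

/-- The sum of a lifted structure and a structure on the complement is a split generalized
`F`-structure. -/
theorem IsSGF.sumEnd [T2Space M] :
    IsSGF FN (GenGeom.pullFam FM FN π H (E ⊔ E') ⊔ vertical FM FN π H)
      (pullEnd FM FN π H J + Ψ) := by
  have ho := orthogonal_pullFam hπ hH hEE'
  have hL : ∀ {q : N} {x : GT FM (π q)}, x ∈ E (π q) →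
      (pullEnd FM FN π H J + Ψ) q (liftAt FM FN π H q x) = liftAt FM FN π H q (J (π q) x) :=
    fun hx => sumEnd_liftAt hπ hH hΨ hEE' hx
  have hB : ∀ {q : N} {y : GT FN q}, y ∈ (GenGeom.pullFam FM FN π H E' ⊔ vertical FM FN π H) q →
    (pullEnd FM FN π H J + Ψ) q y = Ψ q y := fun hy => sumEnd_apply hπ hH hJ hEE' hy
  have hl : ∀ {q : N} {x : GT FM (π q)}, x ∈ E (π q) →
      liftAt FM FN π H q x ∈ GenGeom.pullFam FM FN π H E q := liftAt_mem_pullFam hπ hH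
  rw [pullFam_sup_vertical FM FN π H]
  refine ⟨(hJ.split.pullFam hπ hH).sup hΨ.split ho, fun q x hx => ?_, fun q x hx => ?_,
    fun q x hx y hy => ?_, fun q x hx y hy => ?_, fun U hU s hs => ?_⟩
  · obtain ⟨_, ⟨a, ha, rfl⟩, b, hb, rfl⟩ := Submodule.mem_sup.1 hx
    rw [map_add, hL ha, hB hb]
    exact Submodule.add_mem_sup (hl (hJ.mapsTo _ _ ha)) (hΨ.mapsTo _ _ hb)
  · have h1 : J (π q) (dropAt FM FN π H q x) = 0 := hJ.zero _ _ fun y hy => by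
      rw [pairing_dropAt]
      exact hx _ (Submodule.mem_sup_left (hl hy))
    have h2 : Ψ q x = 0 := hΨ.zero _ _ fun y hy => hx _ (Submodule.mem_sup_right hy)
    show liftAt FM FN π H q (J (π q) (dropAt FM FN π H q x)) + Ψ q x = 0
    rw [h1, h2, map_zero, zero_add]
  · obtain ⟨_, ⟨a, ha, rfl⟩, b, hb, rfl⟩ := Submodule.mem_sup.1 hx
    obtain ⟨_, ⟨c, hc, rfl⟩, d, hd, rfl⟩ := Submodule.mem_sup.1 hy
    simp only [map_add, hL ha, hB hb, hL hc, hB hd, LinearMap.add_apply]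
    rw [pairing_liftAt hπ hH, pairing_liftAt hπ hH, hJ.skew _ _ ha _ hc, hΨ.skew _ _ hb _ hd,
      ho q _ (hl (hJ.mapsTo _ _ ha)) _ hd, ho q _ (hl ha) _ (hΨ.mapsTo _ _ hd),
      ho.symm q _ (hΨ.mapsTo _ _ hb) _ (hl hc), ho.symm q _ hb _ (hl (hJ.mapsTo _ _ hc))]
    ring
  · obtain ⟨_, ⟨a, ha, rfl⟩, b, hb, rfl⟩ := Submodule.mem_sup.1 hx
    obtain ⟨_, ⟨c, hc, rfl⟩, d, hd, rfl⟩ := Submodule.mem_sup.1 hy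
    simp only [map_add, hL ha, hB hb, hL hc, hB hd, LinearMap.add_apply]
    rw [pairing_liftAt hπ hH, pairing_liftAt hπ hH, hJ.orthogonal _ _ ha _ hc,
      hΨ.orthogonal _ _ hb _ hd, ho q _ (hl (hJ.mapsTo _ _ ha)) _ (hΨ.mapsTo _ _ hd),
      ho q _ (hl ha) _ hd, ho.symm q _ (hΨ.mapsTo _ _ hb) _ (hl (hJ.mapsTo _ _ hc)),
      ho.symm q _ hb _ (hl hc)]
  -- Near a point, `J` is applied to the lifted sections on `M` and `Ψ` to the complementary
  -- section.
  · refine (smoothOn_iff hU).2 fun q₀ hq₀ => ?_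
    rw [← pullFam_sup_vertical FM FN π H] at hs
    obtain ⟨W, r, e, c, y, hW, hq, he, hc, hy, hsq⟩ :=
      exists_decomposition hπ hH hEE' hJ.split hU hs hq₀
    have h1 : SecSmoothAt FN ((fun q => ∑ i, c i q • pullSec FM FN π H
        (fun p => J p (e i p)) q) + fun q => Ψ q (y q)) q₀ :=
      (SecSmoothAt.sum fun i _ => SecSmoothAt.smul (hc i _ hq) (secSmoothAt_pullSec hπ hH
        ((hJ.smooth univ isOpen_univ _ (he i)).secSmoothAt univ_mem))).add
        ((smoothOn_iff hW).1 (hΨ.smooth W hW y hy) q₀ hq)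
    refine h1.congr ?_
    filter_upwards [hW.mem_nhds hq] with q hqW
    rw [hsq q hqW, map_add, map_sum, hB (hy.2 q hqW)]
    refine congrArg (· + Ψ q (y q)) (Finset.sum_congr rfl fun i _ => ?_)
    rw [map_smul]
    exact congrArg _ (hL ((he i).2 _ (mem_univ _)))

end Drop

/-! ### Framings as global frames -/

section Framing

variable {F : Type*} [NormedAddCommGroup F] [NormedSpace ℝ F] [FiniteDimensional ℝ F]
  {X : Type*} [TopologicalSpace X] [ChartedSpace F X] [IsManifold 𝓘(ℝ, F) ∞ X] [T2Space X]

/-- A framing of a split structure has a basis, which is a frame at each point. -/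
theorem IsFraming.exists_basis {E : GFam F X} {V : Submodule ℝ (GSec F X)}
    (hV : IsFraming F univ E V) (hE : IsSplit F E) :
    ∃ v : Fin (Module.finrank ℝ V) → GSec F X, (∀ i, v i ∈ V) ∧ (∀ p, (gram v p).det ≠ 0) ∧
      ∀ p, Submodule.span ℝ (range fun i => v i p) = E p := by
  obtain ⟨hfin, hrank, hsec, hgen⟩ := hV
  have : Module.Free ℝ V := Module.Free.of_divisionRing ℝ V
  let b := Module.finBasis ℝ V
  have hspan : ∀ p, Submodule.span ℝ (range fun i => (b i : GSec F X) p) = E p := by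
    intro p
    refine le_antisymm (Submodule.span_le.2 ?_) fun x hx => ?_
    · rintro _ ⟨i, rfl⟩
      exact (hsec _ (b i).2).2 p (mem_univ p)
    · obtain ⟨s, hs, rfl⟩ := hE.exists_section hx
      obtain ⟨n, f, w, hfw, hsw⟩ := hgen s hs
      rw [hsw p (mem_univ p)]
      refine Submodule.sum_mem _ fun i _ => Submodule.smul_mem _ _ ?_
      have h1 := congrArg (fun z : V => (z : GSec F X) p) (b.sum_repr ⟨w i, (hfw i).2⟩)
      have h2 : ((∑ j, b.repr ⟨w i, (hfw i).2⟩ j • b j : V) : GSec F X) p =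
          ∑ j, b.repr ⟨w i, (hfw i).2⟩ j • (b j : GSec F X) p := by
        rw [Submodule.coe_sum, Finset.sum_apply]
        rfl
      rw [← show _ = w i p from h1, h2]
      exact Submodule.sum_mem _ fun j _ => Submodule.smul_mem _ _
        (Submodule.subset_span (mem_range_self j))
  refine ⟨fun i => b i, fun i => (b i).2, fun p => gram_det_ne_zero ?_ ?_, hspan⟩
  -- The values of a basis of `V` span a fibre whose rank is `dim V`, hence they are independent.
  · rw [linearIndependent_iff_card_eq_finrank_span, Fintype.card_fin, Set.finrank, hspan,
      hrank p (mem_univ p)]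
  · rw [hspan]
    exact fun x hx => hE.eq_zero hx

theorem eq_sum_gramCoeff {ι : Type*} [Fintype ι] [DecidableEq ι] {E : GFam F X}
    (hE : IsSplit F E) {e : ι → GSec F X} {p : X} (hdet : (gram e p).det ≠ 0)
    (hspan : Submodule.span ℝ (range fun i => e i p) = E p) {s : GSec F X} (hs : s p ∈ E p) :
    s p = ∑ i, gramCoeff e s i p • e i p := by
  refine sub_eq_zero.1 (hE.eq_zero (p := p) ?_ fun y hy =>
    pairing_sub_gramCoeff hdet s (by rw [hspan]; exact hy))
  refine sub_mem hs (Submodule.sum_mem _ fun i _ => Submodule.smul_mem _ _ ?_)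
  rw [← hspan]
  exact Submodule.subset_span (mem_range_self i)

omit [FiniteDimensional ℝ F] [IsManifold 𝓘(ℝ, F) ∞ X] [T2Space X] in
/-- A smooth complex function, from its real and imaginary parts. -/
def CFun.mk {a b : X → ℝ} (ha : ∀ q, FunSmoothAt F a q) (hb : ∀ q, FunSmoothAt F b q) : CFun F X :=
  ⟨fun q => ⟨a q, b q⟩, fun q => (Complex.equivRealProdCLM.symm.contDiff.contMDiff.contMDiffAt
    (x := (a q, b q))).comp (f := fun q => (a q, b q)) q ((ha q).prodMk_space (hb q))⟩

/-- Complex sections of a split structure are combinations of the elements of a frame. -/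
theorem exists_eq_sum_frame {ι : Type*} [Fintype ι] [DecidableEq ι] {E : GFam F X}
    (hE : IsSplit F E) {v : ι → csections F E}
    {w : ι → GSec F X} (hvw : ∀ i, (v i : CSec F X) = csec (w i) 0)
    (hw : ∀ i q, SecSmoothAt F (w i) q) (hdet : ∀ p, (gram w p).det ≠ 0)
    (hspan : ∀ p, Submodule.span ℝ (range fun i => w i p) = E p) (e : csections F E) :
    ∃ g : ι → CFun F X, e = ∑ i, g i • v i := by
  have h1 := e.2.1
  refine ⟨fun i => CFun.mk (a := gramCoeff w (reSec (e : CSec F X)) i)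
    (b := gramCoeff w (imSec (e : CSec F X)) i)
    (fun q => funSmoothAt_gramCoeff (fun i => hw i q) (h1.1.secSmoothAt univ_mem) (hdet q) i)
    (fun q => funSmoothAt_gramCoeff (fun i => hw i q) (h1.2.secSmoothAt univ_mem) (hdet q) i), ?_⟩
  refine Subtype.ext (funext fun p => ?_)
  rw [Submodule.coe_sum, Finset.sum_apply]
  have hv : ∀ (g : CFun F X) i, ((g • v i : csections F E) : CSec F X) p =
      Cx.mk ((g p).re • w i p) ((g p).im • w i p) := by
    intro g i
    show g p • (v i : CSec F X) p = _
    rw [hvw]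
    refine Cx.ext ?_ ?_
    · show (g p).re • w i p - (g p).im • (0 : GT F p) = _
      rw [smul_zero, sub_zero]; rfl
    · show (g p).re • (0 : GT F p) + (g p).im • w i p = _
      rw [smul_zero, zero_add]; rfl
  simp only [hv]
  refine Cx.ext ?_ ?_
  · rw [Cx.re_sum]
    exact eq_sum_gramCoeff (s := reSec (e : CSec F X)) hE (hdet p) (hspan p) (e.2.2 p).1
  · rw [Cx.im_sum]
    exact eq_sum_gramCoeff (s := imSec (e : CSec F X)) hE (hdet p) (hspan p) (e.2.2 p).2

end Framing

/-! ### Admissible isomorphisms are fibrewise injective -/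

section Lift

variable {FM FN FG : Type*} [NormedAddCommGroup FM] [NormedSpace ℝ FM] [FiniteDimensional ℝ FM]
  [NormedAddCommGroup FN] [NormedSpace ℝ FN] [FiniteDimensional ℝ FN]
  [NormedAddCommGroup FG] [NormedSpace ℝ FG] [FiniteDimensional ℝ FG]
  {M : Type*} [TopologicalSpace M] [ChartedSpace FM M] [IsManifold 𝓘(ℝ, FM) ∞ M] [T2Space M]
  {N : Type*} [TopologicalSpace N] [ChartedSpace FN N] [IsManifold 𝓘(ℝ, FN) ∞ N] [T2Space N]
  {G : Type*} [TopologicalSpace G] [ChartedSpace FG G] [Group G] [LieGroup 𝓘(ℝ, FG) ∞ G]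
  [MulAction Gᵐᵒᵖ N] {π : N → M} {H : Distribution FN N}
  (hπ : IsPrincipalBundle FM FN FG G π) (hH : IsFlatConnection FM FN FG G π H)
  {E E' : GFam FM M} {V : Submodule ℝ (GSec FM M)}

include hπ hH

/-- An element of the vertical framing that vanishes at a point is zero. -/
theorem eq_zero_of_mem_verticalFraming {s : GSec FN N} (hs : s ∈ verticalFraming FN FG G H) {q : N}
    (hq : s q = 0) : s = 0 := by
  obtain ⟨v, l, h⟩ := hs
  have hv : v = 0 := hπ.fundamentalField_eq_zero ((h q).1.symm.trans (congrArg Prod.fst hq))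
  have hl : ∀ w, l w = 0 := fun w => by rw [← (h q).2.2 w, hq]; rfl
  refine funext fun r => gt_ext_lift hπ hH ?_ (fun t _ => ?_) fun w => ?_
  · rw [(h r).1, hv]
    exact map_zero _
  · exact (h r).2.1 _ (horLift_mem r _)
  · rw [(h r).2.2, hl]
    rfl

/-- Elements of `π^*V`, as complex sections. -/
def pullFramingElt (hV : IsFraming FM univ E' V) (v : V) : csections FN (pullFam FM FN π H E') :=
  ⟨csec (pullSec FM FN π H v) 0, ⟨smoothOn_of_secSmoothAt fun _ _ =>
    secSmoothAt_pullSec hπ hH ((hV.2.2.1 v v.2).1.secSmoothAt univ_mem), SmoothOn.zero FN⟩,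
    fun _ => ⟨liftAt_mem_pullFam hπ hH ((hV.2.2.1 v v.2).2 _ (mem_univ _)), zero_mem _⟩⟩

/-- Lifting is isometric, so the Gram matrix of the lifted framing is a pull-back and stays
invertible; Gram coefficients are then smooth on all of `N`. -/
theorem exists_eq_sum_pullFraming (hE' : IsSplit FM E') (hV : IsFraming FM univ E' V)
    (e : csections FN (pullFam FM FN π H E')) :
    ∃ (d : ℕ) (v : Fin d → V) (g : Fin d → CFun FN N),
      e = ∑ i, g i • pullFramingElt hπ hH hV (v i) := by
  obtain ⟨v, hvV, hdet, hspan⟩ := hV.exists_basis hE'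
  refine ⟨_, fun i => ⟨v i, hvV i⟩, exists_eq_sum_frame (hE'.pullFam hπ hH)
    (w := fun i => pullSec FM FN π H (v i)) (fun i => rfl)
    (fun i q => secSmoothAt_pullSec hπ hH ((hV.2.2.1 _ (hvV i)).1.secSmoothAt univ_mem))
    (fun q => ?_) (fun q => ?_) e⟩
  · rw [gram_pullSec hπ hH]
    exact hdet _
  · have : (range fun i => pullSec FM FN π H (v i) q) =
        liftAt FM FN π H q '' range fun i => v i (π q) := by
      rw [← range_comp]
      rfl
    rw [this, Submodule.span_image, hspan]
    rfl

theorem pullFramingElt_mem (hV : IsFraming FM univ E' V) (v : V) :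
    pullFramingElt hπ hH hV v ∈ cframing FN (pullFam FM FN π H E') (V.map (pullSec FM FN π H)) :=
  ⟨Submodule.mem_map_of_mem v.2, zero_mem _⟩

omit hπ hH in
-- The framing is only a vector space, so constancy of the coefficients is essential; it makes it
-- possible to freeze variable coefficients at a point.
theorem sum_const_mem_cframing {F X ι : Type*} [NormedAddCommGroup F] [NormedSpace ℝ F]
    [TopologicalSpace X] [ChartedSpace F X] [IsManifold 𝓘(ℝ, F) ∞ X] {E : GFam F X}
    {V : Submodule ℝ (GSec F X)} (A : Finset ι) {v : ι → csections F E}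
    (hv : ∀ i ∈ A, v i ∈ cframing F E V) (c : ι → ℂ) :
    ∑ i ∈ A, (ContMDiffMap.const (c i) : CFun F X) • v i ∈ cframing F E V := by
  classical
  induction A using Finset.induction_on with
  | empty => exact ⟨zero_mem V, zero_mem V⟩
  | insert i A hi ih =>
    rw [Finset.sum_insert hi]
    have h1 := hv i (Finset.mem_insert_self i A)
    have h2 := ih fun j hj => hv j (Finset.mem_insert_of_mem hj)
    exact ⟨add_mem (sub_mem (V.smul_mem (c i).re h1.1) (V.smul_mem (c i).im h1.2)) h2.1,
      add_mem (add_mem (V.smul_mem (c i).re h1.2) (V.smul_mem (c i).im h1.1)) h2.2⟩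

variable {Ψ : GEnd FN N}
  {φ : csections FN (pullFam FM FN π H E') ≃ₗ[CFun FN N] csections FN (vertical FM FN π H)}
  (hφ : IsAdmissible FN (V.map (pullSec FM FN π H)) (verticalFraming FN FG G H) Ψ φ)

include hφ

/-- An admissible isomorphism is injective on each fibre. -/
theorem IsAdmissible.eq_zero (hE' : IsSplit FM E') (hV : IsFraming FM univ E' V)
    {e : csections FN (pullFam FM FN π H E')} {q : N} (h : (φ e : CSec FN N) q = 0) :
    (e : CSec FN N) q = 0 := by
  obtain ⟨d, v, g, hg⟩ := exists_eq_sum_pullFraming hπ hH hE' hV e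
  -- Freeze the coefficients of `e` at `q`. Then `e₀` agrees with `e` at `q`, by linearity `φ e₀`
  -- agrees with `φ e` at `q`, and `φ e₀` lies in the complexified vertical framing, where vanishing
  -- at a point means being zero.
  let e₀ : csections FN (pullFam FM FN π H E') :=
    ∑ i, (ContMDiffMap.const (g i q) : CFun FN N) • pullFramingElt hπ hH hV (v i)
  have h1 : ∀ {E₀ : GFam FN N} (u : Fin d → csections FN E₀),
      ((∑ i, (ContMDiffMap.const (g i q) : CFun FN N) • u i : csections FN E₀) : CSec FN N) q =
        ((∑ i, g i • u i : csections FN E₀) : CSec FN N) q := by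
    intro E₀ u
    rw [Submodule.coe_sum, Submodule.coe_sum, Finset.sum_apply, Finset.sum_apply]
    rfl
  have h2 : (e₀ : CSec FN N) q = (e : CSec FN N) q := by rw [hg]; exact h1 _
  have h3 : (φ e₀ : CSec FN N) q = 0 := by
    rw [← h, hg, map_sum, map_sum]
    simp only [map_smul]
    exact h1 _
  have h4 : φ e₀ ∈ cframing FN (vertical FM FN π H) (verticalFraming FN FG G H) := by
    rw [← hφ.map_framing]
    exact mem_image_of_mem _ (sum_const_mem_cframing _
      (fun i _ => pullFramingElt_mem hπ hH hV (v i)) _)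
  have h5 : φ e₀ = 0 := Subtype.ext (funext fun r => Cx.ext
    (congrFun (eq_zero_of_mem_verticalFraming hπ hH h4.1 (q := q) (congrArg Cx.re h3)) r)
    (congrFun (eq_zero_of_mem_verticalFraming hπ hH h4.2 (q := q) (congrArg Cx.im h3)) r))
  have h6 : e₀ = 0 := (LinearEquiv.map_eq_zero_iff φ).1 h5
  rw [← h2, h6]
  rfl

omit hπ hH in
theorem IsAdmissible.add_mem (e : csections FN (pullFam FM FN π H E')) :
    (e : CSec FN N) + (φ e : CSec FN N) ∈
      eigensections FN (pullFam FM FN π H E' ⊔ vertical FM FN π H) Ψ := by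
  rw [hφ.graph]
  exact ⟨e, rfl⟩

end Lift

section ZeroBracket

variable {F : Type*} [NormedAddCommGroup F] [NormedSpace ℝ F] [FiniteDimensional ℝ F]
  {X : Type*} [TopologicalSpace X] [ChartedSpace F X] [IsManifold 𝓘(ℝ, F) ∞ X]

theorem dorfman_zero_right {x : GSec F X} {p : X} (hx : SecSmoothAt F x p) :
    dorfman F x 0 p = 0 := by
  have h := dorfman_add_right hx (SecSmoothAt.zero (p := p)) SecSmoothAt.zero
  rwa [add_zero, left_eq_add] at h

theorem dorfman_zero_left {x : GSec F X} {p : X} (hx : SecSmoothAt F x p) :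
    dorfman F 0 x p = 0 := by
  have h := dorfman_add_left (SecSmoothAt.zero (p := p)) SecSmoothAt.zero hx
  rwa [add_zero, left_eq_add] at h

theorem cdorfman_real {x y : GSec F X} {p : X} (hx : SecSmoothAt F x p) (hy : SecSmoothAt F y p) :
    cdorfman F (csec x 0) (csec y 0) p = Cx.mk (dorfman F x y p) 0 := by
  refine Cx.ext ?_ ?_
  · show dorfman F x y p - dorfman F 0 0 p = dorfman F x y p
    rw [dorfman_zero_left SecSmoothAt.zero, sub_zero]
  · show dorfman F x 0 p + dorfman F 0 y p = 0
    rw [dorfman_zero_left hy, dorfman_zero_right hx, add_zero]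

theorem eq_zero_of_mem_eigenbundle {E E' : GFam F X} {J : GEnd F X} (hE : IsSplit F E)
    (hEE' : Orthogonal F E E') {p : X} {z : Cx (GT F p)} (hz : z ∈ eigenbundle F E J p)
    (hz' : z.re ∈ E' p) : z = 0 := by
  rw [mem_eigenbundle_iff] at hz
  have h1 : z.re = 0 := Submodule.disjoint_def.1 (hE.disjoint hEE' p) _ hz.1 hz'
  refine Cx.ext h1 ?_
  rw [hz.2, h1, map_zero, neg_zero]
  rfl

end ZeroBracket

/-! ### Complex brackets on the total space, and lifts inside the eigenbundle -/

section Lift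

variable {FM FN FG : Type*} [NormedAddCommGroup FM] [NormedSpace ℝ FM] [FiniteDimensional ℝ FM]
  [NormedAddCommGroup FN] [NormedSpace ℝ FN] [FiniteDimensional ℝ FN]
  [NormedAddCommGroup FG] [NormedSpace ℝ FG] [FiniteDimensional ℝ FG]
  {M : Type*} [TopologicalSpace M] [ChartedSpace FM M] [IsManifold 𝓘(ℝ, FM) ∞ M] [T2Space M]
  {N : Type*} [TopologicalSpace N] [ChartedSpace FN N] [IsManifold 𝓘(ℝ, FN) ∞ N] [T2Space N]
  {G : Type*} [TopologicalSpace G] [ChartedSpace FG G] [Group G] [LieGroup 𝓘(ℝ, FG) ∞ G]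
  [MulAction Gᵐᵒᵖ N] {π : N → M} {H : Distribution FN N}
  (hπ : IsPrincipalBundle FM FN FG G π) (hH : IsFlatConnection FM FN FG G π H)
  {E E' : GFam FM M} {V : Submodule ℝ (GSec FM M)}

variable (FM FN π H) in
/-- The complex linear extension of `liftAt`. -/
def cliftAt (q : N) (z : Cx (GT FM (π q))) : Cx (GT FN q) :=
  Cx.mk (liftAt FM FN π H q z.re) (liftAt FM FN π H q z.im)

variable (FM FN π H) in
/-- The lift of complex sections. -/
def cpull (s : CSec FM M) : CSec FN N := fun q => cliftAt FM FN π H q (s (π q))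

theorem cliftAt_sub (q : N) (z w : Cx (GT FM (π q))) :
    cliftAt FM FN π H q (z - w) = cliftAt FM FN π H q z - cliftAt FM FN π H q w := by
  refine Cx.ext ?_ ?_
  · rw [Cx.re_sub]
    exact (congrArg _ (Cx.re_sub z w)).trans (map_sub _ _ _)
  · rw [Cx.im_sub]
    exact (congrArg _ (Cx.im_sub z w)).trans (map_sub _ _ _)

include hπ hH

theorem CSmooth.cpull {s : CSec FM M} (hs : CSmooth FM s) : CSmooth FN (cpull FM FN π H s) :=
  ⟨smoothOn_of_secSmoothAt fun _ _ => secSmoothAt_pullSec hπ hH (hs.1.secSmoothAt univ_mem),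
    smoothOn_of_secSmoothAt fun _ _ => secSmoothAt_pullSec hπ hH (hs.2.secSmoothAt univ_mem)⟩

theorem cdorfman_cpull {s t : CSec FM M} (hs : CSmooth FM s) (ht : CSmooth FM t) (q : N) :
    cdorfman FN (cpull FM FN π H s) (cpull FM FN π H t) q =
      cpull FM FN π H (cdorfman FM s t) q := by
  have e : ∀ {x y : GSec FM M}, SmoothOn FM univ x → SmoothOn FM univ y →
      dorfman FN (pullSec FM FN π H x) (pullSec FM FN π H y) q =
        liftAt FM FN π H q (dorfman FM x y (π q)) := fun hx hy =>
    dorfman_pullSec hπ hH (fun p => hx.secSmoothAt univ_mem) (fun p => hy.secSmoothAt univ_mem) q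
  refine Cx.ext ?_ ?_
  · exact (congrArg₂ (· - ·) (e hs.1 ht.1) (e hs.2 ht.2)).trans (map_sub _ _ _).symm
  · exact (congrArg₂ (· + ·) (e hs.1 ht.2) (e hs.2 ht.1)).trans (map_add _ _ _).symm

theorem cdorfman_cpull_vertical {s : CSec FM M} (hs : CSmooth FM s) {c : CSec FN N}
    (hc : reSec c ∈ verticalFraming FN FG G H) (hc' : imSec c ∈ verticalFraming FN FG G H) (q : N) :
    cdorfman FN (cpull FM FN π H s) c q = 0 := by
  have e : ∀ {x : GSec FM M} {c : GSec FN N}, SmoothOn FM univ x →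
      c ∈ verticalFraming FN FG G H → dorfman FN (pullSec FM FN π H x) c q = 0 := fun hx hc =>
    dorfman_pullSec_verticalFraming hπ hH (fun p => hx.secSmoothAt univ_mem) hc q
  refine Cx.ext ?_ ?_
  · exact (congrArg₂ (· - ·) (e hs.1 hc) (e hs.2 hc')).trans (sub_zero _)
  · exact (congrArg₂ (· + ·) (e hs.1 hc') (e hs.2 hc)).trans (add_zero _)

theorem cdorfman_vertical_cpull {s : CSec FM M} (hs : CSmooth FM s) {c : CSec FN N}
    (hc : reSec c ∈ verticalFraming FN FG G H) (hc' : imSec c ∈ verticalFraming FN FG G H) (q : N) :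
    cdorfman FN c (cpull FM FN π H s) q = 0 := by
  have e : ∀ {x : GSec FM M} {c : GSec FN N}, SmoothOn FM univ x →
      c ∈ verticalFraming FN FG G H → dorfman FN c (pullSec FM FN π H x) q = 0 := fun hx hc =>
    dorfman_verticalFraming_pullSec hπ hH (fun p => hx.secSmoothAt univ_mem) hc q
  refine Cx.ext ?_ ?_
  · exact (congrArg₂ (· - ·) (e hs.1 hc) (e hs.2 hc')).trans (sub_zero _)
  · exact (congrArg₂ (· + ·) (e hs.2 hc) (e hs.1 hc')).trans (add_zero _)

theorem cSmooth_vertical {c : CSec FN N} (hc : reSec c ∈ verticalFraming FN FG G H)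
    (hc' : imSec c ∈ verticalFraming FN FG G H) : CSmooth FN c :=
  ⟨smoothOn_of_secSmoothAt fun q _ => secSmoothAt_of_mem_verticalFraming hπ hH hc q,
    smoothOn_of_secSmoothAt fun q _ => secSmoothAt_of_mem_verticalFraming hπ hH hc' q⟩

/-- The cross terms vanish because lifts and the vertical framing commute. Both directions of the
theorem compute brackets on the graph of `φ` with this splitting. -/
theorem cdorfman_cpull_add {s t : CSec FM M} (hs : CSmooth FM s) (ht : CSmooth FM t)
    {c c' : CSec FN N}
    (hc : reSec c ∈ verticalFraming FN FG G H ∧ imSec c ∈ verticalFraming FN FG G H)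
    (hc' : reSec c' ∈ verticalFraming FN FG G H ∧ imSec c' ∈ verticalFraming FN FG G H) (q : N) :
    cdorfman FN (cpull FM FN π H s + c) (cpull FM FN π H t + c') q =
      cpull FM FN π H (cdorfman FM s t) q + cdorfman FN c c' q := by
  have s1 := (hs.cpull hπ hH).cSmoothAt q
  have t1 := (ht.cpull hπ hH).cSmoothAt q
  have c1 := (cSmooth_vertical hπ hH hc.1 hc.2).cSmoothAt q
  have c2 := (cSmooth_vertical hπ hH hc'.1 hc'.2).cSmoothAt q
  rw [cdorfman_add_left s1 c1 (t1.add c2), cdorfman_add_right s1 t1 c2,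
    cdorfman_add_right c1 t1 c2, cdorfman_cpull hπ hH hs ht,
    cdorfman_cpull_vertical hπ hH hs hc'.1 hc'.2, cdorfman_vertical_cpull hπ hH ht hc.1 hc.2,
    add_zero, zero_add]

/-- The complexified vertical framing is closed under the bracket. -/
theorem cdorfman_mem_cframing {a b : csections FN (vertical FM FN π H)}
    (ha : a ∈ cframing FN _ (verticalFraming FN FG G H))
    (hb : b ∈ cframing FN _ (verticalFraming FN FG G H)) :
    ∃ c ∈ cframing FN (vertical FM FN π H) (verticalFraming FN FG G H),
      (c : CSec FN N) = cdorfman FN a b := by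
  have e : ∀ {x y : GSec FN N}, x ∈ verticalFraming FN FG G H → y ∈ verticalFraming FN FG G H →
    dorfman FN x y ∈ verticalFraming FN FG G H := dorfman_mem_verticalFraming hπ hH
  have h1 : reSec (cdorfman FN (a : CSec FN N) b) ∈ verticalFraming FN FG G H :=
    sub_mem (e ha.1 hb.1) (e ha.2 hb.2)
  have h2 : imSec (cdorfman FN (a : CSec FN N) b) ∈ verticalFraming FN FG G H :=
    add_mem (e ha.1 hb.2) (e ha.2 hb.1)
  exact ⟨⟨cdorfman FN a b, cSmooth_vertical hπ hH h1 h2, fun q =>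
    ⟨mem_vertical_of_mem_verticalFraming hπ h1 q, mem_vertical_of_mem_verticalFraming hπ h2 q⟩⟩,
    ⟨h1, h2⟩, rfl⟩

omit hπ hH in
theorem exists_cpull_of_mem_cframing {a : csections FN (pullFam FM FN π H E')}
    (ha : a ∈ cframing FN _ (V.map (pullSec FM FN π H))) :
    ∃ x y : GSec FM M, x ∈ V ∧ y ∈ V ∧ (a : CSec FN N) = cpull FM FN π H (csec x y) := by
  obtain ⟨⟨x, hx, hx'⟩, y, hy, hy'⟩ := ha
  exact ⟨x, y, hx, hy, funext fun q => Cx.ext (congrFun hx' q).symm (congrFun hy' q).symm⟩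

theorem eq_zero_of_mem_pullFam_of_mem_vertical {q : N} {x : GT FN q}
    (hx : x ∈ pullFam FM FN π H E' q) (hx' : x ∈ vertical FM FN π H q) : x = 0 := by
  obtain ⟨u, -, rfl⟩ := hx
  rw [← dropAt_liftAt hπ hH q u, dropAt_vertical hx', map_zero]

variable {J : GEnd FM M} {Ψ : GEnd FN N} (hJ : IsSGF FM E J)
  (hΨ : IsSGF FN (pullFam FM FN π H E' ⊔ vertical FM FN π H) Ψ) (hEE' : Orthogonal FM E E')

include hΨ hEE' in
theorem cliftAt_mem {q : N} {z : Cx (GT FM (π q))} (hz : z ∈ eigenbundle FM E J (π q)) :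
    cliftAt FM FN π H q z ∈ eigenbundle FN (pullFam FM FN π H (E ⊔ E') ⊔ vertical FM FN π H)
      (pullEnd FM FN π H J + Ψ) q := by
  rw [mem_eigenbundle_iff] at hz
  refine mem_eigenbundle_iff.2 ⟨Submodule.mem_sup_left (liftAt_mem_pullFam hπ hH
    (Submodule.mem_sup_left hz.1)), ?_⟩
  refine Eq.trans ?_ (congrArg Neg.neg (sumEnd_liftAt hπ hH hΨ hEE' hz.1)).symm
  exact (congrArg (liftAt FM FN π H q) hz.2).trans (map_neg _ _)

include hJ hEE' in
theorem mem_of_mem_eigenbundle {q : N} {z : Cx (GT FN q)}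
    (hz : z ∈ eigenbundle FN (pullFam FM FN π H E' ⊔ vertical FM FN π H) Ψ q) :
    z ∈ eigenbundle FN (pullFam FM FN π H (E ⊔ E') ⊔ vertical FM FN π H)
      (pullEnd FM FN π H J + Ψ) q := by
  rw [mem_eigenbundle_iff] at hz
  refine mem_eigenbundle_iff.2 ⟨?_, ?_⟩
  · rw [pullFam_sup_vertical FM FN π H]
    exact Submodule.mem_sup_right hz.1
  · rw [sumEnd_apply hπ hH hJ hEE' hz.1]
    exact hz.2

include hΨ hEE' in
theorem cpull_mem {s : CSec FM M} (hs : s ∈ eigensections FM E J) :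
    cpull FM FN π H s ∈ eigensections FN (pullFam FM FN π H (E ⊔ E') ⊔ vertical FM FN π H)
      (pullEnd FM FN π H J + Ψ) :=
  ⟨hs.1.cpull hπ hH, fun q => cliftAt_mem hπ hH hΨ hEE' (hs.2 (π q))⟩

include hJ hΨ hEE' in
-- If the real part has component `e` in `E`, the imaginary part has component `-Je` there. The
-- latter drops to zero, so `Je` lies in `E ∩ E' = 0`, and `e = 0` because `J` is injective on `E`.
theorem dropAt_re_mem {q : N} {z : Cx (GT FN q)} (hz : z ∈ eigenbundle FN
      (pullFam FM FN π H (E ⊔ E') ⊔ vertical FM FN π H) (pullEnd FM FN π H J + Ψ) q)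
    (hz' : dropAt FM FN π H q z.im = 0) : dropAt FM FN π H q z.re ∈ E' (π q) := by
  rw [mem_eigenbundle_iff, pullFam_sup_vertical FM FN π H] at hz
  obtain ⟨h1, h2⟩ := hz
  obtain ⟨_, ⟨e, he, rfl⟩, y, hy, hey⟩ := Submodule.mem_sup.1 h1
  rw [← hey, map_add, sumEnd_liftAt hπ hH hΨ hEE' he, sumEnd_apply hπ hH hJ hEE' hy] at h2
  rw [h2, map_neg, map_add, dropAt_liftAt hπ hH, neg_eq_zero] at hz'
  have h3 : J (π q) e ∈ E' (π q) := by
    rw [eq_neg_of_add_eq_zero_left hz']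
    exact neg_mem (dropAt_mem hπ hH (hΨ.mapsTo _ _ hy))
  have h4 : J (π q) e = 0 :=
    Submodule.disjoint_def.1 (hJ.split.disjoint hEE' _) _ (hJ.mapsTo _ _ he) h3
  rw [← hey, hJ.eq_zero he h4, map_zero, zero_add]
  exact dropAt_mem hπ hH hy

variable {φ : csections FN (pullFam FM FN π H E') ≃ₗ[CFun FN N] csections FN (vertical FM FN π H)}
  (hφ : IsAdmissible FN (V.map (pullSec FM FN π H)) (verticalFraming FN FG G H) Ψ φ)
  (hE' : IsSplit FM E') (hV : IsFraming FM univ E' V)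

include hΨ hφ hE' hV in
/-- The eigenbundle of an admissible structure meets the first summand trivially. -/
theorem IsAdmissible.eigenbundle_inter {q : N} {y : GT FN q} (hy : y ∈ pullFam FM FN π H E' q)
    (hy' : Ψ q y ∈ pullFam FM FN π H E' q) : y = 0 := by
  -- The graph condition concerns global sections, so `y` is extended to one.
  obtain ⟨Y, hY, rfl⟩ := hΨ.split.exists_section (p := q) (x := y) (Submodule.mem_sup_left hy)
  have h1 := hΨ.mem_eigensections hY
  rw [hφ.graph] at h1
  obtain ⟨e, he⟩ := h1
  have h2 := congrFun he q
  have hre : Y q = ((e : CSec FN N) q).re + ((φ e : CSec FN N) q).re := congrArg Cx.re h2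
  have him : -(Ψ q (Y q)) = ((e : CSec FN N) q).im + ((φ e : CSec FN N) q).im :=
    congrArg Cx.im h2
  -- `y`, `Ψ y` and `e` have no vertical component at `q`, so the vertical term `φ e` vanishes
  -- there.
  have h3 : (φ e : CSec FN N) q = 0 := by
    refine Cx.ext ?_ ?_
    · refine eq_zero_of_mem_pullFam_of_mem_vertical hπ hH (E' := E') ?_ ((φ e).2.2 q).1
      rw [← sub_eq_of_eq_add' hre]
      exact sub_mem hy (e.2.2 q).1
    · refine eq_zero_of_mem_pullFam_of_mem_vertical hπ hH (E' := E') ?_ ((φ e).2.2 q).2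
      rw [← sub_eq_of_eq_add' him]
      exact sub_mem (neg_mem hy') (e.2.2 q).2
  rw [hre, h3, hφ.eq_zero hπ hH hE' hV h3]
  exact add_zero _

include hJ hΨ hEE' hφ hE' hV in
/-- An element of the fibre of `𝕋M` whose lift lies in the eigenbundle of the sum lies in the
eigenbundle of `J`. -/
theorem mem_of_cliftAt_mem {q : N} {z : Cx (GT FM (π q))}
    (hz : cliftAt FM FN π H q z ∈ eigenbundle FN
      (pullFam FM FN π H (E ⊔ E') ⊔ vertical FM FN π H) (pullEnd FM FN π H J + Ψ) q) :
    z ∈ eigenbundle FM E J (π q) := by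
  rw [mem_eigenbundle_iff, pullFam_sup_vertical FM FN π H] at hz
  obtain ⟨h1, h2⟩ := hz
  change liftAt FM FN π H q z.re ∈ _ at h1
  change liftAt FM FN π H q z.im = -(_ : GEnd FN N) q (liftAt FM FN π H q z.re) at h2
  obtain ⟨_, ⟨e, he, rfl⟩, y, hy, hey⟩ := Submodule.mem_sup.1 h1
  have hlift : ∀ {y : GT FN q} {u : GT FM (π q)}, liftAt FM FN π H q u = y →
      y ∈ (pullFam FM FN π H E' ⊔ vertical FM FN π H) q → y ∈ pullFam FM FN π H E' q := by
    rintro _ u rfl hu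
    refine liftAt_mem_pullFam hπ hH ?_
    rw [← dropAt_liftAt hπ hH q u]
    exact dropAt_mem hπ hH hu
  rw [← hey, map_add, sumEnd_liftAt hπ hH hΨ hEE' he, sumEnd_apply hπ hH hJ hEE' hy] at h2
  have hy1 : liftAt FM FN π H q (z.re - e) = y := by rw [map_sub, ← hey, add_sub_cancel_left]
  have hy2 : liftAt FM FN π H q (-z.im - J (π q) e) = Ψ q y := by
    rw [map_sub, map_neg, h2]
    abel
  -- Both `y` and `Ψ y` are lifts that lie in the complement of `π^*E`, hence both lie in `π^*E'`.
  have hy0 : y = 0 := hφ.eigenbundle_inter hπ hH hΨ hE' hV (hlift hy1 hy)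
    (hlift hy2 (hΨ.mapsTo _ _ hy))
  rw [hy0] at hy1 hy2
  rw [map_zero] at hy2
  have hinj : ∀ {u : GT FM (π q)}, liftAt FM FN π H q u = 0 → u = 0 := fun hu =>
    (map_eq_zero_iff _ (liftAt_injective hπ hH q)).1 hu
  have e1 : z.re = e := sub_eq_zero.1 (hinj hy1)
  have e2 : -z.im = J (π q) e := sub_eq_zero.1 (hinj hy2)
  refine mem_eigenbundle_iff.2 ⟨e1 ▸ he, ?_⟩
  rw [e1, ← e2, neg_neg]

end Lift

/-! ### Closure on the total space implies the normal pair and the Lie isomorphism -/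

section Main

variable {FM FN FG : Type*} [NormedAddCommGroup FM] [NormedSpace ℝ FM] [FiniteDimensional ℝ FM]
  [NormedAddCommGroup FN] [NormedSpace ℝ FN] [FiniteDimensional ℝ FN]
  [NormedAddCommGroup FG] [NormedSpace ℝ FG] [FiniteDimensional ℝ FG]
  {M : Type*} [TopologicalSpace M] [ChartedSpace FM M] [IsManifold 𝓘(ℝ, FM) ∞ M] [T2Space M]
  {N : Type*} [TopologicalSpace N] [ChartedSpace FN N] [IsManifold 𝓘(ℝ, FN) ∞ N] [T2Space N]
  {G : Type*} [TopologicalSpace G] [ChartedSpace FG G] [Group G] [LieGroup 𝓘(ℝ, FG) ∞ G]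
  [MulAction Gᵐᵒᵖ N] {π : N → M} {H : Distribution FN N}
  (hπ : IsPrincipalBundle FM FN FG G π) (hH : IsFlatConnection FM FN FG G π H)
  {E E' : GFam FM M} {V : Submodule ℝ (GSec FM M)} {J : GEnd FM M} {Ψ : GEnd FN N}
  (hJ : IsSGF FM E J)
  (hΨ : IsSGF FN (pullFam FM FN π H E' ⊔ vertical FM FN π H) Ψ) (hEE' : Orthogonal FM E E')
  {φ : csections FN (pullFam FM FN π H E') ≃ₗ[CFun FN N] csections FN (vertical FM FN π H)}
  (hφ : IsAdmissible FN (V.map (pullSec FM FN π H)) (verticalFraming FN FG G H) Ψ φ)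
  (hE' : IsSplit FM E') (hV : IsFraming FM univ E' V)

include hπ hH

theorem coe_pullFramingElt (v : V) : (pullFramingElt hπ hH hV v : CSec FN N) =
    cpull FM FN π H (csec v 0) :=
  funext fun q => Cx.ext rfl (map_zero (liftAt FM FN π H q)).symm

omit hπ hH in
include hφ in
theorem IsAdmissible.map_mem {a : csections FN (pullFam FM FN π H E')}
    (ha : a ∈ cframing FN _ (V.map (pullSec FM FN π H))) :
    φ a ∈ cframing FN _ (verticalFraming FN FG G H) := by
  rw [← hφ.map_framing]
  exact mem_image_of_mem _ ha

omit hπ hH in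
include hφ in
theorem IsAdmissible.symm_mem {a : csections FN (vertical FM FN π H)}
    (ha : a ∈ cframing FN _ (verticalFraming FN FG G H)) :
    φ.symm a ∈ cframing FN _ (V.map (pullSec FM FN π H)) := by
  rw [← hφ.map_framing] at ha
  obtain ⟨b, hb, rfl⟩ := ha
  rwa [LinearEquiv.symm_apply_apply]

omit hπ hH in
include hφ in
theorem IsAdmissible.symm_image : φ.symm '' cframing FN _ (verticalFraming FN FG G H) =
    cframing FN _ (V.map (pullSec FM FN π H)) := by
  rw [← hφ.map_framing, ← image_comp]
  simp

include hJ hEE' hφ in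
theorem IsAdmissible.add_mem_sum (e : csections FN (pullFam FM FN π H E')) :
    (e : CSec FN N) + (φ e : CSec FN N) ∈ eigensections FN
      (pullFam FM FN π H (E ⊔ E') ⊔ vertical FM FN π H) (pullEnd FM FN π H J + Ψ) := by
  have h := hφ.add_mem e
  exact ⟨h.1, fun q => mem_of_mem_eigenbundle hπ hH hJ hEE' (h.2 q)⟩

omit hπ hH in
include hV in
theorem IsFraming.cSmooth {x y : GSec FM M} (hx : x ∈ V) (hy : y ∈ V) :
    CSmooth FM (csec x y) := ⟨(hV.2.2.1 x hx).1, (hV.2.2.1 y hy).1⟩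

include hφ hV in
/-- The bracket of a section `v + φ(v)` with a lifted section. -/
theorem cdorfman_add_map_cpull (v : V) {s : CSec FM M} (hs : CSmooth FM s) (q : N) :
    cdorfman FN ((pullFramingElt hπ hH hV v : CSec FN N) + (φ (pullFramingElt hπ hH hV v) : CSec FN N))
      (cpull FM FN π H s) q = cpull FM FN π H (cdorfman FM (csec v 0) s) q := by
  have hc := hφ.map_mem (pullFramingElt_mem hπ hH hV v)
  have hv : CSmooth FM (csec (v : GSec FM M) 0) := hV.cSmooth v.2 (zero_mem V)
  rw [coe_pullFramingElt, cdorfman_add_left ((hv.cpull hπ hH).cSmoothAt q)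
    ((cSmooth_vertical hπ hH hc.1 hc.2).cSmoothAt q) ((hs.cpull hπ hH).cSmoothAt q),
    cdorfman_cpull hπ hH hv hs, cdorfman_vertical_cpull hπ hH hs hc.1 hc.2, add_zero]

section Forward

variable (hcrf : IsCRF FN (pullFam FM FN π H (E ⊔ E') ⊔ vertical FM FN π H)
  (pullEnd FM FN π H J + Ψ))

include hJ hΨ hEE' hφ hE' hV hcrf

/-- The bracket of two lifted sections of `L_J` is a lift lying in the large eigenbundle, hence a
lift from `L_J`; surjectivity of `π` reaches every point of `M`. -/
theorem isCRF_of_isCRF_sum : IsCRF FM E J := by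
  refine ⟨hJ, fun s hs t ht p => ?_⟩
  obtain ⟨q, rfl⟩ := hπ.surjective p
  have h := hcrf.2 _ (cpull_mem hπ hH hΨ hEE' hs) _ (cpull_mem hπ hH hΨ hEE' ht) q
  rw [cdorfman_cpull hπ hH hs.1 ht.1] at h
  exact mem_of_cliftAt_mem hπ hH hJ hΨ hEE' hφ hE' hV h

/-- The vertical part of `v + φ(v)` commutes with lifts, so its bracket with the lift of `s` is the
lift of `[v, s]`. -/
theorem mem_normalizerSGF_of_isCRF_sum {v : GSec FM M} (hv : v ∈ V) :
    csec v 0 ∈ normalizerSGF FM E J := by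
  refine ⟨hV.cSmooth hv (zero_mem V), fun s hs p => ?_⟩
  obtain ⟨q, rfl⟩ := hπ.surjective p
  have h := hcrf.2 _ (hφ.add_mem_sum hπ hH hJ hEE' (pullFramingElt hπ hH hV ⟨v, hv⟩)) _
    (cpull_mem hπ hH hΨ hEE' hs) q
  rw [cdorfman_add_map_cpull hπ hH hφ hV ⟨v, hv⟩ hs.1] at h
  exact mem_of_cliftAt_mem hπ hH hJ hΨ hEE' hφ hE' hV h

/-- The bracket of `v + φ(v)` and `w + φ(w)` is the lift of the real section `[v, w]` plus a
vertical section. Its imaginary part is vertical, so `dropAt_re_mem` applies to its real part. -/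
theorem dorfman_mem_of_isCRF_sum {v w : GSec FM M} (hv : v ∈ V) (hw : w ∈ V) (p : M) :
    dorfman FM v w p ∈ E' p := by
  obtain ⟨q, rfl⟩ := hπ.surjective p
  have h := hcrf.2 _ (hφ.add_mem_sum hπ hH hJ hEE' (pullFramingElt hπ hH hV ⟨v, hv⟩)) _
    (hφ.add_mem_sum hπ hH hJ hEE' (pullFramingElt hπ hH hV ⟨w, hw⟩)) q
  have cv := hφ.map_mem (pullFramingElt_mem hπ hH hV ⟨v, hv⟩)
  have cw := hφ.map_mem (pullFramingElt_mem hπ hH hV ⟨w, hw⟩)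
  obtain ⟨c, -, hc⟩ := cdorfman_mem_cframing hπ hH cv cw
  have hcv := c.2.2 q
  rw [coe_pullFramingElt, coe_pullFramingElt,
    cdorfman_cpull_add hπ hH (hV.cSmooth hv (zero_mem V)) (hV.cSmooth hw (zero_mem V)) cv cw,
    ← hc] at h
  have e : cpull FM FN π H (cdorfman FM (csec v 0) (csec w 0)) q =
      Cx.mk (liftAt FM FN π H q (dorfman FM v w (π q))) 0 := by
    show cliftAt FM FN π H q (cdorfman FM (csec v 0) (csec w 0) (π q)) = _
    rw [cdorfman_real ((hV.2.2.1 v hv).1.secSmoothAt univ_mem)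
      ((hV.2.2.1 w hw).1.secSmoothAt univ_mem)]
    exact Cx.ext rfl (map_zero (liftAt FM FN π H q))
  rw [e] at h
  have h2 := dropAt_re_mem hπ hH hJ hΨ hEE' h (by
    rw [Cx.im_add, map_add, dropAt_vertical hcv.2, add_zero]
    exact map_zero _)
  rw [Cx.re_add, map_add, dropAt_vertical hcv.1, add_zero, Cx.re_mk, dropAt_liftAt hπ hH] at h2
  exact h2

/-- `V` generates the sections of `E'`, and by the Leibniz rule brackets within `V` decide. -/
theorem mem_normalizer_of_isCRF_sum {v : GSec FM M} (hv : v ∈ V) :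
    v ∈ normalizer FM univ E' := by
  have hv1 : ∀ {v}, v ∈ V → ∀ p, SecSmoothAt FM v p := fun hv p =>
    (hV.2.2.1 _ hv).1.secSmoothAt univ_mem
  refine ⟨(hV.2.2.1 v hv).1, fun s hs p _ => ?_⟩
  obtain ⟨n, f, w, hfw, hsw⟩ := hV.2.2.2 s hs
  have hs' : s = fun q => ∑ i, f i q • w i q := funext fun q => hsw q (mem_univ q)
  have hf : ∀ i, FunSmoothAt FM (f i) p := fun i => (hfw i).1.contMDiffAt univ_mem
  have key : ∀ A : Finset (Fin n), dorfman FM v (fun q => ∑ i ∈ A, f i q • w i q) p ∈ E' p := by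
    intro A
    classical
    induction A using Finset.induction_on with
    | empty =>
      have := dorfman_zero_right (hv1 hv p)
      exact (congrArg (· ∈ E' p) this).mpr (zero_mem _)
    | insert i A hi ih =>
      have e : (fun q => ∑ j ∈ insert i A, f j q • w j q) =
          (fun q => f i q • w i q) + fun q => ∑ j ∈ A, f j q • w j q :=
        funext fun q => Finset.sum_insert hi
      rw [e, dorfman_add_right (hv1 hv p) ((hv1 (hfw i).2 p).smul (hf i))
        (SecSmoothAt.sum fun j _ => (hv1 (hfw j).2 p).smul (hf j)),
        dorfman_smul_right (hv1 hv p) (hv1 (hfw i).2 p) (hf i)]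
      exact add_mem (add_mem (Submodule.smul_mem _ _ (dorfman_mem_of_isCRF_sum hπ hH hJ hΨ hEE' hφ
        hE' hV hcrf hv (hfw i).2 p)) (Submodule.smul_mem _ _
        ((hV.2.2.1 _ (hfw i).2).2 p (mem_univ p)))) ih
  rw [hs']
  exact key Finset.univ

/-- The inverse of the admissible isomorphism preserves the bracket. -/
theorem symm_bracket_of_isCRF_sum {a b : csections FN (pullFam FM FN π H E')}
    (ha : a ∈ cframing FN _ (V.map (pullSec FM FN π H)))
    (hb : b ∈ cframing FN _ (V.map (pullSec FM FN π H))) {c : csections FN (vertical FM FN π H)}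
    (hc : c ∈ cframing FN _ (verticalFraming FN FG G H))
    (hcab : (c : CSec FN N) = cdorfman FN (φ a) (φ b)) :
    (φ.symm c : CSec FN N) = cdorfman FN a b := by
  have va := hφ.map_mem ha
  have vb := hφ.map_mem hb
  have h1 := hcrf.2 _ (hφ.add_mem_sum hπ hH hJ hEE' a) _ (hφ.add_mem_sum hπ hH hJ hEE' b)
  have h2 := hφ.add_mem_sum hπ hH hJ hEE' (φ.symm c)
  rw [LinearEquiv.apply_symm_apply] at h2
  obtain ⟨x, x', hx, hx', hxa⟩ := exists_cpull_of_mem_cframing ha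
  obtain ⟨y, y', hy, hy', hyb⟩ := exists_cpull_of_mem_cframing hb
  obtain ⟨z, z', hz, hz', hzc⟩ := exists_cpull_of_mem_cframing (hφ.symm_mem hc)
  have sx := hV.cSmooth hx hx'
  have sy := hV.cSmooth hy hy'
  rw [hzc, hxa, hyb]
  funext q
  have h1q := h1 q
  rw [hxa, hyb, cdorfman_cpull_add hπ hH sx sy va vb, ← hcab] at h1q
  have h2q := h2.2 q
  rw [hzc] at h2q
  have hbig := hJ.sumEnd hπ hH hΨ hEE'
  -- Both elements have the same vertical part `c`, so their difference is a lift.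
  have h3 := (hbig.eigenSubmodule q).sub_mem h1q h2q
  have h4 : cliftAt FM FN π H q (cdorfman FM (csec x x') (csec y y') (π q) -
      csec z z' (π q)) ∈ hbig.eigenSubmodule q := by
    rw [cliftAt_sub]
    refine (congrArg (· ∈ hbig.eigenSubmodule q) ?_).mp h3
    exact add_sub_add_right_eq_sub _ _ _
  have h5 := mem_of_cliftAt_mem hπ hH hJ hΨ hEE' hφ hE' hV h4
  have hm : ∀ {v w}, v ∈ V → w ∈ V → dorfman FM v w (π q) ∈ E' (π q) := fun hv hw =>
    dorfman_mem_of_isCRF_sum hπ hH hJ hΨ hEE' hφ hE' hV hcrf hv hw (π q)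
  -- The difference lies in `L_J` while its real part lies in `E'`, which meets `E` trivially.
  have h6 := eq_zero_of_mem_eigenbundle hJ.split hEE' h5 (by
    rw [Cx.re_sub]
    exact sub_mem (sub_mem (hm hx hy) (hm hx' hy')) ((hV.2.2.1 z hz).2 _ (mem_univ _)))
  rw [cdorfman_cpull hπ hH sx sy]
  exact congrArg (cliftAt FM FN π H q) (sub_eq_zero.1 h6).symm

theorem isNormalPair_of_isCRF_sum : IsNormalPair FM E E' J V :=
  ⟨isCRF_of_isCRF_sum hπ hH hJ hΨ hEE' hφ hE' hV hcrf, hE', hEE', hV,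
    fun _ hv => mem_normalizerSGF_of_isCRF_sum hπ hH hJ hΨ hEE' hφ hE' hV hcrf hv,
    fun _ hv => mem_normalizer_of_isCRF_sum hπ hH hJ hΨ hEE' hφ hE' hV hcrf hv⟩

theorem isLieIso_of_isCRF_sum :
    IsLieIso FN (verticalFraming FN FG G H) (V.map (pullSec FM FN π H)) φ.symm := by
  have key := fun {a b} => symm_bracket_of_isCRF_sum hπ hH hJ hΨ hEE' hφ hE' hV hcrf (a := a) (b := b)
  refine ⟨fun a ha b hb => cdorfman_mem_cframing hπ hH ha hb, fun a ha b hb => ?_,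
    hφ.symm_image, fun a ha b hb c hc hcab => ?_⟩
  · obtain ⟨c, hc, hcab⟩ := cdorfman_mem_cframing hπ hH (hφ.map_mem ha) (hφ.map_mem hb)
    exact ⟨φ.symm c, hφ.symm_mem hc, key ha hb hc hcab⟩
  · refine key (hφ.symm_mem ha) (hφ.symm_mem hb) hc ?_
    rw [LinearEquiv.apply_symm_apply, LinearEquiv.apply_symm_apply]
    exact hcab

end Forward

end Main

/-! ### A normal pair and a Lie isomorphism imply closure on the total space -/

section Backward

variable {FM FN FG : Type*} [NormedAddCommGroup FM] [NormedSpace ℝ FM] [FiniteDimensional ℝ FM]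
  [NormedAddCommGroup FN] [NormedSpace ℝ FN] [FiniteDimensional ℝ FN]
  [NormedAddCommGroup FG] [NormedSpace ℝ FG] [FiniteDimensional ℝ FG]
  {M : Type*} [TopologicalSpace M] [ChartedSpace FM M] [IsManifold 𝓘(ℝ, FM) ∞ M] [T2Space M]
  {N : Type*} [TopologicalSpace N] [ChartedSpace FN N] [IsManifold 𝓘(ℝ, FN) ∞ N] [T2Space N]
  {G : Type*} [TopologicalSpace G] [ChartedSpace FG G] [Group G] [LieGroup 𝓘(ℝ, FG) ∞ G]
  [MulAction Gᵐᵒᵖ N] {π : N → M} {H : Distribution FN N}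
  (hπ : IsPrincipalBundle FM FN FG G π) (hH : IsFlatConnection FM FN FG G π H)
  {E E' : GFam FM M} {V : Submodule ℝ (GSec FM M)} {J : GEnd FM M} {Ψ : GEnd FN N}
  (hJ : IsSGF FM E J)
  (hΨ : IsSGF FN (pullFam FM FN π H E' ⊔ vertical FM FN π H) Ψ) (hEE' : Orthogonal FM E E')
  {φ : csections FN (pullFam FM FN π H E') ≃ₗ[CFun FN N] csections FN (vertical FM FN π H)}
  (hφ : IsAdmissible FN (V.map (pullSec FM FN π H)) (verticalFraming FN FG G H) Ψ φ)
  (hE' : IsSplit FM E') (hV : IsFraming FM univ E' V)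

variable (J φ) in
/-- The sections of the eigenbundle of the sum that come from a section of `L_J` or from an element
of the framing. -/
def IsGenerator (σ : CSec FN N) : Prop :=
  (∃ w ∈ eigensections FM E J, σ = cpull FM FN π H w) ∨
    ∃ v : V, σ = (pullFramingElt hπ hH hV v : CSec FN N) +
      (φ (pullFramingElt hπ hH hV v) : CSec FN N)

include hπ hH hJ hΨ hEE' hφ

theorem IsGenerator.mem {σ : CSec FN N} (hσ : IsGenerator hπ hH (E := E) J φ hV σ) :
    σ ∈ eigensections FN (pullFam FM FN π H (E ⊔ E') ⊔ vertical FM FN π H)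
      (pullEnd FM FN π H J + Ψ) := by
  rcases hσ with ⟨w, hw, rfl⟩ | ⟨v, rfl⟩
  · exact cpull_mem hπ hH hΨ hEE' hw
  · exact hφ.add_mem_sum hπ hH hJ hEE' _

include hE' in
/-- Locally, sections of the eigenbundle are combinations of generators. -/
theorem exists_eq_sum_generators {s : CSec FN N} (hs : s ∈ eigensections FN
      (pullFam FM FN π H (E ⊔ E') ⊔ vertical FM FN π H) (pullEnd FM FN π H J + Ψ)) (q₀ : N) :
    ∃ (r d : ℕ) (σ : Fin r ⊕ Fin d → CSec FN N) (g : Fin r ⊕ Fin d → N → ℂ),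
      (∀ i, IsGenerator hπ hH (E := E) J φ hV (σ i)) ∧
      (∀ i, FunSmoothAt FN (fun q => (g i q).re) q₀) ∧
      (∀ i, FunSmoothAt FN (fun q => (g i q).im) q₀) ∧
      ∀ᶠ q in 𝓝 q₀, s q = ∑ i, g i q • σ i q := by
  -- A section of an eigenbundle is determined by its real part, so it suffices to decompose that.
  obtain ⟨W, r, e, c, y, hW, hq₀, he, hc, hy, hsq⟩ := exists_decomposition hπ hH hEE' hJ.split
    isOpen_univ (re_mem_sections hs) (mem_univ q₀)
  -- The complementary part is made global so that `Y - iΨY` is on the graph of `φ`.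
  obtain ⟨Y, hY, hYy⟩ := exists_global_section hW hy hq₀
  have hYe := hΨ.mem_eigensections hY
  rw [hφ.graph] at hYe
  obtain ⟨a, ha⟩ := hYe
  obtain ⟨d, v, f, hf⟩ := exists_eq_sum_pullFraming hπ hH hE' hV a
  have hφa : φ a = ∑ k, f k • φ (pullFramingElt hπ hH hV (v k)) := by
    rw [hf, map_sum]
    simp only [map_smul]
  let τ : Fin d → CSec FN N := fun k => (pullFramingElt hπ hH hV (v k) : CSec FN N) +
    (φ (pullFramingElt hπ hH hV (v k)) : CSec FN N)
  let u : Fin r → CSec FM M := fun i => csec (e i) fun p => -(J p (e i p))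
  have hYsum : ∀ q, Cx.mk (Y q) (-(Ψ q (Y q))) = ∑ k, f k q • τ k q := by
    intro q
    have h1 : Cx.mk (Y q) (-(Ψ q (Y q))) = (a : CSec FN N) q + (φ a : CSec FN N) q :=
      congrFun ha q
    rw [h1, hφa, hf, Submodule.coe_sum, Submodule.coe_sum, Finset.sum_apply, Finset.sum_apply,
      ← Finset.sum_add_distrib]
    exact Finset.sum_congr rfl fun k _ => (smul_add (f k q)
      ((pullFramingElt hπ hH hV (v k) : CSec FN N) q)
      ((φ (pullFramingElt hπ hH hV (v k)) : CSec FN N) q)).symm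
  refine ⟨r, d, Sum.elim (fun i => cpull FM FN π H (u i)) τ,
    Sum.elim (fun i q => (c i q : ℂ)) fun k q => f k q, ?_, ?_, ?_, ?_⟩
  · rintro (i | k)
    · exact Or.inl ⟨_, hJ.mem_eigensections (he i), rfl⟩
    · exact Or.inr ⟨v k, rfl⟩
  · rintro (i | k)
    · exact hc i q₀ hq₀
    · exact (CFun.smooth_re FN (f k)).contMDiffAt univ_mem
  · rintro (i | k)
    · exact contMDiffAt_const
    · exact (CFun.smooth_im FN (f k)).contMDiffAt univ_mem
  · filter_upwards [hW.mem_nhds hq₀, hYy] with q hq hqY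
    rw [Fintype.sum_sum_type]
    refine Eq.trans ?_ (congrArg (_ + ·) (hYsum q))
    have h1 := mem_eigenbundle_iff.1 (hs.2 q)
    have h2 : (s q).re = ∑ i, c i q • pullSec FM FN π H (e i) q + Y q := by
      rw [hqY]
      exact hsq q hq
    have h3 : ∀ i, (c i q : ℂ) • cpull FM FN π H (u i) q =
        Cx.mk (c i q • pullSec FM FN π H (e i) q)
          (-(c i q • liftAt FM FN π H q (J (π q) (e i (π q))))) := by
      intro i
      refine Cx.ext ?_ ?_
      · rw [Cx.re_smul, Complex.ofReal_re, Complex.ofReal_im, zero_smul, sub_zero]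
        rfl
      · rw [Cx.im_smul, Complex.ofReal_re, Complex.ofReal_im, zero_smul, add_zero]
        refine (congrArg (c i q • ·) (map_neg (liftAt FM FN π H q) _)).trans (smul_neg _ _)
    simp only [Sum.elim_inl, h3]
    refine Cx.ext ?_ ?_
    · rw [Cx.re_add, Cx.re_sum, h2]
      rfl
    · rw [Cx.im_add, Cx.im_sum, h1.2, h2, map_add, map_sum,
        sumEnd_apply hπ hH hJ hEE' (hY.2 q (mem_univ q)), neg_add]
      simp only [Cx.im_mk, Finset.sum_neg_distrib, map_smul]
      refine congrArg (fun z => -z + -(Ψ q (Y q))) (Finset.sum_congr rfl fun i _ => ?_)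
      exact congrArg _ (sumEnd_liftAt hπ hH hΨ hEE' ((he i).2 _ (mem_univ _)))

/-- The bracket of two generators is a section of the eigenbundle. -/
theorem IsGenerator.cdorfman_mem (hJV : IsNormalPair FM E E' J V)
    (hLie : IsLieIso FN (verticalFraming FN FG G H) (V.map (pullSec FM FN π H)) φ.symm)
    {σ τ : CSec FN N} (hσ : IsGenerator hπ hH (E := E) J φ hV σ)
    (hτ : IsGenerator hπ hH (E := E) J φ hV τ) (q : N) :
    cdorfman FN σ τ q ∈ eigenbundle FN (pullFam FM FN π H (E ⊔ E') ⊔ vertical FM FN π H)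
      (pullEnd FM FN π H J + Ψ) q := by
  have hbig := hJ.sumEnd hπ hH hΨ hEE'
  have hmix : ∀ (v : V) {w : CSec FM M}, w ∈ eigensections FM E J →
      cdorfman FN ((pullFramingElt hπ hH hV v : CSec FN N) +
        (φ (pullFramingElt hπ hH hV v) : CSec FN N)) (cpull FM FN π H w) q ∈
        hbig.eigenSubmodule q := by
    intro v w hw
    rw [cdorfman_add_map_cpull hπ hH hφ hV v hw.1]
    exact cliftAt_mem hπ hH hΨ hEE' ((hJV.normalizes_J v v.2).2 w hw (π q))
  rcases id hσ with ⟨w, hw, rfl⟩ | ⟨v, rfl⟩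
  · rcases id hτ with ⟨w', hw', rfl⟩ | ⟨v', rfl⟩
    · rw [cdorfman_cpull hπ hH hw.1 hw'.1]
      exact cliftAt_mem hπ hH hΨ hEE' (hJV.crf.2 w hw w' hw' (π q))
    -- The normalizer condition has the framing element on the left; skew-symmetry on the isotropic
    -- eigenbundle restores this order.
    · rw [hbig.cdorfman_swap (hσ.mem hπ hH hJ hΨ hEE' hφ hV) (hτ.mem hπ hH hJ hΨ hEE' hφ hV)]
      exact (hbig.eigenSubmodule q).neg_mem (hmix v' hw)
  · rcases id hτ with ⟨w', hw', rfl⟩ | ⟨v', rfl⟩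
    · exact hmix v hw'
    · have cv := hφ.map_mem (pullFramingElt_mem hπ hH hV v)
      have cv' := hφ.map_mem (pullFramingElt_mem hπ hH hV v')
      obtain ⟨c, hc, hcv⟩ := hLie.closed_left _ cv _ cv'
      have h1 := hLie.map_bracket _ cv _ cv' c hc hcv
      rw [LinearEquiv.symm_apply_apply, LinearEquiv.symm_apply_apply] at h1
      have h2 := (hφ.add_mem_sum hπ hH hJ hEE' (φ.symm c)).2 q
      rw [LinearEquiv.apply_symm_apply] at h2
      have sv := hV.cSmooth v.2 (zero_mem V)
      have sv' := hV.cSmooth v'.2 (zero_mem V)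
      -- The Lie isomorphism identifies the lift of `[v, v']` with `φ.symm c`, which puts the
      -- bracket on the graph of `φ`.
      have h3 : cdorfman FN ((pullFramingElt hπ hH hV v : CSec FN N) +
          (φ (pullFramingElt hπ hH hV v) : CSec FN N)) ((pullFramingElt hπ hH hV v' : CSec FN N) +
          (φ (pullFramingElt hπ hH hV v') : CSec FN N)) q =
          ((φ.symm c : CSec FN N) + (c : CSec FN N)) q := by
        rw [coe_pullFramingElt, coe_pullFramingElt, cdorfman_cpull_add hπ hH sv sv' cv cv', ← hcv,
          ← cdorfman_cpull hπ hH sv sv', ← coe_pullFramingElt hπ hH hV,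
          ← coe_pullFramingElt hπ hH hV, ← h1]
        rfl
      rw [h3]
      exact h2

include hπ hH hE' hV in
-- The Leibniz rule is available in the right slot only. Expanding there, swapping the arguments by
-- skew-symmetry and expanding again reduces closure to pairs of generators.
theorem isCRF_sum (hJV : IsNormalPair FM E E' J V)
    (hLie : IsLieIso FN (verticalFraming FN FG G H) (V.map (pullSec FM FN π H)) φ.symm) :
    IsCRF FN (pullFam FM FN π H (E ⊔ E') ⊔ vertical FM FN π H) (pullEnd FM FN π H J + Ψ) := by
  have hbig := hJ.sumEnd hπ hH hΨ hEE'
  have hgm : ∀ {σ}, IsGenerator hπ hH (E := E) J φ hV σ → _ := fun hσ =>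
    hσ.mem hπ hH hJ hΨ hEE' hφ hV
  have expand : ∀ {s t : CSec FN N} (q : N), s ∈ eigensections FN
      (pullFam FM FN π H (E ⊔ E') ⊔ vertical FM FN π H) (pullEnd FM FN π H J + Ψ) →
      t ∈ eigensections FN
      (pullFam FM FN π H (E ⊔ E') ⊔ vertical FM FN π H) (pullEnd FM FN π H J + Ψ) →
      (∀ τ, IsGenerator hπ hH (E := E) J φ hV τ → cdorfman FN s τ q ∈ hbig.eigenSubmodule q) →
      cdorfman FN s t q ∈ hbig.eigenSubmodule q := by
    intro s t q hs ht h
    obtain ⟨r, d, σ, g, hσ, hr, hi, hsum⟩ :=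
      exists_eq_sum_generators hπ hH hJ hΨ hEE' hφ hE' hV ht q
    rw [cdorfman_congr (Eventually.of_forall fun _ => rfl) hsum]
    exact (cdorfman_sum_mem Finset.univ (hbig.eigenSubmodule q) (hs.1.cSmoothAt q)
      (fun i _ => (hgm (hσ i)).1.cSmoothAt q) (fun i _ => hr i) (fun i _ => hi i)
      (fun i _ => (hgm (hσ i)).2 q) fun i _ => h _ (hσ i)).2
  refine ⟨hbig, fun s hs t ht q => expand q hs ht fun τ hτ => ?_⟩
  rw [hbig.cdorfman_swap hs (hgm hτ)]
  exact (hbig.eigenSubmodule q).neg_mem (expand q (hgm hτ) hs fun σ hσ =>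
    hτ.cdorfman_mem hπ hH hJ hΨ hEE' hφ hV hJV hLie hσ q)

end Backward

end GenGeom

end

theorem mainTheorem7
    {FM FN FG : Type*}
    [NormedAddCommGroup FM] [NormedSpace ℝ FM] [FiniteDimensional ℝ FM]
    [NormedAddCommGroup FN] [NormedSpace ℝ FN] [FiniteDimensional ℝ FN]
    [NormedAddCommGroup FG] [NormedSpace ℝ FG] [FiniteDimensional ℝ FG]
    {M : Type*} [TopologicalSpace M] [ChartedSpace FM M] [IsManifold 𝓘(ℝ, FM) ∞ M]
    [T2Space M] [SecondCountableTopology M]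
    {N : Type*} [TopologicalSpace N] [ChartedSpace FN N] [IsManifold 𝓘(ℝ, FN) ∞ N]
    [T2Space N] [SecondCountableTopology N]
    {G : Type*} [TopologicalSpace G] [ChartedSpace FG G] [Group G] [LieGroup 𝓘(ℝ, FG) ∞ G]
    [MulAction Gᵐᵒᵖ N]
    (π : N → M) (hπ : IsPrincipalBundle FM FN FG G π)
    (H : Distribution FN N) (hH : IsFlatConnection FM FN FG G π H)
    (E E' : GFam FM M) (hE : IsSplit FM E) (hE' : IsSplit FM E') (hEE' : Orthogonal FM E E')
    (J : GEnd FM M) (hJ : IsSGF FM E J)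
    (V : Submodule ℝ (GSec FM M)) (hV : IsFraming FM Set.univ E' V)
    (hVE : ∀ v ∈ V, v ∈ normalizer FM Set.univ (E ⊔ E'))
    (hW : HasAdaptedLocalFramings FM E (E ⊔ E') J)
    (Ψ : GEnd FN N) (hΨ : IsSGF FN (pullFam FM FN π H E' ⊔ vertical FM FN π H) Ψ)
    (φ : csections FN (pullFam FM FN π H E') ≃ₗ[CFun FN N] csections FN (vertical FM FN π H))
    (hφ : IsAdmissible FN (V.map (pullSec FM FN π H)) (verticalFraming FN FG G H) Ψ φ) :
    IsCRF FN (pullFam FM FN π H (E ⊔ E') ⊔ vertical FM FN π H) (pullEnd FM FN π H J + Ψ) ↔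
      IsNormalPair FM E E' J V ∧
        IsLieIso FN (verticalFraming FN FG G H) (V.map (pullSec FM FN π H)) φ.symm := by
  constructor
  · intro hcrf
    exact ⟨isNormalPair_of_isCRF_sum hπ hH hJ hΨ hEE' hφ hE' hV hcrf,
      isLieIso_of_isCRF_sum hπ hH hJ hΨ hEE' hφ hE' hV hcrf⟩
  · rintro ⟨hJV, hLie⟩
    exact isCRF_sum hπ hH hJ hΨ hEE' hφ hE' hV hJV hLie
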